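/- Let $N\ge 2$, $n=\lfloor N/2\rfloor$, $i'=N-i+1$. Let $q\in\mathbb C\setminus\{0\}$ be not a root of unity, and fix a square root $q^{1/2}$. Put $\rho_i=\frac N2-i$ and $\rho_{i'}=-\rho_i$ for $1\le i\le n$, and $\rho_{n+1}=0$ if $N=2n+1$. Write $[a]=\frac{1-q^a}{1-q}$, $[a]_q=\frac{q^a-q^{-a}}{q-q^{-1}}$ and $(a;b)_k=\prod_{j=0}^{k-1}(1-ab^j)$. Let $\mathcal A=\mathbb C_q[x_1,\dots,x_N]$ be the associative unital algebra generated by $x_1,\dots,x_N$ with the relations $$x_ix_j=q\,x_jx_i\quad(i<j,\ i\ne j'),\qquad x_{i'}x_i-x_ix_{i'}=\frac{q-q^{-1}}{q^{\rho_i-1}+q^{-\rho_i+1}}\sum_{j=i+1}^{(i+1)'}q^{\rho_{j'}}x_jx_{j'}\quad(i<n),$$ $$x_{n'}x_n-x_nx_{n'}=(q^{1/2}-q^{-1/2})x_{n+1}^2\ \text{ if }N=2n+1,\qquad x_{n'}x_n=x_nx_{n'}\ \text{ if }N=2n .$$ The monomials $\mathbf x^\nu=x_1^{\nu_1}\cdots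 x_N^{\nu_N}$ form a basis of $\mathcal A$; let $\mathcal A_m$ be the span of those with $\nu_1+\dots+\nu_N=m$ (and $\mathcal A_{-1}=\mathcal A_{-2}=0$). Define linear operators $\partial_k$ on $\mathcal A$ by $$\partial_k\mathbf x^\nu=[\nu_k]_q\,q^{\nu_{k+1}+\dots+\nu_N}\mathbf x^{\nu-\varepsilon_k}\quad(k\le n),\qquad \partial_{n+1}\mathbf x^\nu=[\nu_{n+1}]\,q^{\nu_{n+2}+\dots+\nu_N}\mathbf x^{\nu-\varepsilon_{n+1}}\quad(N=2n+1),$$ $$\partial_{k'}\mathbf x^\nu=[\nu_{k'}]_q\,q^{\nu_k+\nu_{(k-1)'}+\dots+\nu_{1'}}\mathbf x^{\nu-\varepsilon_{k'}}+\sum_{j=k+1}^n[\nu_j]_q[\nu_{j'}]_q(q-q^{-1})q^{\rho_k-\rho_j+d_{kj}}\mathbf x^{\nu+\varepsilon_k-\varepsilon_j-\varepsilon_{j'}}$$ $$\qquad+[\nu_{n+1}-1][\nu_{n+1}]\frac{q-q^{-1}}{1+q}\,q^{\rho_k+2+e_k}\,\mathbf x^{\nu+\varepsilon_k-2\varepsilon_{n+1}}\quad(k\le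 n),$$ where $d_{kj}=\nu_k+\dots+\nu_{j-1}+\nu_{(j-1)'}+\dots+\nu_{1'}$, $e_k=\nu_k+\dots+\nu_{1'}-2\nu_{n+1}$, and the last summand is omitted if $N=2n$. Put $$Q=\sum_{i=1}^Nq^{\rho_{i'}}x_ix_{i'},\qquad \hat Q\,p=Qp,\qquad \Delta_q=\sum_{i=1}^Nq^{\rho_i}\partial_i\partial_{i'},\qquad \mathcal H_m=\{p\in\mathcal A_m:\Delta_qp=0\}.$$ The quantum algebra $U_q(\mathrm{so}_N)$ is the Drinfeld–Jimbo algebra of type $B_n$ or $D_n$ with generators $K_i^{\pm1},E_i,F_i$ ($1\le i\le n$; no generators for $N=2$), normalized by $[E_i,F_i]=(K_i-K_i^{-1})/(q-q^{-1})$. It acts on $\mathcal A$ as follows. For $N\geq 3$ call $(a,b)$ a simple pair if $(a,b)=(i,i+1)$ with $i<n$, or $(a,b)=(n,n+1)$ and $N=2n+1$, or $(a,b)=(n-1,n+1)$ and $N=2n$; simple pairs correspond to the simple roots. The generators of the simple pair $(a,b)$ act by $K^{\pm1}\mathbf x^\nu=q^{\pm((\nu_a-\nu_{a'})-(\nu_b-\nu_{b'}))}\mathbf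 x^\nu$ and, if $b\ne b'$, $$E\,\mathbf x^\nu=[\nu_b]_q\,q^{\nu_a-\nu_b+1}\mathbf x^{\nu+\varepsilon_a-\varepsilon_b}-[\nu_{a'}]_q\,q^{\nu_a-\nu_b-\nu_{a'}+\nu_{b'}+1}\mathbf x^{\nu+\varepsilon_{b'}-\varepsilon_{a'}},$$ $$F\,\mathbf x^\nu=[\nu_a]_q\,q^{-\nu_a+\nu_b-\nu_{b'}+\nu_{a'}+1}\mathbf x^{\nu-\varepsilon_a+\varepsilon_b}-[\nu_{b'}]_q\,q^{-\nu_{b'}+\nu_{a'}+1}\mathbf x^{\nu-\varepsilon_{b'}+\varepsilon_{a'}},$$ while for $N=2n+1$ and $(a,b)=(n,n+1)$ $$E\,\mathbf x^\nu=[\nu_{n+1}]\,q^{\nu_n-\nu_{n+1}+3/2}\mathbf x^{\nu+\varepsilon_n-\varepsilon_{n+1}}-[\nu_{n+2}]_q\,q^{\nu_n-\nu_{n+2}+1}\mathbf x^{\nu+\varepsilon_{n+1}-\varepsilon_{n+2}},$$ $$F\,\mathbf x^\nu=[\nu_n]_q\,q^{-\nu_n+\nu_{n+2}+1/2}\mathbf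 x^{\nu-\varepsilon_n+\varepsilon_{n+1}}-[\nu_{n+1}]\,q^{-\nu_{n+1}+\nu_{n+2}+1}\mathbf x^{\nu-\varepsilon_{n+1}+\varepsilon_{n+2}} .$$ Let also $\hat K_i^{\pm1}\mathbf x^\nu=q^{\pm(\nu_i-\nu_{i'})}\mathbf x^\nu$ for $1\le i\le n$. Then for every integer $m\ge0$ one has $\mathcal A_m=\mathcal H_m\oplus Q\mathcal A_{m-2}$, and the projector $\mathsf H_m:\mathcal A_m\to\mathcal H_m$ along $Q\mathcal A_{m-2}$ is given by $$\mathsf H_mp=\sum_{k=0}^{\lfloor m/2\rfloor}\alpha_k\,\hat Q^k\Delta_q^kp,\qquad \alpha_k=\frac{q^{2k^2-2mk-k}(1-q^2)^{2k}}{(1+q^{N-2})^{2k}\,(q^{-N-2m+4};q^2)_k\,(q^2;q^2)_k},\qquad p\in\mathcal A_m .$$ Moreover $\mathsf H_m^2=\mathsf H_m$. The algebra of operators on $\mathcal A$ generated by all the operators $E,F,K^{\pm1},\hat K_i^{\pm1}$ above preserves $\mathcal A_m$ and commutes there with $\mathsf H_m$; so $\mathsf H_m$ commutes with the action of $U_q(\mathrm{so}_N)$.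 -/

import Mathlib

open scoped BigOperators

noncomputable section

namespace QEuclid

/-! Throughout `N` is the number of coordinates, `s` is a square root `q^{1/2}` of the deformation
parameter and `q = s ^ 2`.  Coordinates are indexed by `Fin N`, so that the coordinate `x_i`
(`1 ≤ i ≤ N`) has index `i - 1`, and the involution `i ↦ i' = N - i + 1` is `Fin.rev`.
We write `n = ⌊N/2⌋`. -/

/-- The integer `2 ρ_i`, where `ρ_i = N/2 - i` for `1 ≤ i ≤ n`, `ρ_{i'} = - ρ_i`, and
`ρ_{n+1} = 0` for `N = 2 n + 1`. -/
def twoRho {N : ℕ} (i : Fin N) : ℤ :=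
  if i < i.rev then (N : ℤ) - 2 * ((i : ℤ) + 1)
  else if i.rev < i then -((N : ℤ) - 2 * ((i.rev : ℤ) + 1))
  else 0

/-- `q^{ρ_i}`. -/
def qRho {N : ℕ} (s : ℂ) (i : Fin N) : ℂ := s ^ twoRho i

/-- The `q`-number `[a] = (1 - q^a) / (1 - q)`, with `q = s ^ 2`. -/
def qNum (s : ℂ) (a : ℤ) : ℂ := (1 - (s ^ 2) ^ a) / (1 - s ^ 2)

/-- The symmetric `q`-number `[a]_q = (q^a - q^{-a}) / (q - q^{-1})`, with `q = s ^ 2`. -/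
def qSym (s : ℂ) (a : ℤ) : ℂ :=
  ((s ^ 2) ^ a - (s ^ 2) ^ (-a)) / (s ^ 2 - (s ^ 2)⁻¹)

/-- The `q`-Pochhammer symbol `(a; b)_k = (1 - a) (1 - a b) ⋯ (1 - a b^{k-1})`. -/
def qPoch (a b : ℂ) (k : ℕ) : ℂ := ∏ j ∈ Finset.range k, (1 - a * b ^ j)

/-! ### The algebra of polynomials on the quantum Euclidean space -/

/-- The defining relations of the quantum Euclidean space. -/
inductive Rel (N : ℕ) (s : ℂ) : FreeAlgebra ℂ (Fin N) → FreeAlgebra ℂ (Fin N) → Prop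
  /-- `x_i x_j = q x_j x_i` for `i < j`, `i ≠ j'`. -/
  | qcomm (i j : Fin N) (hij : i < j) (h : i ≠ j.rev) :
      Rel N s (FreeAlgebra.ι ℂ i * FreeAlgebra.ι ℂ j)
        ((s ^ 2) • (FreeAlgebra.ι ℂ j * FreeAlgebra.ι ℂ i))
  /-- `x_{i'} x_i - x_i x_{i'} =
    (q - q⁻¹) / (q^{ρ_i - 1} + q^{1 - ρ_i}) ∑_{i < j < i'} q^{ρ_{j'}} x_j x_{j'}` for `i < n`. -/
  | conj (i : Fin N) (hi : (i : ℕ) + 1 < N / 2) :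
      Rel N s
        (FreeAlgebra.ι ℂ i.rev * FreeAlgebra.ι ℂ i - FreeAlgebra.ι ℂ i * FreeAlgebra.ι ℂ i.rev)
        (((s ^ 2 - (s ^ 2)⁻¹) / (s ^ (twoRho i - 2) + s ^ (2 - twoRho i))) •
          ∑ j ∈ Finset.Ioo i i.rev,
            qRho s j.rev • (FreeAlgebra.ι ℂ j * FreeAlgebra.ι ℂ j.rev))
  /-- `x_{n'} x_n - x_n x_{n'} = (q^{1/2} - q^{-1/2}) x_{n+1}^2` if `N = 2 n + 1`. -/
  | odd (i c : Fin N) (hc : c.rev = c) (hi : (i : ℕ) + 1 = c) :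
      Rel N s
        (FreeAlgebra.ι ℂ i.rev * FreeAlgebra.ι ℂ i - FreeAlgebra.ι ℂ i * FreeAlgebra.ι ℂ i.rev)
        ((s - s⁻¹) • FreeAlgebra.ι ℂ c ^ 2)
  /-- `x_{n'} x_n = x_n x_{n'}` if `N = 2 n`. -/
  | even (i : Fin N) (hi : (i : ℕ) + 1 = i.rev) :
      Rel N s (FreeAlgebra.ι ℂ i.rev * FreeAlgebra.ι ℂ i)
        (FreeAlgebra.ι ℂ i * FreeAlgebra.ι ℂ i.rev)

/-- The algebra `𝒜 = ℂ_q[x_1, …, x_N]`: the quotient of the free algebra by the two-sided ideal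
generated by the defining relations. -/
def Alg (N : ℕ) (s : ℂ) : Type := (ringConGen (Rel N s)).Quotient

instance (N : ℕ) (s : ℂ) : Ring (Alg N s) :=
  inferInstanceAs (Ring (ringConGen (Rel N s)).Quotient)

instance (N : ℕ) (s : ℂ) : Algebra ℂ (Alg N s) :=
  inferInstanceAs (Algebra ℂ (ringConGen (Rel N s)).Quotient)

/-- The quotient map. -/
def Alg.mk (N : ℕ) (s : ℂ) : FreeAlgebra ℂ (Fin N) →ₐ[ℂ] Alg N s :=
  RingCon.mkₐ ℂ (ringConGen (Rel N s))

/-- The generators `x_i` of `𝒜`. -/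
def x {N : ℕ} (s : ℂ) (i : Fin N) : Alg N s := Alg.mk N s (FreeAlgebra.ι ℂ i)

/-- The ordered monomial `x^ν = x_1^{ν_1} x_2^{ν_2} ⋯ x_N^{ν_N}`. -/
def mono {N : ℕ} (s : ℂ) (ν : Fin N → ℕ) : Alg N s :=
  (List.ofFn fun i => x s i ^ ν i).prod

/-- The vector `ε_i`. -/
def ε {N : ℕ} (i : Fin N) : Fin N → ℕ := Pi.single i 1

/-- The space `𝒜_m` of homogeneous polynomials of degree `m`. -/
def homog (N : ℕ) (s : ℂ) (m : ℕ) : Submodule ℂ (Alg N s) :=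
  Submodule.span ℂ {a | ∃ ν : Fin N → ℕ, ∑ i, ν i = m ∧ mono s ν = a}

open Classical in
/-- The linear operator on `𝒜` with prescribed values `f ν` on the ordered monomials `x^ν`.
(It is unique since the ordered monomials span `𝒜`, and it exists since they are linearly
independent; a function `f` for which there were no such operator would be sent to `0`.) -/
def opOfMono {N : ℕ} {s : ℂ} (f : (Fin N → ℕ) → Alg N s) : Module.End ℂ (Alg N s) :=
  if h : ∃ T : Module.End ℂ (Alg N s), ∀ ν, T (mono s ν) = f ν then h.choose else 0

/-! ### The differential operators, the squared `q`-radius and the `q`-Laplace operator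

In all formulas on monomials below the subtraction of exponents is never truncated, except in
terms whose coefficient is zero. -/

/-- The operators `∂_k`.  On monomials,
* `∂_k x^ν = [ν_k]_q q^{ν_{k+1} + ⋯ + ν_N} x^{ν - ε_k}` for `k ≤ n`;
* `∂_{n+1} x^ν = [ν_{n+1}] q^{ν_{n+2} + ⋯ + ν_N} x^{ν - ε_{n+1}}` if `N = 2 n + 1`;
* `∂_{k'} x^ν = [ν_{k'}]_q q^{ν_k + ν_{(k-1)'} + ⋯ + ν_{1'}} x^{ν - ε_{k'}}`
  `+ ∑_{j = k+1}^{n} [ν_j]_q [ν_{j'}]_q (q - q⁻¹) q^{ρ_k - ρ_j} q^{d_{kj}} x^{ν + ε_k - ε_j - ε_{j'}}`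
  `+ [ν_{n+1} - 1] [ν_{n+1}] (q - q⁻¹) / (1 + q) q^{ρ_k + 2} q^{e_k} x^{ν + ε_k - 2 ε_{n+1}}`
  for `k ≤ n`, with `d_{kj} = ν_k + ⋯ + ν_{j-1} + ν_{(j-1)'} + ⋯ + ν_{1'}` and
  `e_k = ν_k + ⋯ + ν_{1'} - 2 ν_{n+1}`, the last summand being absent for `N = 2 n`. -/
def partialOp {N : ℕ} (s : ℂ) (l : Fin N) : Module.End ℂ (Alg N s) :=
  opOfMono fun ν =>
    if l < l.rev then
      (qSym s (ν l) * (s ^ 2) ^ (∑ i ∈ Finset.Ioi l, ν i)) • mono s (ν - ε l)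
    else if l = l.rev then
      (qNum s (ν l) * (s ^ 2) ^ (∑ i ∈ Finset.Ioi l, ν i)) • mono s (ν - ε l)
    else
      (qSym s (ν l) * (s ^ 2) ^ (ν l.rev + ∑ i ∈ Finset.Ioi l, ν i)) • mono s (ν - ε l)
      + ∑ j ∈ Finset.univ.filter (fun j : Fin N => l.rev < j ∧ j < j.rev),
          (qSym s (ν j) * qSym s (ν j.rev) * (s ^ 2 - (s ^ 2)⁻¹) * (qRho s l.rev / qRho s j)
            * (s ^ 2) ^ (∑ i ∈ Finset.Ico l.rev j, ν i + ∑ i ∈ Finset.Ioi j.rev, ν i))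
            • mono s (ν + ε l.rev - ε j - ε j.rev)
      + ∑ c ∈ Finset.univ.filter (fun c : Fin N => c = c.rev),
          (qNum s ((ν c : ℤ) - 1) * qNum s (ν c) * ((s ^ 2 - (s ^ 2)⁻¹) / (1 + s ^ 2))
            * (qRho s l.rev * (s ^ 2) ^ 2)
            * (s ^ 2) ^ (((∑ i ∈ Finset.Ici l.rev, ν i : ℕ) : ℤ) - 2 * (ν c : ℤ)))
            • mono s (ν + ε l.rev - 2 • ε c)

/-- The squared `q`-radius `Q = ∑_i q^{ρ_{i'}} x_i x_{i'}`. -/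
def radiusSq (N : ℕ) (s : ℂ) : Alg N s :=
  ∑ i : Fin N, qRho s i.rev • (x s i * x s i.rev)

/-- The operator `Q̂` of left multiplication by `Q`. -/
def Qhat (N : ℕ) (s : ℂ) : Module.End ℂ (Alg N s) :=
  LinearMap.mulLeft ℂ (radiusSq N s)

/-- The `q`-Laplace operator `Δ_q = ∑_i q^{ρ_i} ∂_i ∂_{i'}`. -/
def laplace (N : ℕ) (s : ℂ) : Module.End ℂ (Alg N s) :=
  ∑ i : Fin N, qRho s i • (partialOp s i * partialOp s i.rev)

/-- The space `ℋ_m` of `q`-harmonic homogeneous polynomials of degree `m`. -/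
def harm (N : ℕ) (s : ℂ) (m : ℕ) : Submodule ℂ (Alg N s) :=
  homog N s m ⊓ LinearMap.ker (laplace N s)

/-- The space `Q 𝒜_{m-2}` (with `𝒜_{-2} = 𝒜_{-1} = 0`). -/
def radial (N : ℕ) (s : ℂ) : ℕ → Submodule ℂ (Alg N s)
  | 0 => ⊥
  | 1 => ⊥
  | m + 2 => (homog N s m).map (Qhat N s)

/-- The direct sum decomposition `𝒜_m = ℋ_m ⊕ Q 𝒜_{m-2}`. -/
def Decomposition (N : ℕ) (s : ℂ) (m : ℕ) : Prop :=
  radial N s m ≤ homog N s m ∧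
    IsCompl ((harm N s m).submoduleOf (homog N s m)) ((radial N s m).submoduleOf (homog N s m))

/-- The projector `H_m : 𝒜_m → ℋ_m` along `Q 𝒜_{m-2}`, viewed as an operator on `𝒜_m`. -/
def projector {N : ℕ} {s : ℂ} {m : ℕ} (h : Decomposition N s m) :
    Module.End ℂ (homog N s m) :=
  Submodule.projection ((harm N s m).submoduleOf (homog N s m))
    ((radial N s m).submoduleOf (homog N s m)) h.2

/-- The coefficient
`α_k = q^{2k² - 2mk - k} (1 - q²)^{2k} / ((1 + q^{N-2})^{2k} (q^{-N-2m+4}; q²)_k (q²; q²)_k)`. -/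
def alpha (N : ℕ) (q : ℂ) (m k : ℕ) : ℂ :=
  q ^ (2 * (k : ℤ) ^ 2 - 2 * m * k - k) * (1 - q ^ 2) ^ (2 * k) /
    ((1 + q ^ ((N : ℤ) - 2)) ^ (2 * k) * qPoch (q ^ (-(N : ℤ) - 2 * m + 4)) (q ^ 2) k
      * qPoch (q ^ 2) (q ^ 2) k)

/-! ### The quantum algebra `U_q(so_N)` and its action on `𝒜` -/

/-- The simple roots.  The coordinate `x_i` has weight `ε_i` for `i ≤ n`, `-ε_{i'}` for `i ≥ n'`
and `0` for `i = i'`, and the pair `(a, b)` of indices stands for the difference of the weights of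
`x_a` and `x_b`.  The simple roots are given by the pairs `(i, i + 1)` with `i < n`, together with
the pair `(n, n + 1)` (the root `ε_n`) if `N = 2 n + 1` and the pair `(n - 1, n + 1)` (the root
`ε_{n-1} + ε_n`) if `N = 2 n`.  There is none for `N = 2`. -/
def IsSimpleRoot {N : ℕ} (a b : Fin N) : Prop :=
  ((a : ℕ) + 1 = b ∧ 2 * (b : ℕ) + 1 ≤ N) ∨ ((a : ℕ) + 2 = b ∧ 2 * (b : ℕ) = N)

/-- The index set of the simple roots. -/
def SimpleRoot (N : ℕ) : Type := {p : Fin N × Fin N // IsSimpleRoot p.1 p.2}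

/-- The inner product of the weights of `x_i` and `x_j`. -/
def wtIP {N : ℕ} (i j : Fin N) : ℤ :=
  (if i = j then 1 else 0) - (if i = j.rev then 1 else 0)

/-- The inner product `(α, β)` of two simple roots. -/
def rootIP {N : ℕ} (α β : SimpleRoot N) : ℤ :=
  wtIP α.1.1 β.1.1 - wtIP α.1.1 β.1.2 - wtIP α.1.2 β.1.1 + wtIP α.1.2 β.1.2

/-- The entry `2 (α, β) / (α, α)` of the Cartan matrix. -/
def cartan {N : ℕ} (α β : SimpleRoot N) : ℤ := 2 * rootIP α β / rootIP α α

/-- The symmetric `q`-number `(p^a - p^{-a}) / (p - p⁻¹)` to the base `p`. -/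
def symNum (p : ℂ) (a : ℕ) : ℂ := (p ^ a - (p ^ a)⁻¹) / (p - p⁻¹)

/-- The symmetric `q`-binomial coefficient to the base `p`. -/
def symBinom (p : ℂ) (r k : ℕ) : ℂ :=
  (∏ j ∈ Finset.range r, symNum p (j + 1)) /
    ((∏ j ∈ Finset.range k, symNum p (j + 1)) * ∏ j ∈ Finset.range (r - k), symNum p (j + 1))

/-- Names of the generators of `U_q(so_N)`. -/
inductive UGen (N : ℕ) : Type
  | K (α : SimpleRoot N)
  | Kinv (α : SimpleRoot N)
  | E (α : SimpleRoot N)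
  | F (α : SimpleRoot N)

/-- The `q`-Serre element
`∑_k (-1)^k [r choose k]_{q_α} X_α^k X_β X_α^{r-k}`, where `r = 1 - a_{αβ}` and
`q_α = q^{(α, α) / 2}`. -/
def serre {N : ℕ} (s : ℂ) (X : SimpleRoot N → FreeAlgebra ℂ (UGen N)) (α β : SimpleRoot N) :
    FreeAlgebra ℂ (UGen N) :=
  ∑ k ∈ Finset.range ((1 - cartan α β).toNat + 1),
    ((-1) ^ k * symBinom (s ^ rootIP α α) (1 - cartan α β).toNat k) •
      (X α ^ k * X β * X α ^ ((1 - cartan α β).toNat - k))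

/-- The Drinfeld-Jimbo relations of `U_q(so_N)`. -/
inductive URel (N : ℕ) (s : ℂ) : FreeAlgebra ℂ (UGen N) → FreeAlgebra ℂ (UGen N) → Prop
  | K_Kinv (α : SimpleRoot N) :
      URel N s (FreeAlgebra.ι ℂ (.K α) * FreeAlgebra.ι ℂ (.Kinv α)) 1
  | Kinv_K (α : SimpleRoot N) :
      URel N s (FreeAlgebra.ι ℂ (.Kinv α) * FreeAlgebra.ι ℂ (.K α)) 1
  | K_K (α β : SimpleRoot N) :
      URel N s (FreeAlgebra.ι ℂ (.K α) * FreeAlgebra.ι ℂ (.K β))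
        (FreeAlgebra.ι ℂ (.K β) * FreeAlgebra.ι ℂ (.K α))
  | K_E (α β : SimpleRoot N) :
      URel N s (FreeAlgebra.ι ℂ (.K α) * FreeAlgebra.ι ℂ (.E β))
        ((s ^ 2) ^ rootIP α β • (FreeAlgebra.ι ℂ (.E β) * FreeAlgebra.ι ℂ (.K α)))
  | K_F (α β : SimpleRoot N) :
      URel N s (FreeAlgebra.ι ℂ (.K α) * FreeAlgebra.ι ℂ (.F β))
        ((s ^ 2) ^ (-rootIP α β) • (FreeAlgebra.ι ℂ (.F β) * FreeAlgebra.ι ℂ (.K α)))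
  | E_F (α : SimpleRoot N) :
      URel N s
        (FreeAlgebra.ι ℂ (.E α) * FreeAlgebra.ι ℂ (.F α)
          - FreeAlgebra.ι ℂ (.F α) * FreeAlgebra.ι ℂ (.E α))
        ((s ^ 2 - (s ^ 2)⁻¹)⁻¹ • (FreeAlgebra.ι ℂ (.K α) - FreeAlgebra.ι ℂ (.Kinv α)))
  | E_F_comm (α β : SimpleRoot N) (h : α ≠ β) :
      URel N s (FreeAlgebra.ι ℂ (.E α) * FreeAlgebra.ι ℂ (.F β))
        (FreeAlgebra.ι ℂ (.F β) * FreeAlgebra.ι ℂ (.E α))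
  | serreE (α β : SimpleRoot N) (h : α ≠ β) :
      URel N s (serre s (fun γ => FreeAlgebra.ι ℂ (.E γ)) α β) 0
  | serreF (α β : SimpleRoot N) (h : α ≠ β) :
      URel N s (serre s (fun γ => FreeAlgebra.ι ℂ (.F γ)) α β) 0

/-- The quantum algebra `U_q(so_N)`. -/
abbrev Uq (N : ℕ) (s : ℂ) : Type := (ringConGen (URel N s)).Quotient

/-- The generators of `U_q(so_N)`. -/
def Uq.gen {N : ℕ} (s : ℂ) (g : UGen N) : Uq N s :=
  RingCon.mkₐ ℂ (ringConGen (URel N s)) (FreeAlgebra.ι ℂ g)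

/-- The action of `E_α` for the simple root `α = (a, b)`.  For `α = (k, k + 1)`, `k < n`, this is
`E_k x^ν = [ν_{k+1}]_q q^{ν_k - ν_{k+1} + 1} x^{ν + ε_k - ε_{k+1}}`
`- [ν_{k'}]_q q^{ν_k - ν_{k+1} - ν_{k'} + ν_{(k+1)'} + 1} x^{ν + ε_{(k+1)'} - ε_{k'}}`;
for `N = 2 n` and `α = (n - 1, n + 1)` it is the same with `n + 1` for `k + 1` and `n - 1` for `k`;
for `N = 2 n + 1` and `α = (n, n + 1)` it is
`E_n x^ν = [ν_{n+1}] q^{ν_n - ν_{n+1} + 3/2} x^{ν + ε_n - ε_{n+1}}`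
`- [ν_{n+2}]_q q^{ν_n - ν_{n+2} + 1} x^{ν + ε_{n+1} - ε_{n+2}}`. -/
def opE {N : ℕ} (s : ℂ) (a b : Fin N) : Module.End ℂ (Alg N s) :=
  opOfMono fun ν =>
    if b = b.rev then
      (qNum s (ν b) * ((s ^ 2) ^ ((ν a : ℤ) - ν b) * s ^ 3)) • mono s (ν + ε a - ε b)
      - (qSym s (ν a.rev) * (s ^ 2) ^ ((ν a : ℤ) - ν a.rev + 1)) • mono s (ν + ε b - ε a.rev)
    else
      (qSym s (ν b) * (s ^ 2) ^ ((ν a : ℤ) - ν b + 1)) • mono s (ν + ε a - ε b)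
      - (qSym s (ν a.rev) * (s ^ 2) ^ ((ν a : ℤ) - ν b - ν a.rev + ν b.rev + 1))
          • mono s (ν + ε b.rev - ε a.rev)

/-- The action of `F_α` for the simple root `α = (a, b)`.  For `α = (k, k + 1)`, `k < n`, this is
`F_k x^ν = [ν_k]_q q^{-ν_k + ν_{k+1} - ν_{(k+1)'} + ν_{k'} + 1} x^{ν - ε_k + ε_{k+1}}`
`- [ν_{(k+1)'}]_q q^{-ν_{(k+1)'} + ν_{k'} + 1} x^{ν - ε_{(k+1)'} + ε_{k'}}`;
for `N = 2 n` and `α = (n - 1, n + 1)` it is the same with `n + 1` for `k + 1` and `n - 1` for `k`;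
for `N = 2 n + 1` and `α = (n, n + 1)` it is
`F_n x^ν = [ν_n]_q q^{-ν_n + ν_{n+2} + 1/2} x^{ν - ε_n + ε_{n+1}}`
`- [ν_{n+1}] q^{-ν_{n+1} + ν_{n+2} + 1} x^{ν - ε_{n+1} + ε_{n+2}}`. -/
def opF {N : ℕ} (s : ℂ) (a b : Fin N) : Module.End ℂ (Alg N s) :=
  opOfMono fun ν =>
    if b = b.rev then
      (qSym s (ν a) * ((s ^ 2) ^ (-(ν a : ℤ) + ν a.rev) * s)) • mono s (ν - ε a + ε b)
      - (qNum s (ν b) * (s ^ 2) ^ (-(ν b : ℤ) + ν a.rev + 1)) • mono s (ν - ε b + ε a.rev)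
    else
      (qSym s (ν a) * (s ^ 2) ^ (-(ν a : ℤ) + ν b - ν b.rev + ν a.rev + 1))
          • mono s (ν - ε a + ε b)
      - (qSym s (ν b.rev) * (s ^ 2) ^ (-(ν b.rev : ℤ) + ν a.rev + 1))
          • mono s (ν - ε b.rev + ε a.rev)

/-- The diagonal operator `x^ν ↦ q^{z ((ν_i - ν_{i'}) - (ν_j - ν_{j'}))} x^ν`. -/
def opK {N : ℕ} (s : ℂ) (z : ℤ) (a b : Fin N) : Module.End ℂ (Alg N s) :=
  opOfMono fun ν =>
    ((s ^ 2) ^ (z * (((ν a : ℤ) - ν a.rev) - ((ν b : ℤ) - ν b.rev)))) • mono s ν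

/-- The operators `K̂_i^{z}`, `x^ν ↦ q^{z (ν_i - ν_{i'})} x^ν`. -/
def opKhat {N : ℕ} (s : ℂ) (z : ℤ) (i : Fin N) : Module.End ℂ (Alg N s) :=
  opOfMono fun ν => ((s ^ 2) ^ (z * ((ν i : ℤ) - ν i.rev))) • mono s ν

/-- The action of the generators of `U_q(so_N)` on `𝒜`. -/
def genOp {N : ℕ} (s : ℂ) : UGen N → Module.End ℂ (Alg N s)
  | .K α => opK s 1 α.1.1 α.1.2
  | .Kinv α => opK s (-1) α.1.1 α.1.2
  | .E α => opE s α.1.1 α.1.2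
  | .F α => opF s α.1.1 α.1.2

/-- The algebra of all operators `a ↦ X ▷ a` on `𝒜` with `X ∈ U_q(so_N)`, including those of the
elements `K̂_i^{±1}`: the algebra generated by the operators of the generators.  (For `N = 2` only
the operators of `K̂_1^{±1}` are left.) -/
def uqOperators (N : ℕ) (s : ℂ) : Subalgebra ℂ (Module.End ℂ (Alg N s)) :=
  Algebra.adjoin ℂ (Set.range (genOp (N := N) s) ∪
    {T | ∃ i : Fin N, i < i.rev ∧ (T = opKhat s 1 i ∨ T = opKhat s (-1) i)})

end QEuclid

end

/-!
The theorem is the `q`-analogue of the classical decomposition of polynomials into harmonic ones and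
multiples of the squared radius, and it rests on one relation: on elements of degree `d`, the
operators `Δ_q` and `Q̂` satisfy `Δ_q Q̂ = q² Q̂ Δ_q + c_d` with an explicit scalar `c_d`
(`laplace_Qhat`).  From it one obtains `Δ_q Q̂^k` and `Δ_q^k Q̂` for all `k`, and the coefficients `α_k`
obey the two-term recurrence (`alpha_succ`) for which `P = ∑ α_k Q̂^k Δ_q^k` satisfies `Δ_q P = 0` on
`𝒜_m` and `P Q̂ = 0` on `𝒜_{m-2}` by telescoping; sums end because negative degrees vanish.  Since
`α_0 = 1`, the operator `P` is the identity on `ℋ_m` and `1 - P` takes values in `Q 𝒜_{m-2}`.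
Thus the direct sum holds and `P` is the projector (`decomposition`, `projector_apply`).  Any
operator that preserves degrees and commutes with `Q̂` and `Δ_q` then commutes with `P`, so that the
invariance of `H_m` reduces to that of `Q̂` and `Δ_q` under the generators.

All computations take place on functions on the lattice `ℤ^N`, where the operators are sums of
weighted shifts.  The algebra acts there: `x_i` with `i ≤ i'` is an invertible weighted shift, and
`x_{i'}` is then determined by `x_i x_{i'} = q^{ρ_i} (ω_i - ω_{i+1})`, where `ω_k` is proportional to
the squared radius of the coordinates `x_{k}, …, x_{k'}`.  That these operators satisfy the defining
relations (`lift_opX_eq`) comes down to the `q`-commutation of the weighted shifts and to a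
telescoping sum for the squared radius (`sum_inner_telescope`).  Acting on the indicator function
of `0` sends `x^ν` to the indicator function of `ν`; this gives the linear independence of the ordered
monomials, hence the basis (`monoBasis`), and an injective symbol map `symb` that carries every
operator defined on monomials to weighted shifts (`symb_opOfMono`).

Under the symbol map, `Q̂` and `Δ_q` become `(1 + q^{N-2})` times sums `∑_j U_j` and `∑_j D_j` of single
weighted shifts, one for each pair `{j, j'}` (`symb_Qhat`, `symb_laplace`; for `Δ_q` the sum
telescopes in the same way as for `Q`).  For `j ≠ k` one has `D_k U_j = q² U_j D_k`, whereas
`D_j U_j - q² U_j D_j` is a difference `Z_{j+1} - Z_j` of diagonal operators.  Summation over `j`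
leaves the extreme ones, which depend on the degree alone; this is the relation above
(`innerSum_opD_innerSum_opU_apply`).  A generator of the quantum algebra involves only two adjacent
pairs, and its commutation with the sum of their two terms is an identity of rational functions
(`commute_pair`, `commute_pair_mid`).
-/

open scoped BigOperators

noncomputable section

namespace QEuclid

/-! ### Weighted shift operators on functions on the lattice `ℤ^N` -/

/-- Functions on the lattice of integral exponents; the indicator function of `ν` plays the role of
the monomial `x^ν`, negative exponents being allowed. -/
abbrev Lat (N : ℕ) : Type := (Fin N → ℤ) → ℂ

/-- The weighted shift operator `e_ν ↦ c(ν) e_{ν + δ}`. -/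
def sh {N : ℕ} (δ : Fin N → ℤ) (c : (Fin N → ℤ) → ℂ) : Module.End ℂ (Lat N) where
  toFun f := fun ν => c (ν - δ) * f (ν - δ)
  map_add' f g := by ext ν; simp [mul_add]
  map_smul' a f := by ext ν; simp [mul_left_comm]

/-- The indicator function of the lattice point `ν`. -/
def pt {N : ℕ} (ν : Fin N → ℤ) : Lat N := Pi.single ν 1

lemma sh_apply {N : ℕ} (δ : Fin N → ℤ) (c : (Fin N → ℤ) → ℂ) (f : Lat N) (ν : Fin N → ℤ) :
    sh δ c f ν = c (ν - δ) * f (ν - δ) := rfl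

lemma sh_mul_sh {N : ℕ} (δ δ' : Fin N → ℤ) (c c' : (Fin N → ℤ) → ℂ) :
    sh δ c * sh δ' c' = sh (δ' + δ) (fun ν => c (ν + δ') * c' ν) := by
  ext f ν
  have h : ν - δ = ν - (δ' + δ) + δ' := by abel
  simp only [Module.End.mul_apply, sh_apply]
  rw [h, add_sub_cancel_right, mul_assoc]

lemma sh_sub {N : ℕ} (δ : Fin N → ℤ) (c c' : (Fin N → ℤ) → ℂ) :
    sh δ c - sh δ c' = sh δ (fun ν => c ν - c' ν) := by
  ext f ν; simp [sh_apply, sub_mul]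

lemma smul_sh {N : ℕ} (a : ℂ) (δ : Fin N → ℤ) (c : (Fin N → ℤ) → ℂ) :
    a • sh δ c = sh δ (fun ν => a * c ν) := by
  ext f ν; simp [sh_apply, mul_assoc]

lemma sh_one {N : ℕ} : sh (0 : Fin N → ℤ) (fun _ => 1) = 1 := by
  ext f ν; simp [sh_apply]

lemma sh_congr {N : ℕ} {δ δ' : Fin N → ℤ} {c c' : (Fin N → ℤ) → ℂ} (hδ : δ = δ')
    (hc : ∀ ν, c ν = c' ν) : sh δ c = sh δ' c' := by
  rw [hδ, funext hc]

lemma sh_pt {N : ℕ} (δ : Fin N → ℤ) (c : (Fin N → ℤ) → ℂ) (ν : Fin N → ℤ) :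
    sh δ c (pt ν) = c ν • pt (ν + δ) := by
  ext μ
  simp only [sh_apply, pt, Pi.single_apply, Pi.smul_apply, smul_eq_mul]
  by_cases h : μ = ν + δ
  · simp [h]
  · rw [if_neg h, if_neg (fun h' => h (by rw [← h']; abel))]; simp

/-! ### Linear functionals on exponents -/

/-- The unit vector `ε_i` in the lattice. -/
def ez {N : ℕ} (i : Fin N) : Fin N → ℤ := Pi.single i 1

/-- The pairs `{i, i'}` are numbered by `lev i = min i i'`, counted from `0`. -/
def lev {N : ℕ} (i : Fin N) : ℕ := min (i : ℕ) (i.rev : ℕ)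

/-- The degree `ν_1 + ⋯ + ν_N`. -/
def tot {N : ℕ} : (Fin N → ℤ) →+ ℤ where
  toFun ν := ∑ i, ν i
  map_zero' := by simp
  map_add' := by simp [Finset.sum_add_distrib]

/-- The sum of the exponents of the outermost `k` pairs. -/
def out {N : ℕ} (k : ℕ) : (Fin N → ℤ) →+ ℤ where
  toFun ν := ∑ i with lev i < k, ν i
  map_zero' := by simp
  map_add' := by simp [Finset.sum_add_distrib]

/-- The sum of the first `k` exponents. -/
def pre {N : ℕ} (k : ℕ) : (Fin N → ℤ) →+ ℤ where
  toFun ν := ∑ i : Fin N with i.val < k, ν i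
  map_zero' := by simp
  map_add' := by simp [Finset.sum_add_distrib]

lemma ez_apply {N : ℕ} (i j : Fin N) : ez i j = if j = i then 1 else 0 := by
  simp [ez, Pi.single_apply]

lemma tot_ez {N : ℕ} (i : Fin N) : tot (ez i) = 1 := by
  simp [tot, ez_apply]

lemma out_ez {N : ℕ} (k : ℕ) (i : Fin N) : out k (ez i) = if lev i < k then 1 else 0 := by
  simp [out, ez_apply]

lemma pre_ez {N : ℕ} (k : ℕ) (i : Fin N) : pre k (ez i) = if (i : ℕ) < k then 1 else 0 := by
  simp [pre, ez_apply]

lemma lev_rev {N : ℕ} (i : Fin N) : lev i.rev = lev i := by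
  simp [lev, min_comm]

lemma lev_eq {N : ℕ} {i : Fin N} (h : i ≤ i.rev) : lev i = i := by
  simpa [lev, Fin.le_def] using h

lemma lev_inj {N : ℕ} {i j : Fin N} (h : lev i = lev j) : i = j ∨ i = j.rev := by
  simp only [lev, Fin.ext_iff, Fin.val_rev] at *; omega

lemma two_lev {N : ℕ} (i : Fin N) : 2 * lev i + 1 ≤ N := by
  have := i.2
  simp only [lev, Fin.val_rev]; omega

lemma two_lev_eq_iff {N : ℕ} (i : Fin N) : 2 * lev i + 1 = N ↔ i = i.rev := by
  have := i.2
  simp only [lev, Fin.ext_iff, Fin.val_rev]; omega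

lemma out_succ {N : ℕ} (i : Fin N) (h : i ≠ i.rev) (ν : Fin N → ℤ) :
    out (lev i + 1) ν = out (lev i) ν + ν i + ν i.rev := by
  have : (Finset.univ.filter fun l : Fin N => lev l < lev i + 1)
      = insert i (insert i.rev (Finset.univ.filter fun l : Fin N => lev l < lev i)) := by
    ext l
    simp only [Finset.mem_filter, Finset.mem_univ, true_and, Finset.mem_insert]
    constructor
    · intro hl
      rcases Nat.lt_succ_iff_lt_or_eq.1 hl with h1 | h1
      · exact Or.inr (Or.inr h1)
      · rcases lev_inj h1 with h2 | h2 <;> simp [h2]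
    · rintro (rfl | rfl | h1)
      · omega
      · rw [lev_rev]; omega
      · omega
  simp only [out, AddMonoidHom.coe_mk, ZeroHom.coe_mk]
  rw [this, Finset.sum_insert (by simp [h]), Finset.sum_insert (by simp [lev_rev])]
  ring

lemma out_succ_mid {N : ℕ} (i : Fin N) (h : i = i.rev) (ν : Fin N → ℤ) :
    out (lev i + 1) ν = out (lev i) ν + ν i := by
  have : (Finset.univ.filter fun l : Fin N => lev l < lev i + 1)
      = insert i (Finset.univ.filter fun l : Fin N => lev l < lev i) := by
    ext l
    simp only [Finset.mem_filter, Finset.mem_univ, true_and, Finset.mem_insert]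
    constructor
    · intro hl
      rcases Nat.lt_succ_iff_lt_or_eq.1 hl with h1 | h1
      · exact Or.inr h1
      · rcases lev_inj h1 with h2 | h2
        · exact Or.inl h2
        · exact Or.inl (h2.trans h.symm)
    · rintro (rfl | h1) <;> omega
  simp only [out, AddMonoidHom.coe_mk, ZeroHom.coe_mk]
  rw [this, Finset.sum_insert (by simp), add_comm]

lemma out_zero {N : ℕ} (ν : Fin N → ℤ) : out 0 ν = 0 := by simp [out]

lemma pre_zero {N : ℕ} (ν : Fin N → ℤ) : pre 0 ν = 0 := by simp [pre]

lemma out_top {N : ℕ} {k : ℕ} (hk : N ≤ 2 * k) (ν : Fin N → ℤ) : out k ν = tot ν := by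
  have : (Finset.univ.filter fun l : Fin N => lev l < k) = Finset.univ := by
    ext l
    have := two_lev l
    simp only [Finset.mem_filter, Finset.mem_univ, true_and, iff_true]; omega
  simp [out, tot, this]

lemma pre_succ {N : ℕ} (i : Fin N) (ν : Fin N → ℤ) :
    pre ((i : ℕ) + 1) ν = pre i ν + ν i := by
  have : (Finset.univ.filter fun l : Fin N => (l : ℕ) < (i : ℕ) + 1)
      = insert i (Finset.univ.filter fun l : Fin N => (l : ℕ) < (i : ℕ)) := by
    ext l
    simp only [Finset.mem_filter, Finset.mem_univ, true_and, Finset.mem_insert, Fin.ext_iff]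
    omega
  simp only [pre, AddMonoidHom.coe_mk, ZeroHom.coe_mk]
  rw [this, Finset.sum_insert (by simp), add_comm]

/-- The exponents of the outermost `k` pairs are the first `k` and the last `k` ones. -/
lemma out_eq {N : ℕ} {k : ℕ} (hk : 2 * k ≤ N) (ν : Fin N → ℤ) :
    out k ν = pre k ν + tot ν - pre (N - k) ν := by
  have h1 : pre (N - k) ν + ∑ i : Fin N with ¬ (i.val < N - k), ν i = tot ν := by
    simpa [pre, tot] using Finset.sum_filter_add_sum_filter_not Finset.univ
      (fun i : Fin N => (i : ℕ) < N - k) ν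
  have h2 : out k ν = pre k ν + ∑ i : Fin N with ¬ (i.val < N - k), ν i := by
    simp only [pre, out, AddMonoidHom.coe_mk, ZeroHom.coe_mk]
    rw [← Finset.sum_union]
    · congr 1
      ext l
      have := l.2
      simp only [Finset.mem_filter, Finset.mem_univ, true_and, Finset.mem_union]
      simp only [lev, Fin.val_rev]
      omega
    · rw [Finset.disjoint_left]
      intro l
      simp only [Finset.mem_filter, Finset.mem_univ, true_and]
      omega
  linarith

/-! ### The inner parts of the squared radius and of the Laplace operator -/

/-- The sum of `A j` over the pairs `{j, j'}` with `lev j ≥ k`, each pair being represented by its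
smaller element. -/
def innerSum {N : ℕ} {M : Type*} [AddCommMonoid M] (A : Fin N → M) (k : ℕ) : M :=
  ∑ j with j ≤ j.rev ∧ k ≤ lev j, A j

lemma innerSum_eq_add {N : ℕ} {M : Type*} [AddCommMonoid M] (A : Fin N → M) (i : Fin N)
    (hi : i ≤ i.rev) : innerSum A (lev i) = A i + innerSum A (lev i + 1) := by
  have : (Finset.univ.filter fun j : Fin N => j ≤ j.rev ∧ lev i ≤ lev j)
      = insert i (Finset.univ.filter fun j : Fin N => j ≤ j.rev ∧ lev i + 1 ≤ lev j) := by
    ext j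
    simp only [Finset.mem_filter, Finset.mem_univ, true_and, Finset.mem_insert]
    constructor
    · rintro ⟨h1, h2⟩
      rcases Nat.eq_or_lt_of_le h2 with h3 | h3
      · left; rw [lev_eq hi, lev_eq h1] at h3; exact Fin.ext h3.symm
      · exact Or.inr ⟨h1, h3⟩
    · rintro (rfl | h)
      · exact ⟨hi, le_rfl⟩
      · exact ⟨h.1, by omega⟩
  rw [innerSum, this, Finset.sum_insert (by simp)]
  rfl

lemma innerSum_eq_zero {N : ℕ} {M : Type*} [AddCommMonoid M] (A : Fin N → M) {k : ℕ}
    (hk : N ≤ 2 * k) : innerSum A k = 0 := by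
  refine Finset.sum_eq_zero fun j hj => ?_
  have := two_lev j
  simp only [Finset.mem_filter] at hj
  omega

lemma mul_innerSum {N : ℕ} {R : Type*} [Ring R] [Algebra ℂ R] (A : Fin N → R) (k : ℕ) (a : R)
    (c : ℂ) (h : ∀ j : Fin N, j ≤ j.rev → k ≤ lev j → a * A j = c • (A j * a)) :
    a * innerSum A k = c • (innerSum A k * a) := by
  rw [innerSum, Finset.mul_sum, Finset.sum_mul, Finset.smul_sum]
  refine Finset.sum_congr rfl fun j hj => ?_
  simp only [Finset.mem_filter, Finset.mem_univ, true_and] at hj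
  exact h j hj.1 hj.2

lemma commute_innerSum {N : ℕ} {R : Type*} [Ring R] (A : Fin N → R) (k : ℕ) (a : R)
    (h : ∀ j : Fin N, j ≤ j.rev → k ≤ lev j → Commute a (A j)) :
    Commute a (innerSum A k) := by
  refine Commute.sum_right _ _ _ fun j hj => ?_
  simp only [Finset.mem_filter, Finset.mem_univ, true_and] at hj
  exact h j hj.1 hj.2

/-- The number `2 ρ_j` for `j < j'`, prolonged to the index `n + 1` of `N = 2 n + 1` by the value
`-1`, so that it drops by `2` from each pair to the next. -/
def rr {N : ℕ} (i : Fin N) : ℤ := N - 2 - 2 * lev i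

/-- The coefficient of `x^{ν + ε_j + ε_{j'}}` in the product of `Q / (1 + q^{N-2})` and `x^ν`. -/
def uCo {N : ℕ} (s : ℂ) (j : Fin N) (ν : Fin N → ℤ) : ℂ :=
  (if j = j.rev then s / (s ^ 2 + 1) else 1) *
    s ^ (-rr j - 2 * tot ν + 2 * out (lev j + 1) ν)

/-- The contribution of the pair `{j, j'}` to the multiplication by `Q / (1 + q^{N-2})`. -/
def opU {N : ℕ} (s : ℂ) (j : Fin N) : Module.End ℂ (Lat N) :=
  sh (ez j + ez j.rev) (uCo s j)

/-- The coefficient of `x^{ν - ε_j - ε_{j'}}` in `Δ_q x^ν / (1 + q^{N-2})`. -/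
def dCo {N : ℕ} (s : ℂ) (j : Fin N) (ν : Fin N → ℤ) : ℂ :=
  if j = j.rev then
    s ^ (2 + 4 * out (lev j) ν) / (1 + s ^ 2) * (qNum s (ν j - 1) * qNum s (ν j))
  else s ^ (-rr j - 2 + 2 * tot ν + 2 * out (lev j) ν) * (qSym s (ν j) * qSym s (ν j.rev))

/-- The contribution of the pair `{j, j'}` to the operator `Δ_q / (1 + q^{N-2})`. -/
def opD {N : ℕ} (s : ℂ) (j : Fin N) : Module.End ℂ (Lat N) :=
  sh (-(ez j + ez j.rev)) (dCo s j)

/-- The diagonal operator `e_ν ↦ q^{-2 (ν_1 + ⋯ + ν_k)} e_ν`. -/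
def opG {N : ℕ} (s : ℂ) (k : ℕ) : Module.End ℂ (Lat N) :=
  sh 0 fun ν => s ^ (-4 * pre k ν)

/-- The left multiplication by the squared radius of the coordinates `x_{k+1}, …, x_{(k+1)'}`,
normalized. -/
def opOm (N : ℕ) (s : ℂ) (k : ℕ) : Module.End ℂ (Lat N) := opG s k * innerSum (opU s) k

/-- The multiplication by `x_i` for `i ≤ i'`. -/
def opX0 {N : ℕ} (s : ℂ) (i : Fin N) : Module.End ℂ (Lat N) :=
  sh (ez i) fun ν => s ^ (-2 * pre i ν)

/-- The inverse of the multiplication by `x_i` for `i ≤ i'`. -/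
def opY {N : ℕ} (s : ℂ) (i : Fin N) : Module.End ℂ (Lat N) :=
  sh (-ez i) fun ν => s ^ (2 * pre i ν)

/-- The left multiplication by `x_l`.  For `l > l'` it is determined by
`x_i x_{i'} = q^{ρ_i} (ω_i - ω_{i+1})`, where `ω_k` are the normalized squared radii. -/
def opX {N : ℕ} (s : ℂ) (l : Fin N) : Module.End ℂ (Lat N) :=
  if l ≤ l.rev then opX0 s l
  else qRho s l.rev • (opY s l.rev * (opOm N s (lev l) - opOm N s (lev l + 1)))

variable {N : ℕ} {s : ℂ}

lemma opY_mul_opX0 (hs : s ≠ 0) (i : Fin N) : opY s i * opX0 s i = 1 := by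
  rw [opY, opX0, sh_mul_sh, ← sh_one]
  refine sh_congr (by abel) fun ν => ?_
  rw [← zpow_add₀ hs]
  simp [pre_ez]

lemma opX0_mul_opY (hs : s ≠ 0) (i : Fin N) : opX0 s i * opY s i = 1 := by
  rw [opY, opX0, sh_mul_sh, ← sh_one]
  refine sh_congr (by abel) fun ν => ?_
  rw [← zpow_add₀ hs]
  simp [pre_ez]

lemma opX0_mul_opX0 (hs : s ≠ 0) {i j : Fin N} (hij : i < j) :
    opX0 s i * opX0 s j = s ^ (2 : ℤ) • (opX0 s j * opX0 s i) := by
  simp only [opX0, sh_mul_sh, smul_sh]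
  refine sh_congr (by abel) fun ν => ?_
  simp only [← zpow_add₀ hs, map_add, pre_ez]
  rw [Fin.lt_def] at hij
  rw [if_pos hij, if_neg (by omega)]
  congr 1; ring

lemma rr_eq_twoRho {i : Fin N} (h : i < i.rev) : twoRho i = rr i := by
  rw [twoRho, if_pos h, rr, lev_eq h.le]; ring

lemma commute_opX0_opU (hs : s ≠ 0) {i : Fin N} (hi : i ≤ i.rev) {j : Fin N} (hj : j ≤ j.rev) :
    Commute (opX0 s i) (opU s j) := by
  rw [Commute, SemiconjBy]
  simp only [opX0, opU, sh_mul_sh, uCo]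
  refine sh_congr (by abel) fun ν => ?_
  rw [mul_left_comm, mul_assoc]
  congr 1
  simp only [← zpow_add₀ hs, map_add, pre_ez, out_ez, tot_ez]
  congr 1
  rw [lev_eq hi, lev_eq hj]
  rw [Fin.le_def] at hi hj
  rcases lt_or_ge (j : ℕ) i with h | h
  · have h2 : ¬ ((j.rev : ℕ) < i) := by simp only [Fin.val_rev] at *; omega
    rw [if_pos h, if_neg h2, if_neg (by omega)]; ring
  · have h2 : ¬ ((j.rev : ℕ) < i) := by simp only [Fin.val_rev] at *; omega
    rw [if_neg (by omega), if_neg h2, if_pos (by omega)]; ring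

lemma commute_opX0_innerSum (hs : s ≠ 0) {i : Fin N} (hi : i ≤ i.rev) (k : ℕ) :
    Commute (opX0 s i) (innerSum (opU s) k) :=
  commute_innerSum _ _ _ fun _ hj _ => commute_opX0_opU hs hi hj

lemma opX0_mul_opG (hs : s ≠ 0) (i : Fin N) (k : ℕ) :
    opX0 s i * opG s k = s ^ (if (i : ℕ) < k then 4 else 0 : ℤ) • (opG s k * opX0 s i) := by
  simp only [opX0, opG, sh_mul_sh, smul_sh]
  refine sh_congr (by abel) fun ν => ?_
  simp only [← zpow_add₀ hs, map_add, map_zero, pre_ez]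
  split_ifs <;> (congr 1; ring)

lemma opX0_mul_opOm (hs : s ≠ 0) {i : Fin N} (hi : i ≤ i.rev) (k : ℕ) :
    opX0 s i * opOm N s k = s ^ (if (i : ℕ) < k then 4 else 0 : ℤ) • (opOm N s k * opX0 s i) := by
  rw [opOm, ← mul_assoc, opX0_mul_opG hs, smul_mul_assoc, mul_assoc,
    (commute_opX0_innerSum hs hi k).eq, mul_assoc]

lemma commute_opG_opG (k l : ℕ) :
    Commute (opG s k : Module.End ℂ (Lat N)) (opG s l) := by
  rw [Commute, SemiconjBy]
  simp only [opG, sh_mul_sh]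
  exact sh_congr (by abel) fun ν => by simp [mul_comm]

lemma opU_mul_opG (hs : s ≠ 0) {j : Fin N} (hj : j ≤ j.rev) {l : ℕ} (hl : 2 * l ≤ N) :
    opU s j * opG s l = s ^ (if lev j < l then 4 else 0 : ℤ) • (opG s l * opU s j) := by
  simp only [opU, opG, sh_mul_sh, smul_sh]
  refine sh_congr (by abel) fun ν => ?_
  have h2 : ¬ ((j.rev : ℕ) < l) := by
    rw [Fin.le_def] at hj; simp only [Fin.val_rev] at *; omega
  simp only [uCo, add_zero, map_add, pre_ez, if_neg h2, lev_eq hj]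
  rw [show ∀ a b c : ℂ, (a * b) * c = a * (b * c) by intros; ring,
    show ∀ a b c e : ℂ, e * (c * (a * b)) = a * (e * c * b) by intros; ring]
  congr 1
  simp only [← zpow_add₀ hs]
  split_ifs <;> (congr 1; ring)

lemma opU_mul_opU (hs : s ≠ 0) {j k : Fin N} (h : lev j < lev k) :
    opU s j * opU s k = s ^ (-4 : ℤ) • (opU s k * opU s j) := by
  simp only [opU, sh_mul_sh, smul_sh]
  refine sh_congr (by abel) fun ν => ?_
  simp only [uCo, map_add, out_ez, tot_ez, lev_rev]
  rw [if_neg (show ¬ lev k < lev j + 1 by omega), if_pos (show lev j < lev k + 1 by omega)]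
  rw [show ∀ a b c d e : ℂ, e * ((a * b) * (c * d)) = a * c * (e * (b * d)) by intros; ring,
    show ∀ a b c d : ℂ, (a * b) * (c * d) = c * a * (b * d) by intros; ring]
  congr 1
  simp only [← zpow_add₀ hs]
  congr 1; ring

/-- The contribution of a pair commutes with the squared radius of the coordinates enclosed by it: the
factors `q^2` and `q^{-2}` from the two parts of the latter cancel. -/
lemma commute_opU_opOm (hs : s ≠ 0) {j : Fin N} (hj : j ≤ j.rev) {l : ℕ} (hjl : lev j < l)
    (hl : 2 * l ≤ N) : Commute (opU s j) (opOm N s l) := by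
  rw [Commute, SemiconjBy, opOm, ← mul_assoc, opU_mul_opG hs hj hl, if_pos hjl, smul_mul_assoc,
    mul_assoc, mul_innerSum _ _ _ (s ^ (-4 : ℤ))
      (fun k _ hk => opU_mul_opU hs (lt_of_lt_of_le hjl hk)),
    mul_smul_comm, smul_smul, ← zpow_add₀ hs, mul_assoc]
  simp

lemma commute_opG_opOm (hs : s ≠ 0) {k l : ℕ} (hkl : k ≤ l) (hl : 2 * k ≤ N) :
    Commute (opG s k) (opOm N s l) := by
  refine (commute_opG_opG k l).mul_right (commute_innerSum _ _ _ fun j hj hlj => ?_)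
  have := opU_mul_opG hs hj hl
  rw [if_neg (by omega), zpow_zero, one_smul] at this
  exact this.symm

lemma commute_innerSum_opOm (hs : s ≠ 0) {k l : ℕ} (hkl : k ≤ l) (hl : 2 * l ≤ N) :
    Commute (innerSum (opU s) k) (opOm N s l) := by
  induction hkl using Nat.decreasingInduction with
  | self =>
    refine Commute.mul_right ?_ (Commute.refl _)
    refine (commute_innerSum _ _ _ fun j hj hlj => ?_).symm
    have := opU_mul_opG hs hj hl
    rw [if_neg (by omega), zpow_zero, one_smul] at this
    exact this.symm
  | of_succ k hk ih =>
    have hk' : k < N := by omega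
    have hi : (⟨k, hk'⟩ : Fin N) ≤ (⟨k, hk'⟩ : Fin N).rev := by
      rw [Fin.le_def, Fin.val_rev]; simp only; omega
    have := innerSum_eq_add (opU s) _ hi
    have h2 : lev (⟨k, hk'⟩ : Fin N) = k := lev_eq hi
    rw [h2] at this
    rw [this]
    exact (commute_opU_opOm hs hi (by rw [h2]; exact hk) hl).add_left ih

lemma commute_opOm_opOm (hs : s ≠ 0) {k l : ℕ} (hk : 2 * k ≤ N) (hl : 2 * l ≤ N) :
    Commute (opOm N s k) (opOm N s l) := by
  rcases le_total k l with h | h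
  · exact (commute_opG_opOm hs h hk).mul_left (commute_innerSum_opOm hs h hl)
  · exact ((commute_opG_opOm hs h hl).mul_left (commute_innerSum_opOm hs h hk)).symm

/-! ### The relations between the multiplication operators -/

/-- The difference of two successive normalized squared radii, proportional to `x_i x_{i'}`. -/
def opW (s : ℂ) (i : Fin N) : Module.End ℂ (Lat N) := opOm N s (lev i) - opOm N s (lev i + 1)

lemma opX_of_le {i : Fin N} (h : i ≤ i.rev) : opX s i = opX0 s i := if_pos h

lemma opX_rev {i : Fin N} (h : i < i.rev) : opX s i.rev = qRho s i • (opY s i * opW s i) := by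
  rw [opX, if_neg (by rw [Fin.rev_rev]; exact not_le.2 h), Fin.rev_rev, lev_rev, opW]

lemma opX0_mul_opW_of_lt (hs : s ≠ 0) {i j : Fin N} (hi : i ≤ i.rev) (hj : j ≤ j.rev)
    (hij : i < j) : opX0 s i * opW s j = s ^ (4 : ℤ) • (opW s j * opX0 s i) := by
  rw [Fin.lt_def] at hij
  rw [opW, mul_sub, sub_mul, opX0_mul_opOm hs hi, opX0_mul_opOm hs hi, lev_eq hj, if_pos hij,
    if_pos (by omega), smul_sub]

lemma opX0_mul_opW_of_gt (hs : s ≠ 0) {i j : Fin N} (hi : i ≤ i.rev) (hj : j ≤ j.rev)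
    (hij : j < i) : opX0 s i * opW s j = opW s j * opX0 s i := by
  rw [Fin.lt_def] at hij
  rw [opW, mul_sub, sub_mul, opX0_mul_opOm hs hi, opX0_mul_opOm hs hi, lev_eq hj,
    if_neg (by omega), if_neg (by omega), zpow_zero, one_smul, one_smul]

lemma opW_mul_opY_of_lt (hs : s ≠ 0) {i j : Fin N} (hi : i ≤ i.rev) (hj : j ≤ j.rev)
    (hij : i < j) : opW s j * opY s i = s ^ (4 : ℤ) • (opY s i * opW s j) := by
  have h := congrArg (fun t => opY s i * t * opY s i) (opX0_mul_opW_of_lt hs hi hj hij)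
  simp only [mul_smul_comm, smul_mul_assoc] at h
  rwa [← mul_assoc, opY_mul_opX0 hs, one_mul, mul_assoc (opY s i), mul_assoc (opW s j),
    opX0_mul_opY hs, mul_one] at h

lemma opW_mul_opY_of_gt (hs : s ≠ 0) {i j : Fin N} (hi : i ≤ i.rev) (hj : j ≤ j.rev)
    (hij : j < i) : opW s j * opY s i = opY s i * opW s j := by
  have h := congrArg (fun t => opY s i * t * opY s i) (opX0_mul_opW_of_gt hs hi hj hij)
  rwa [← mul_assoc, opY_mul_opX0 hs, one_mul, mul_assoc (opY s i), mul_assoc (opW s j),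
    opX0_mul_opY hs, mul_one] at h

lemma commute_opW_opW (hs : s ≠ 0) {i j : Fin N} (hi : i < i.rev) (hj : j < j.rev) :
    Commute (opW s i) (opW s j) := by
  have h : ∀ k : Fin N, k < k.rev → 2 * (lev k + 1) ≤ N := by
    intro k hk
    rw [lev_eq hk.le]; simp only [Fin.lt_def, Fin.val_rev] at hk; omega
  have hi' := h i hi
  have hj' := h j hj
  exact ((commute_opOm_opOm hs (by omega) (by omega)).sub_left
    (commute_opOm_opOm hs (by omega) (by omega))).sub_right
    ((commute_opOm_opOm hs (by omega) (by omega)).sub_left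
    (commute_opOm_opOm hs (by omega) (by omega)))

lemma opX0_mul_opY_of_lt (hs : s ≠ 0) {i j : Fin N} (hij : i < j) :
    opX0 s i * opY s j = s ^ (-2 : ℤ) • (opY s j * opX0 s i) := by
  simp only [opX0, opY, sh_mul_sh, smul_sh]
  refine sh_congr (by abel) fun ν => ?_
  simp only [← zpow_add₀ hs, map_add, map_neg, pre_ez]
  rw [Fin.lt_def] at hij
  rw [if_pos hij, if_neg (by omega)]
  congr 1; ring

lemma opX0_mul_opY_of_gt (hs : s ≠ 0) {i j : Fin N} (hij : j < i) :
    opX0 s i * opY s j = s ^ (2 : ℤ) • (opY s j * opX0 s i) := by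
  simp only [opX0, opY, sh_mul_sh, smul_sh]
  refine sh_congr (by abel) fun ν => ?_
  simp only [← zpow_add₀ hs, map_add, map_neg, pre_ez]
  rw [Fin.lt_def] at hij
  rw [if_pos hij, if_neg (by omega)]
  congr 1; ring

lemma opY_mul_opY (hs : s ≠ 0) {i j : Fin N} (hij : i < j) :
    opY s i * opY s j = s ^ (2 : ℤ) • (opY s j * opY s i) := by
  simp only [opY, sh_mul_sh, smul_sh]
  refine sh_congr (by abel) fun ν => ?_
  simp only [← zpow_add₀ hs, map_add, map_neg, pre_ez]
  rw [Fin.lt_def] at hij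
  rw [if_pos hij, if_neg (by omega)]
  congr 1; ring

/-- The `q`-commutation relations of the coordinates. -/
lemma opX_mul_opX (hs : s ≠ 0) {i j : Fin N} (hij : i < j) (h : i ≠ j.rev) :
    opX s i * opX s j = s ^ (2 : ℤ) • (opX s j * opX s i) := by
  rcases le_or_gt j j.rev with hj | hj
  · have hi : i ≤ i.rev := by
      simp only [Fin.lt_def, Fin.le_def, Fin.val_rev] at *; omega
    -- both coordinates act by plain weighted shifts
    rw [opX_of_le hi, opX_of_le hj, opX0_mul_opX0 hs hij]
  · obtain ⟨k, rfl⟩ : ∃ k : Fin N, j = k.rev := ⟨j.rev, by simp⟩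
    rw [Fin.rev_rev] at hj h
    rw [opX_rev hj]
    rcases le_or_gt i i.rev with hi | hi
    · rw [opX_of_le hi]
      simp only [mul_smul_comm, smul_mul_assoc]
      rw [smul_comm (s ^ (2 : ℤ))]
      congr 1
      rcases lt_or_gt_of_ne h with hik | hik
      -- outside of the pair `{k, k'}` the factor `q` is `q^{-1}` from `opY` times `q^2` from `opW`
      · rw [← mul_assoc, opX0_mul_opY_of_lt hs hik, smul_mul_assoc, mul_assoc,
          opX0_mul_opW_of_lt hs hi hj.le hik, mul_smul_comm, smul_smul, ← zpow_add₀ hs, mul_assoc]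
        norm_num
      · rw [← mul_assoc, opX0_mul_opY_of_gt hs hik, smul_mul_assoc, mul_assoc,
          opX0_mul_opW_of_gt hs hi hj.le hik, mul_assoc]
    · obtain ⟨l, rfl⟩ : ∃ l : Fin N, i = l.rev := ⟨i.rev, by simp⟩
      rw [Fin.rev_rev] at hi
      have hkl : k < l := Fin.rev_lt_rev.1 hij
      rw [opX_rev hi]
      simp only [mul_smul_comm, smul_mul_assoc]
      rw [smul_comm (qRho s l), smul_comm (s ^ (2 : ℤ)), smul_comm (s ^ (2 : ℤ))]
      congr 2
      -- `q^2` arises on the left from `opW s l` and `opY s k`, and on the right a second factor `q`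
      -- arises from the exchange of the two `opY`
      rw [← mul_assoc, mul_assoc (opY s l), opW_mul_opY_of_lt hs hj.le hi.le hkl,
        ← mul_assoc, mul_assoc (opY s k), opW_mul_opY_of_gt hs hi.le hj.le hkl]
      simp only [mul_smul_comm, smul_mul_assoc]
      rw [← mul_assoc (opY s k), opY_mul_opY hs hkl]
      simp only [smul_mul_assoc, mul_assoc]
      rw [(commute_opW_opW hs hi hj).eq, smul_smul, ← zpow_add₀ hs]
      norm_num

lemma opX_mul_opX_rev (hs : s ≠ 0) {i : Fin N} (h : i < i.rev) :
    opX s i * opX s i.rev = qRho s i • (opOm N s (lev i) - opOm N s (lev i + 1)) := by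
  rw [opX_of_le h.le, opX_rev h, mul_smul_comm, ← mul_assoc, opX0_mul_opY hs, one_mul, opW]

lemma opX_rev_mul_opX (hs : s ≠ 0) {i : Fin N} (h : i < i.rev) :
    opX s i.rev * opX s i
      = qRho s i • (opOm N s (lev i) - s ^ (-4 : ℤ) • opOm N s (lev i + 1)) := by
  have h1 := opX0_mul_opOm hs h.le (lev i)
  have h2 := opX0_mul_opOm hs h.le (lev i + 1)
  rw [if_neg (by rw [lev_eq h.le]; omega), zpow_zero, one_smul] at h1
  rw [if_pos (by rw [lev_eq h.le]; omega)] at h2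
  have h3 : opOm N s (lev i + 1) * opX0 s i
      = s ^ (-4 : ℤ) • (opX0 s i * opOm N s (lev i + 1)) := by
    rw [h2, smul_smul, ← zpow_add₀ hs]; simp
  rw [opX_of_le h.le, opX_rev h, smul_mul_assoc, mul_assoc, opW, sub_mul, ← h1, h3,
    ← mul_smul_comm (s ^ (-4 : ℤ)), ← mul_sub, ← mul_assoc, opY_mul_opX0 hs, one_mul]

lemma opX_mid_sq (hs : s ≠ 0) (hs1 : s ^ 2 + 1 ≠ 0) {c : Fin N} (h : c = c.rev) :
    opX s c * opX s c = (1 + s ^ (-2 : ℤ)) • opOm N s (lev c) := by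
  have hc := (two_lev_eq_iff c).2 h
  have hl := lev_eq h.le
  rw [opX_of_le h.le, opOm, innerSum_eq_add _ _ h.le, innerSum_eq_zero _ (by omega), add_zero]
  simp only [opX0, opG, opU, sh_mul_sh, smul_sh]
  refine sh_congr (by rw [← h]; abel) fun ν => ?_
  simp only [uCo, if_pos h, out_top (show N ≤ 2 * ((c : ℕ) + 1) by omega), map_add, pre_ez, hl]
  have hr : rr c = -1 := by rw [rr]; omega
  rw [← h, if_neg (lt_irrefl _), hr]
  have e1 : (-(-1) - 2 * tot ν + 2 * tot ν : ℤ) = 1 := by ring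
  rw [e1, zpow_one, ← zpow_add₀ hs, zpow_neg]
  have e2 : (-4 * (pre (↑c) ν + (0 + 0)) : ℤ) = -2 * (pre (↑c) ν + 0) + -2 * pre (↑c) ν := by ring
  rw [e2]
  have : (1 + (s ^ (2 : ℤ))⁻¹) * (s / (s ^ 2 + 1) * s) = 1 := by
    rw [zpow_ofNat]; field_simp
  linear_combination (-s ^ (-2 * (pre (↑c) ν + 0) + -2 * pre (↑c) ν)) * this

/-- A telescoping sum over the inner pairs, common to the squared radius and to the Laplace
operator: if both products of a pair are combinations of `Z_k` and `Z_{k+1}` as below, then the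
contribution of `Z_{k+1}` is cancelled by the sum over the pairs further inside. -/
lemma sum_inner_telescope {M : Type*} [AddCommGroup M] [Module ℂ M] (A : Fin N → M)
    (Z : ℕ → M)
    (h1 : ∀ i : Fin N, i < i.rev → A i = Z (lev i) - Z (lev i + 1))
    (h2 : ∀ i : Fin N, i < i.rev → A i.rev = s ^ (2 * twoRho i) • Z (lev i)
      - s ^ (2 * twoRho i - 4) • Z (lev i + 1))
    (h3 : ∀ c : Fin N, c = c.rev → A c = (1 + s ^ (-2 : ℤ)) • Z (lev c))
    (h4 : ∀ k, N = 2 * k → Z k = 0) {k : ℕ} (hk : 2 * k ≤ N) :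
    ∑ j with k ≤ lev j, A j = (1 + s ^ (2 * ((N : ℤ) - 2 - 2 * k))) • Z k := by
  obtain ⟨d, hd⟩ := Nat.exists_eq_add_of_le hk
  induction d using Nat.strong_induction_on generalizing k with
  | _ d ih =>
    rcases Nat.eq_zero_or_pos d with h0 | h0
    · rw [h4 k (by omega), smul_zero]
      refine Finset.sum_eq_zero fun j hj => ?_
      have := two_lev j
      simp only [Finset.mem_filter] at hj
      omega
    · have hkN : k < N := by omega
      set i : Fin N := ⟨k, hkN⟩ with hi
      have hir : i ≤ i.rev := by rw [Fin.le_def, Fin.val_rev]; simp only [hi]; omega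
      have hl : lev i = k := lev_eq hir
      have hsplit : ∀ j : Fin N, k ≤ lev j ↔ (j = i ∨ j = i.rev) ∨ k + 1 ≤ lev j := by
        intro j
        constructor
        · intro h
          rcases Nat.eq_or_lt_of_le h with h | h
          · exact Or.inl (lev_inj (h.symm.trans hl.symm))
          · exact Or.inr h
        · rintro ((rfl | rfl) | h)
          · exact hl.ge
          · rw [lev_rev]; exact hl.ge
          · omega
      rcases hir.lt_or_eq with hlt | heq
      · have e : (Finset.univ.filter fun j : Fin N => k ≤ lev j)
            = insert i (insert i.rev (Finset.univ.filter fun j : Fin N => k + 1 ≤ lev j)) := by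
          ext j
          simp only [Finset.mem_filter, Finset.mem_univ, true_and, Finset.mem_insert]
          rw [hsplit]; tauto
        have hlt' := hlt
        simp only [Fin.lt_def, Fin.val_rev, hi] at hlt'
        rw [e, Finset.sum_insert (by simp [hl, hlt.ne]), Finset.sum_insert (by simp [lev_rev, hl]),
          ih (d - 2) (by omega) (by omega) (by omega), h1 i hlt, h2 i hlt, rr_eq_twoRho hlt, rr, hl]
        push_cast
        rw [show (2 * ((N : ℤ) - 2 - 2 * (k + 1))) = 2 * (N - 2 - 2 * k) - 4 by ring]
        module
      · have e : (Finset.univ.filter fun j : Fin N => k ≤ lev j) = {i} := by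
          ext j
          simp only [Finset.mem_filter, Finset.mem_univ, true_and, Finset.mem_singleton]
          rw [hsplit, ← heq]
          have := two_lev j
          have := (two_lev_eq_iff i).2 heq
          constructor
          · rintro (h | h)
            · tauto
            · omega
          · tauto
        have := (two_lev_eq_iff i).2 heq
        rw [e, Finset.sum_singleton, h3 i heq, hl]
        congr 3
        omega

/-! ### The representation of the algebra on functions on the lattice -/

/-- `q = s ^ 2` is not a root of unity (and not zero). -/
structure Generic (s : ℂ) : Prop where
  ne : s ≠ 0
  pow_ne : ∀ r : ℕ, 0 < r → (s ^ 2) ^ r ≠ 1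

lemma Generic.zpow_ne (h : Generic s) {k : ℤ} (hk : k ≠ 0) : s ^ (2 * k) ≠ 1 := by
  rw [zpow_mul, zpow_ofNat]
  rcases Int.natAbs_eq k with h1 | h1
  · rw [h1, zpow_natCast]; exact h.pow_ne _ (by omega)
  · rw [h1, zpow_neg, zpow_natCast, ne_eq, inv_eq_one]; exact h.pow_ne _ (by omega)

lemma Generic.one_add_ne (h : Generic s) (k : ℤ) : 1 + s ^ (2 * k) ≠ 0 := by
  intro h0
  have h1 : s ^ (2 * k) = -1 := by linear_combination h0
  rcases eq_or_ne k 0 with rfl | hk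
  · norm_num at h0
  · apply h.zpow_ne (k := 2 * k) (by omega)
    rw [two_mul k, mul_add, zpow_add₀ h.ne, h1]; norm_num

lemma Generic.sq_add_one_ne (h : Generic s) : s ^ 2 + 1 ≠ 0 := by
  have := h.one_add_ne 1
  rwa [mul_one, zpow_ofNat, add_comm] at this

lemma Generic.one_sub_sq_ne (h : Generic s) : 1 - s ^ 2 ≠ 0 := by
  have := h.zpow_ne (k := 1) one_ne_zero
  rw [mul_one, zpow_ofNat] at this
  exact sub_ne_zero.2 this.symm

lemma Generic.one_sub_pow_four_ne (h : Generic s) : 1 - s ^ 4 ≠ 0 := by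
  have := h.zpow_ne (k := 2) two_ne_zero
  rw [show (2 * 2 : ℤ) = 4 by norm_num, zpow_ofNat] at this
  exact sub_ne_zero.2 this.symm

lemma twoRho_rev (i : Fin N) : twoRho i.rev = -twoRho i := by
  simp only [twoRho, Fin.rev_rev]
  rcases lt_trichotomy i i.rev with h | h | h
  · rw [if_neg h.not_gt, if_pos h, if_pos h]
  · rw [if_neg h.not_gt, if_neg (h ▸ lt_irrefl _), if_neg (h ▸ lt_irrefl _), if_neg h.not_gt]; simp
  · rw [if_pos h, if_neg h.not_gt, if_pos h]; ring

lemma twoRho_mid {c : Fin N} (h : c = c.rev) : twoRho c = 0 := by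
  have := twoRho_rev c
  rw [← h] at this; omega

lemma qRho_mul_qRho_rev (hs : s ≠ 0) (i : Fin N) : qRho s i * qRho s i.rev = 1 := by
  rw [qRho, qRho, twoRho_rev, ← zpow_add₀ hs]; simp

lemma qRho_mid {c : Fin N} (h : c = c.rev) : qRho s c = 1 := by
  rw [qRho, twoRho_mid h, zpow_zero]

lemma opOm_eq_zero {k : ℕ} (hk : N = 2 * k) : opOm N s k = 0 := by
  rw [opOm, innerSum_eq_zero _ hk.le, mul_zero]

/-- The squared radius of the inner coordinates is proportional to its normally ordered form. -/
lemma sum_opX_mul_opX (hs : s ≠ 0) (hs1 : s ^ 2 + 1 ≠ 0) {k : ℕ} (hk : 2 * k ≤ N) :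
    ∑ j : Fin N with k ≤ lev j, qRho s j.rev • (opX s j * opX s j.rev)
      = (1 + s ^ (2 * ((N : ℤ) - 2 - 2 * k))) • opOm N s k := by
  refine sum_inner_telescope _ _ (fun i hi => ?_) (fun i hi => ?_) (fun c hc => ?_)
    (fun k hk => opOm_eq_zero hk) hk
  · rw [opX_mul_opX_rev hs hi, smul_smul, mul_comm, qRho_mul_qRho_rev hs, one_smul]
  · rw [Fin.rev_rev, opX_rev_mul_opX hs hi, smul_smul, smul_sub, smul_smul, qRho,
      ← zpow_add₀ hs, ← zpow_add₀ hs]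
    congr 3 <;> ring
  · rw [← hc, qRho_mid hc, one_smul, opX_mid_sq hs hs1 hc]

lemma opX_comm_sub (hs : s ≠ 0) {i : Fin N} (hi : i < i.rev) :
    opX s i.rev * opX s i - opX s i * opX s i.rev
      = (s ^ twoRho i * (1 - s ^ (-4 : ℤ))) • opOm N s (lev i + 1) := by
  rw [opX_mul_opX_rev hs hi, opX_rev_mul_opX hs hi, qRho]
  module

/-- The operators `opX` satisfy the defining relations of the quantum Euclidean space. -/
lemma lift_opX_eq (h : Generic s) {a b : FreeAlgebra ℂ (Fin N)} (hab : Rel N s a b) :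
    FreeAlgebra.lift ℂ (opX s) a = FreeAlgebra.lift ℂ (opX s) b := by
  have hs := h.ne
  cases hab with
  | qcomm i j hij hne =>
    have := opX_mul_opX hs hij hne
    rw [zpow_ofNat] at this
    simpa using this
  | conj i hi =>
    have hlt : i < i.rev := by simp only [Fin.lt_def, Fin.val_rev]; omega
    -- the sum in the relation is the squared radius of the coordinates enclosed by `{i, i'}`
    have hset : Finset.Ioo i i.rev = Finset.univ.filter fun j : Fin N => lev i + 1 ≤ lev j := by
      ext j
      have := j.2
      simp only [Finset.mem_Ioo, Finset.mem_filter, Finset.mem_univ, true_and]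
      rw [lev_eq hlt.le]
      simp only [lev, Fin.lt_def, Fin.val_rev]; omega
    have hsum := sum_opX_mul_opX (N := N) hs h.sq_add_one_ne (k := lev i + 1)
      (by rw [lev_eq hlt.le]; omega)
    simp only [map_sub, map_mul, map_smul, map_sum, FreeAlgebra.lift_ι_apply]
    rw [hset, hsum, opX_comm_sub hs hlt, smul_smul]
    congr 1
    rw [rr_eq_twoRho hlt, rr]
    push_cast
    set t : ℤ := N - 2 - 2 * lev i with ht
    have e1 : (2 * ((N : ℤ) - 2 - 2 * (lev i + 1))) = 2 * (t - 2) := by rw [ht]; ring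
    rw [e1]
    have h1 := h.one_add_ne (t - 2)
    have h2 : s ^ (t - 2) + s ^ (2 - t) = s ^ (2 - t) * (1 + s ^ (2 * (t - 2))) := by
      rw [mul_add, ← zpow_add₀ hs, mul_one, add_comm]; congr 2; ring
    have h3 : s ^ t = s ^ 2 * (s ^ (2 - t))⁻¹ * s ^ (0 : ℤ) := by
      rw [← zpow_neg, ← zpow_natCast, ← zpow_add₀ hs, ← zpow_add₀ hs]; congr 1; push_cast; ring
    have h4 : s ^ (2 - t) ≠ 0 := zpow_ne_zero _ hs
    rw [h2, h3, show (-4 : ℤ) = -(4 : ℕ) by norm_num, zpow_neg, zpow_natCast]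
    field_simp
  | odd i c hc hi =>
    have hcr := hc.symm
    have hc' := (two_lev_eq_iff c).2 hcr
    have hlc := lev_eq hcr.le
    have hlt : i < i.rev := by simp only [Fin.lt_def, Fin.val_rev]; omega
    have hli := lev_eq hlt.le
    simp only [map_sub, map_mul, map_smul, map_pow, FreeAlgebra.lift_ι_apply]
    rw [pow_two, opX_comm_sub hs hlt, opX_mid_sq hs h.sq_add_one_ne hcr, smul_smul, hli, hlc, hi]
    congr 1
    rw [rr_eq_twoRho hlt, rr, hli]
    have : (N : ℤ) - 2 - 2 * (i : ℕ) = 1 := by omega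
    rw [this, show (-4 : ℤ) = -(4 : ℕ) by norm_num, show (-2 : ℤ) = -(2 : ℕ) by norm_num,
      zpow_neg, zpow_neg, zpow_natCast, zpow_natCast, zpow_one]
    field_simp
    ring
  | even i hi =>
    have hlt : i < i.rev := by simp only [Fin.lt_def]; omega
    simp only [map_mul, FreeAlgebra.lift_ι_apply]
    rw [← sub_eq_zero, opX_comm_sub hs hlt, opOm_eq_zero, smul_zero]
    rw [lev_eq hlt.le]; rw [Fin.val_rev] at hi; omega

/-- The representation of `𝒜` in which `x_i` acts by `opX s i`. -/
def rep (N : ℕ) (h : Generic s) : Alg N s →ₐ[ℂ] Module.End ℂ (Lat N) :=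
  RingCon.liftₐ (ringConGen (Rel N s)) (FreeAlgebra.lift ℂ (opX s))
    (RingCon.ringConGen_le.2 fun _ _ hab => lift_opX_eq h hab)

lemma rep_x (h : Generic s) (i : Fin N) : rep N h (x s i) = opX s i :=
  FreeAlgebra.lift_ι_apply _ _

/-- The symbol map `a ↦ a · e_0`, which sends `x^ν` to `e_ν`. -/
def symb (N : ℕ) (h : Generic s) : Alg N s →ₗ[ℂ] Lat N :=
  (LinearMap.applyₗ (pt 0)).comp (rep N h).toLinearMap

lemma symb_mul (h : Generic s) (a b : Alg N s) : symb N h (a * b) = rep N h a (symb N h b) := by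
  simp [symb]

/-! ### Ordered monomials -/

lemma prod_ofFn_update {M : Type*} [Monoid M] {n : ℕ} (f g : Fin n → M) (j : Fin n) (a : M)
    (hf : ∀ i < j, f i = 1) (hg : ∀ i < j, g i = 1) (hj : g j = a * f j)
    (hgt : ∀ i, j < i → g i = f i) : (List.ofFn g).prod = a * (List.ofFn f).prod := by
  induction n with
  | zero => exact j.elim0
  | succ n ih =>
    rw [List.ofFn_succ, List.ofFn_succ, List.prod_cons, List.prod_cons]
    rcases Fin.eq_zero_or_eq_succ j with rfl | ⟨k, rfl⟩
    · rw [hj, mul_assoc]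
      congr 3
      exact congrArg List.ofFn (funext fun i => hgt _ (Fin.succ_pos i))
    · rw [hf 0 (Fin.succ_pos k), hg 0 (Fin.succ_pos k), one_mul, one_mul]
      exact ih _ _ k (fun i hi => hf _ (Fin.succ_lt_succ_iff.2 hi))
        (fun i hi => hg _ (Fin.succ_lt_succ_iff.2 hi)) hj
        (fun i hi => hgt _ (Fin.succ_lt_succ_iff.2 hi))

lemma ε_apply (i j : Fin N) : ε i j = if j = i then 1 else 0 := by
  simp [ε, Pi.single_apply]

lemma mono_add_ε (ν : Fin N → ℕ) (j : Fin N) (h : ∀ i < j, ν i = 0) :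
    mono s (ν + ε j) = x s j * mono s ν := by
  refine prod_ofFn_update _ _ j _ (fun i hi => ?_) (fun i hi => ?_) ?_ (fun i hi => ?_)
  · rw [h i hi, pow_zero]
  · simp [ε_apply, h i hi, hi.ne]
  · simp [ε_apply, pow_succ']
  · simp [ε_apply, hi.ne']

lemma mono_zero : mono s (0 : Fin N → ℕ) = 1 := by
  simp [mono]

/-- A nonzero exponent is `μ + ε_j`, where `j` is its first nonzero index. -/
lemma exists_eq_add_ε (ν : Fin N → ℕ) (h : ν ≠ 0) :
    ∃ (j : Fin N) (μ : Fin N → ℕ), ν = μ + ε j ∧ ∀ i < j, ν i = 0 := by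
  have hne : (Finset.univ.filter fun i => ν i ≠ 0).Nonempty := by
    obtain ⟨i, hi⟩ := Function.ne_iff.1 h
    exact ⟨i, by simpa using hi⟩
  set j := (Finset.univ.filter fun i => ν i ≠ 0).min' hne with hj
  have h1 : ν j ≠ 0 := by simpa using Finset.min'_mem _ hne
  refine ⟨j, ν - ε j, ?_, fun i hi => ?_⟩
  · ext i
    simp only [Pi.add_apply, Pi.sub_apply, ε_apply]
    split_ifs with hij
    · subst hij; omega
    · omega
  · by_contra h2
    exact absurd (Finset.min'_le (Finset.univ.filter fun i => ν i ≠ 0) i (by simpa using h2))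
      (not_le.2 hi)

lemma sum_add_ε (μ : Fin N → ℕ) (j : Fin N) : ∑ i, (μ + ε j) i = ∑ i, μ i + 1 := by
  simp [Finset.sum_add_distrib, ε_apply]

/-- The exponent of a monomial as a point of the lattice. -/
def zc (ν : Fin N → ℕ) : Fin N → ℤ := fun i => ν i

lemma zc_add (μ ν : Fin N → ℕ) : zc (μ + ν) = zc μ + zc ν := by
  ext i; simp [zc]

lemma zc_ε (i : Fin N) : zc (ε i) = ez i := by
  ext j; simp [zc, ε_apply, ez_apply]

lemma tot_zc (ν : Fin N → ℕ) : tot (zc ν) = ((∑ i, ν i : ℕ) : ℤ) := by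
  simp [tot, zc]

lemma pre_zc (k : ℕ) (ν : Fin N → ℕ) :
    pre k (zc ν) = ((∑ i : Fin N with i.val < k, ν i : ℕ) : ℤ) := by
  simp [pre, zc]

/-- A coordinate that precedes all coordinates of a monomial only raises its exponent. -/
lemma opX_pt (h : Generic s) (j : Fin N) (μ : Fin N → ℕ) (hμ : ∀ i < j, μ i = 0) :
    opX s j (pt (zc μ)) = pt (zc μ + ez j) := by
  rcases le_or_gt j j.rev with hj | hj
  · rw [opX_of_le hj, opX0, sh_pt, pre_zc, Finset.sum_eq_zero]
    · simp
    · intro i hi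
      simp only [Finset.mem_filter, Finset.mem_univ, true_and] at hi
      exact hμ i hi
  · obtain ⟨i, rfl⟩ : ∃ i : Fin N, j = i.rev := ⟨j.rev, by simp⟩
    rw [Fin.rev_rev] at hj
    have hl := lev_eq hj.le
    have hlt := hj
    simp only [Fin.lt_def, Fin.val_rev] at hlt
    have hp : ∀ k : ℕ, k ≤ N - i - 1 → pre k (zc μ) = 0 := by
      intro k hk
      rw [pre_zc, Finset.sum_eq_zero]
      · simp
      · intro l hl
        simp only [Finset.mem_filter, Finset.mem_univ, true_and] at hl
        exact hμ l (by simp only [Fin.lt_def, Fin.val_rev]; omega)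
    -- the terms of `x_{i'}` from the inner pairs contain the difference of two diagonal operators
    -- that agree on `x^μ`, because `x_i` does not occur in it
    have hW : opW s i = opG s i * opU s i
        + (opG s i - opG s (i + 1)) * innerSum (opU s) (i + 1) := by
      have := innerSum_eq_add (opU s) i hj.le
      rw [hl] at this
      rw [opW, opOm, opOm, hl, this, mul_add, sub_mul]; abel
    have hG : (opG s i - opG s (i + 1) : Module.End ℂ (Lat N)) * innerSum (opU s) (i + 1)
        = innerSum (opU s) (i + 1) * (opG s i - opG s (i + 1)) := by
      refine (commute_innerSum _ _ _ fun k hk hik => ?_).eq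
      have h1 := opU_mul_opG h.ne hk (l := i) (by omega)
      have h2 := opU_mul_opG h.ne hk (l := i + 1) (by omega)
      rw [if_neg (by omega), zpow_zero, one_smul] at h1 h2
      exact (Commute.sub_right h1 h2).symm
    have hz : (opG s i - opG s (i + 1) : Module.End ℂ (Lat N)) (pt (zc μ)) = 0 := by
      rw [opG, opG, sh_sub, sh_pt, hp _ (by omega), hp _ (by omega)]; simp
    rw [opX_rev hj, hW, hG]
    simp only [LinearMap.smul_apply, Module.End.mul_apply, LinearMap.add_apply, hz, map_zero,
      add_zero]
    rw [opU, opG, opY, sh_pt, map_smul, sh_pt, map_smul, map_smul, sh_pt, smul_smul, smul_smul,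
      smul_smul]
    have ho : out (i + 1) (zc μ) = tot (zc μ) := by
      have := out_eq (N := N) (k := i + 1) (by omega) (zc μ)
      rw [hp _ (by omega), hp (N - (i + 1)) (by omega)] at this
      rw [this]; ring
    simp only [uCo, if_neg hj.ne, map_add, add_zero, pre_ez, hp i (by omega), hl, ho, Fin.val_rev]
    rw [if_neg (by omega), if_neg (by omega), qRho, rr_eq_twoRho hj]
    have : zc μ + (ez i + ez i.rev) + -ez i = zc μ + ez i.rev := by abel
    rw [this]
    convert one_smul ℂ _
    simp only [one_mul, ← zpow_add₀ h.ne]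
    convert zpow_zero s using 2
    ring

lemma symb_mono (h : Generic s) (ν : Fin N → ℕ) : symb N h (mono s ν) = pt (zc ν) := by
  obtain ⟨d, hd⟩ : ∃ d, d = ∑ i, ν i := ⟨_, rfl⟩
  induction d generalizing ν with
  | zero =>
    have : ν = 0 := by
      ext i
      exact (Finset.sum_eq_zero_iff.1 hd.symm) i (Finset.mem_univ i)
    subst this
    rw [mono_zero]
    simp only [symb, LinearMap.comp_apply, AlgHom.toLinearMap_apply, map_one,
      LinearMap.applyₗ_apply_apply, Module.End.one_apply]
    congr 1
  | succ d ih =>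
    obtain ⟨j, μ, rfl, hj⟩ := exists_eq_add_ε ν (by rintro rfl; simp at hd)
    have hμ : ∀ i < j, μ i = 0 := fun i hi => by have := hj i hi; simp at this; exact this.1
    rw [sum_add_ε] at hd
    rw [mono_add_ε _ _ hμ, symb_mul, ih μ (by omega), rep_x, opX_pt h _ _ hμ, zc_add, zc_ε]

/-! ### The basis of ordered monomials -/

lemma mk_eq_of_rel {a b : FreeAlgebra ℂ (Fin N)} (h : Rel N s a b) :
    Alg.mk N s a = Alg.mk N s b :=
  (RingCon.eq _).2 (RingCon.le_ringConGen _ _ h)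

lemma x_mul_x {i j : Fin N} (hij : i < j) (h : i ≠ j.rev) :
    x s i * x s j = s ^ 2 • (x s j * x s i) := by
  simpa [x] using mk_eq_of_rel (Rel.qcomm (s := s) i j hij h)

lemma exists_x_rev_mul_x {i : Fin N} (hi : i < i.rev) :
    ∃ c : Fin N → ℂ, x s i.rev * x s i
      = x s i * x s i.rev + ∑ j ∈ Finset.Ioo i i.rev, c j • (x s j * x s j.rev) := by
  have hi' := hi
  simp only [Fin.lt_def, Fin.val_rev] at hi'
  by_cases h1 : (i : ℕ) + 1 < N / 2
  · refine ⟨fun j => ((s ^ 2 - (s ^ 2)⁻¹) / (s ^ (twoRho i - 2) + s ^ (2 - twoRho i)))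
      * qRho s j.rev, ?_⟩
    have := mk_eq_of_rel (Rel.conj (s := s) i h1)
    simp only [map_sub, map_mul, map_smul, map_sum] at this
    rw [sub_eq_iff_eq_add', Finset.smul_sum] at this
    simp only [smul_smul] at this
    exact this
  · by_cases h2 : (i : ℕ) + 1 = i.rev
    · refine ⟨0, ?_⟩
      have := mk_eq_of_rel (Rel.even (s := s) i h2)
      simpa [x] using this
    · simp only [Fin.val_rev] at h2
      set c : Fin N := ⟨i + 1, by omega⟩ with hc
      have hcr : c.rev = c := by
        simp only [hc, Fin.ext_iff, Fin.val_rev]; omega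
      refine ⟨fun _ => s - s⁻¹, ?_⟩
      have := mk_eq_of_rel (Rel.odd (s := s) i c hcr rfl)
      have hset : Finset.Ioo i i.rev = {c} := by
        ext j
        simp only [Finset.mem_Ioo, Finset.mem_singleton, Fin.lt_def, Fin.ext_iff, Fin.val_rev, hc]
        omega
      simp only [map_sub, map_mul, map_smul, map_pow] at this
      rw [hset, Finset.sum_singleton, hcr, ← pow_two]
      rwa [sub_eq_iff_eq_add'] at this

lemma mono_mem_homog (ν : Fin N → ℕ) : mono s ν ∈ homog N s (∑ i, ν i) :=
  Submodule.subset_span ⟨ν, rfl, rfl⟩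

/-- Straightening: a coordinate times an ordered monomial is a combination of ordered monomials,
by induction on the degree and then on the index of the coordinate. -/
lemma x_mul_mem_homog (h : Generic s) (d : ℕ) (i : Fin N) {a : Alg N s}
    (ha : a ∈ homog N s d) : x s i * a ∈ homog N s (d + 1) := by
  induction d using Nat.strong_induction_on generalizing i a with
  | _ d ihd =>
  induction i using WellFoundedLT.induction generalizing a with
  | _ i ihi =>
  induction ha using Submodule.span_induction with
  | zero => simp
  | add a b _ _ ha hb => rw [mul_add]; exact add_mem ha hb
  | smul c a _ ha => rw [mul_smul_comm]; exact Submodule.smul_mem _ _ ha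
  | mem a ha =>
    obtain ⟨ν, rfl, rfl⟩ := ha
    by_cases h0 : ∀ l < i, ν l = 0
    · rw [← mono_add_ε _ _ h0, ← sum_add_ε ν i]
      exact mono_mem_homog _
    -- otherwise the first coordinate `x_j` of the monomial precedes `x_i`; after the exchange of the
    -- two, the leftmost coordinate has an index below `i` in all terms
    · have hν : ν ≠ 0 := by rintro rfl; simp at h0
      obtain ⟨j, μ, rfl, hj⟩ := exists_eq_add_ε ν hν
      have hji : j < i := by
        by_contra hji
        exact h0 fun l hl => hj l (lt_of_lt_of_le hl (not_lt.1 hji))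
      have hμ : ∀ l < j, μ l = 0 := fun l hl => by have := hj l hl; simp at this; exact this.1
      rw [mono_add_ε _ _ hμ, ← mul_assoc]
      rw [sum_add_ε] at ihd ihi ⊢
      have hμm := mono_mem_homog (s := s) μ
      have hlow : ∀ k l : Fin N, k < i →
          x s k * (x s l * mono s μ) ∈ homog N s (∑ i, μ i + 1 + 1) := fun k l hk =>
        ihi k hk (ihd _ (Nat.lt_succ_self _) l hμm)
      by_cases hij : j = i.rev
      · subst hij
        have hr := exists_x_rev_mul_x (s := s) (i := i.rev) (by rwa [Fin.rev_rev])
        rw [Fin.rev_rev] at hr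
        obtain ⟨c, hc⟩ := hr
        rw [hc, add_mul, mul_assoc, Finset.sum_mul]
        refine add_mem (hlow _ _ hji) (Submodule.sum_mem _ fun k hk => ?_)
        rw [smul_mul_assoc, mul_assoc]
        exact Submodule.smul_mem _ _ (hlow _ _ (Finset.mem_Ioo.1 hk).2)
      · have hx := x_mul_x (s := s) hji hij
        have hx' : x s i * x s j = (s ^ 2)⁻¹ • (x s j * x s i) := by
          rw [hx, smul_smul, inv_mul_cancel₀ (pow_ne_zero 2 h.ne), one_smul]
        rw [hx', smul_mul_assoc, mul_assoc]
        exact Submodule.smul_mem _ _ (hlow _ _ hji)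

lemma span_mono (h : Generic s) :
    ⊤ ≤ Submodule.span ℂ (Set.range (mono s : (Fin N → ℕ) → Alg N s)) := by
  set S := Submodule.span ℂ (Set.range (mono s : (Fin N → ℕ) → Alg N s)) with hS
  have hhom : ∀ d, homog N s d ≤ S := fun d =>
    Submodule.span_mono (by rintro _ ⟨ν, _, rfl⟩; exact ⟨ν, rfl⟩)
  have hx : ∀ i, ∀ a ∈ S, x s i * a ∈ S := by
    intro i a ha
    induction ha using Submodule.span_induction with
    | zero => simp
    | add a b _ _ ha hb => rw [mul_add]; exact add_mem ha hb
    | smul c a _ ha => rw [mul_smul_comm]; exact Submodule.smul_mem _ _ ha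
    | mem a ha =>
      obtain ⟨ν, rfl⟩ := ha
      exact hhom _ (x_mul_mem_homog h _ i (mono_mem_homog ν))
  have h1 : (1 : Alg N s) ∈ S := Submodule.subset_span ⟨0, mono_zero⟩
  have hall : ∀ f : FreeAlgebra ℂ (Fin N), ∀ a ∈ S, Alg.mk N s f * a ∈ S := by
    intro f
    induction f using FreeAlgebra.induction with
    | grade0 c =>
      intro a ha
      rw [AlgHom.commutes, Algebra.algebraMap_eq_smul_one, smul_mul_assoc, one_mul]
      exact Submodule.smul_mem _ _ ha
    | grade1 i => exact hx i
    | mul f g hf hg =>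
      intro a ha
      rw [map_mul, mul_assoc]
      exact hf _ (hg _ ha)
    | add f g hf hg =>
      intro a ha
      rw [map_add, add_mul]
      exact add_mem (hf _ ha) (hg _ ha)
  intro a _
  obtain ⟨f, rfl⟩ : ∃ f, Alg.mk N s f = a := RingCon.mkₐ_surjective (α := ℂ) _ a
  simpa using hall f 1 h1

lemma zc_injective : Function.Injective (zc : (Fin N → ℕ) → _) := fun μ ν h => by
  ext i
  have := congrFun h i
  simpa [zc] using this

lemma linearIndependent_pt : LinearIndependent ℂ (pt : (Fin N → ℤ) → Lat N) :=
  Pi.linearIndependent_single_one _ _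

/-- The ordered monomials form a basis of `𝒜`. -/
def monoBasis (N : ℕ) (h : Generic s) : Module.Basis (Fin N → ℕ) ℂ (Alg N s) :=
  Module.Basis.mk (v := mono s) (by
    have h1 : LinearIndependent ℂ (symb N h ∘ mono s) := by
      have : symb N h ∘ mono s = pt ∘ zc := funext fun ν => symb_mono h ν
      rw [this]
      exact linearIndependent_pt.comp _ zc_injective
    exact LinearIndependent.of_comp _ h1) (span_mono h)

lemma monoBasis_apply (h : Generic s) (ν : Fin N → ℕ) : monoBasis N h ν = mono s ν := by
  simp [monoBasis]

lemma opOfMono_mono (h : Generic s) (f : (Fin N → ℕ) → Alg N s) (ν : Fin N → ℕ) :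
    opOfMono f (mono s ν) = f ν := by
  have hex : ∃ T : Module.End ℂ (Alg N s), ∀ ν, T (mono s ν) = f ν :=
    ⟨(monoBasis N h).constr ℂ f, fun ν => by
      rw [← monoBasis_apply h, Module.Basis.constr_basis]⟩
  rw [opOfMono, dif_pos hex]
  exact hex.choose_spec ν

/-- An operator with prescribed values on monomials corresponds under the symbol map to the operator
on functions on the lattice whose values on the points `ν ∈ ℕ^N` are the same. -/
lemma symb_opOfMono (h : Generic s) {f : (Fin N → ℕ) → Alg N s} {T : Module.End ℂ (Lat N)}
    (hT : ∀ ν, symb N h (f ν) = T (pt (zc ν))) (a : Alg N s) :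
    symb N h (opOfMono f a) = T (symb N h a) := by
  have : (symb N h).comp (opOfMono f) = T.comp (symb N h) :=
    (monoBasis N h).ext fun ν => by
      rw [monoBasis_apply, LinearMap.comp_apply, LinearMap.comp_apply, opOfMono_mono h, hT,
        symb_mono]
  exact LinearMap.congr_fun this a

lemma symb_apply_zc (h : Generic s) (a : Alg N s) (ν : Fin N → ℕ) :
    symb N h a (zc ν) = (monoBasis N h).repr a ν := by
  have : (LinearMap.proj (zc ν)).comp (symb N h)
      = (Finsupp.lapply ν).comp ((monoBasis N h).repr : Alg N s →ₗ[ℂ] _) :=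
    (monoBasis N h).ext fun μ => by
      simp only [LinearMap.comp_apply, monoBasis_apply, symb_mono, LinearMap.proj_apply,
        LinearEquiv.coe_coe, Finsupp.lapply_apply]
      rw [← monoBasis_apply h, Module.Basis.repr_self, pt, Pi.single_apply, Finsupp.single_apply]
      simp only [zc_injective.eq_iff, eq_comm]
  exact LinearMap.congr_fun this a

/-- The symbol map reads off the coordinates in the basis of monomials. -/
lemma symb_injective (h : Generic s) : Function.Injective (symb N h) := fun a b hab =>
  (monoBasis N h).repr.injective (Finsupp.ext fun ν => by
    rw [← symb_apply_zc, ← symb_apply_zc, hab])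

/-! ### The grading -/

/-- The functions supported on exponents of total degree `d`. -/
def latDeg (N : ℕ) (d : ℤ) : Submodule ℂ (Lat N) where
  carrier := {f | ∀ ν, f ν ≠ 0 → tot ν = d}
  zero_mem' := fun ν hν => absurd rfl hν
  add_mem' := fun {f g} hf hg ν hν => by
    by_contra hd
    have h1 : f ν = 0 := by by_contra h1; exact hd (hf ν h1)
    have h2 : g ν = 0 := by by_contra h2; exact hd (hg ν h2)
    exact hν (by simp [h1, h2])
  smul_mem' := fun c f hf ν hν => hf ν fun h0 => hν (by simp [h0])

lemma sh_mem_latDeg {δ : Fin N → ℤ} (c : (Fin N → ℤ) → ℂ) {d e : ℤ} (he : d + tot δ = e)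
    {f : Lat N} (hf : f ∈ latDeg N d) : sh δ c f ∈ latDeg N e := by
  intro ν hν
  have := hf (ν - δ) fun h0 => hν (by rw [sh_apply, h0, mul_zero])
  rw [map_sub] at this
  omega

lemma pt_mem_latDeg (ν : Fin N → ℤ) : pt ν ∈ latDeg N (tot ν) := by
  intro μ hμ
  by_cases h : μ = ν
  · rw [h]
  · exact absurd (Pi.single_eq_of_ne h _) hμ

/-- The homogeneous elements of degree `d ∈ ℤ`. -/
def gr (N : ℕ) (h : Generic s) (d : ℤ) : Submodule ℂ (Alg N s) :=
  (latDeg N d).comap (symb N h)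

lemma homog_eq_gr (h : Generic s) (m : ℕ) : homog N s m = gr N h m := by
  apply le_antisymm
  · refine Submodule.span_le.2 ?_
    rintro _ ⟨ν, rfl, rfl⟩
    change symb N h _ ∈ latDeg N _
    rw [symb_mono, ← tot_zc]
    exact pt_mem_latDeg _
  · intro a ha
    rw [← (monoBasis N h).linearCombination_repr a, Finsupp.linearCombination_apply]
    refine Submodule.sum_mem _ fun ν hν => Submodule.smul_mem _ _ ?_
    have h1 := ha (zc ν) (by rw [symb_apply_zc]; exact Finsupp.mem_support_iff.1 hν)
    rw [tot_zc] at h1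
    rw [monoBasis_apply, ← Nat.cast_injective h1]
    exact mono_mem_homog ν

lemma gr_eq_bot (h : Generic s) {d : ℤ} (hd : d < 0) : gr N h d = ⊥ := by
  rw [eq_bot_iff]
  intro a ha
  refine (Submodule.mem_bot ℂ).2 ((monoBasis N h).repr.injective (Finsupp.ext fun ν => ?_))
  rw [map_zero, Finsupp.zero_apply, ← symb_apply_zc]
  by_contra h0
  have := ha (zc ν) h0
  rw [tot_zc] at this
  omega

/-! ### The differential operators on functions on the lattice -/

lemma Generic.sub_inv_ne (h : Generic s) : s ^ 2 - (s ^ 2)⁻¹ ≠ 0 := by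
  have h0 := pow_ne_zero 2 h.ne
  have h1 := h.one_sub_pow_four_ne
  intro h2
  have h3 : s ^ 2 * (s ^ 2)⁻¹ = 1 := mul_inv_cancel₀ h0
  exact h1 (by linear_combination -s ^ 2 * h2 - h3)

lemma sq_zpow (s : ℂ) (a : ℤ) : (s ^ 2) ^ a = s ^ (2 * a) := by
  rw [zpow_mul, zpow_ofNat]

lemma sq_pow (s : ℂ) (a : ℕ) : (s ^ 2) ^ a = s ^ (2 * (a : ℤ)) := by
  rw [← sq_zpow, zpow_natCast]

lemma mul_qSym (h : Generic s) (a : ℤ) :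
    (s ^ 2 - (s ^ 2)⁻¹) * qSym s a = s ^ (2 * a) - s ^ (-2 * a) := by
  rw [qSym, mul_div_cancel₀ _ h.sub_inv_ne, sq_zpow, sq_zpow]
  congr 2; ring

lemma qSym_zero : qSym s 0 = 0 := by simp [qSym]

lemma qNum_zero : qNum s 0 = 0 := by simp [qNum]

/-- `∂_l` for `l < l'`. -/
def opP0 (s : ℂ) (l : Fin N) : Module.End ℂ (Lat N) :=
  sh (-ez l) fun ν => qSym s (ν l) * s ^ (2 * (tot ν - pre (l + 1) ν))

/-- The operator that, composed with the inner Laplace operator, gives the part of `∂_{i'}` raising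
the exponent of `x_i`. -/
def opB (s : ℂ) (i : Fin N) : Module.End ℂ (Lat N) :=
  sh (ez i) fun ν => (s ^ 2 - (s ^ 2)⁻¹) * s ^ (twoRho i - 2 - 2 * tot ν - 2 * pre i ν)

/-- The part of `∂_{i'}` lowering the exponent of `x_{i'}`. -/
def opP1 (s : ℂ) (i : Fin N) : Module.End ℂ (Lat N) :=
  sh (-ez i.rev) fun ν => qSym s (ν i.rev) * s ^ (2 * (ν i + tot ν - pre (i.rev + 1) ν))

/-- The operator `∂_l`. -/
def opP (s : ℂ) (l : Fin N) : Module.End ℂ (Lat N) :=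
  if l < l.rev then opP0 s l
  else if l = l.rev then sh (-ez l) fun ν => qNum s (ν l) * s ^ (2 * (tot ν - pre (l + 1) ν))
  else opP1 s l.rev + opB s l.rev * innerSum (opD s) (lev l + 1)

/-- The Laplace operator of the inner coordinates `x_{k+1}, …, x_{(k+1)'}`, normalized. -/
def opTh (N : ℕ) (s : ℂ) (k : ℕ) : Module.End ℂ (Lat N) := opG s k * innerSum (opD s) k

lemma opP_rev {i : Fin N} (h : i < i.rev) :
    opP s i.rev = opP1 s i + opB s i * innerSum (opD s) (lev i + 1) := by
  rw [opP, if_neg (by rw [Fin.rev_rev]; exact h.not_gt),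
    if_neg (by rw [Fin.rev_rev]; exact h.ne'), Fin.rev_rev, lev_rev]

lemma pre_rev_succ {i : Fin N} (h : i < i.rev) (ν : Fin N → ℤ) :
    pre (i.rev + 1) ν = pre i ν + tot ν - out i ν := by
  rw [out_eq (k := i) (by simp only [Fin.lt_def, Fin.val_rev] at h; omega), Fin.val_rev]
  rw [show N - ((i : ℕ) + 1) + 1 = N - i by omega]; ring

/-- The products of `∂_i` and the raising part of `∂_{i'}` are differences of diagonal operators, as
the coefficient `q - q⁻¹` cancels the denominator of `[ν_i]_q`. -/
lemma opP0_mul_opB (h : Generic s) (i : Fin N) :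
    opP0 s i * opB s i = s ^ twoRho i • (opG s i - s ^ (-4 : ℤ) • opG s (i + 1)) := by
  simp only [opP0, opB, opG, sh_mul_sh, smul_sh, sh_sub]
  refine sh_congr (by abel) fun ν => ?_
  simp only [map_add, pre_ez, tot_ez, pre_succ, Pi.add_apply, ez_apply]
  rw [mul_mul_mul_comm, mul_comm (qSym _ _), mul_qSym h, sub_mul, mul_sub (s ^ twoRho i)]
  simp only [← zpow_add₀ h.ne]
  congr 2 <;> simp <;> ring

lemma opB_mul_opP0 (h : Generic s) (i : Fin N) :
    opB s i * opP0 s i = s ^ twoRho i • (opG s i - opG s (i + 1)) := by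
  simp only [opP0, opB, opG, sh_mul_sh, smul_sh, sh_sub]
  refine sh_congr (by abel) fun ν => ?_
  simp only [map_add, map_neg, pre_ez, tot_ez, pre_succ]
  rw [mul_mul_mul_comm, mul_qSym h, sub_mul, mul_sub (s ^ twoRho i)]
  simp only [← zpow_add₀ h.ne]
  congr 2 <;> simp <;> ring

lemma opP0_mul_opP1 (h : Generic s) {i : Fin N} (hi : i < i.rev) :
    opP0 s i * opP1 s i = s ^ twoRho i • (opG s i * opD s i) := by
  simp only [opP0, opP1, opG, opD, sh_mul_sh, smul_sh]
  refine sh_congr (by abel) fun ν => ?_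
  have h1 : ¬ ((i.rev : ℕ) < i + 1) := by simp only [Fin.lt_def] at hi; omega
  have h2 : ¬ ((i.rev : ℕ) < i) := by omega
  simp only [map_add, map_neg, pre_ez, tot_ez, dCo, pre_rev_succ hi, pre_succ,
    Pi.add_apply, Pi.neg_apply, ez_apply, lev_eq hi.le, if_neg hi.ne, if_neg h2,
    ← rr_eq_twoRho hi]
  rw [show ∀ a b c d : ℂ, (a * b) * (c * d) = (b * d) * (a * c) by intros; ring,
    show ∀ a b c d : ℂ, a * (b * (c * d)) = (a * b * c) * d by intros; ring]
  simp only [← zpow_add₀ h.ne]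
  congr 2
  · simp; ring
  · simp

lemma opP1_mul_opP0 (h : Generic s) {i : Fin N} (hi : i < i.rev) :
    opP1 s i * opP0 s i = s ^ twoRho i • (opG s i * opD s i) := by
  simp only [opP0, opP1, opG, opD, sh_mul_sh, smul_sh]
  refine sh_congr (by abel) fun ν => ?_
  have h1 : ¬ ((i.rev : ℕ) < i + 1) := by simp only [Fin.lt_def] at hi; omega
  have h2 : ¬ ((i.rev : ℕ) < i) := by omega
  simp only [map_add, map_neg, pre_ez, out_ez, tot_ez, dCo, if_neg hi.ne, pre_rev_succ hi, pre_succ,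
    Pi.add_apply, Pi.neg_apply, ez_apply, lev_eq hi.le, if_neg hi.ne', if_neg h2,
    ← rr_eq_twoRho hi]
  rw [show ∀ a b c d : ℂ, (a * b) * (c * d) = (b * d) * (c * a) by intros; ring,
    show ∀ a b c d : ℂ, a * (b * (c * d)) = (a * b * c) * d by intros; ring]
  simp only [← zpow_add₀ h.ne]
  congr 2
  · simp; ring
  · simp

lemma ne_of_lev_ne {i j : Fin N} (h : lev i ≠ lev j) : i ≠ j := fun hij => h (by rw [hij])

lemma commute_opP0_opD (h : Generic s) {i j : Fin N} (hi : i ≤ i.rev) (hj : j ≤ j.rev)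
    (hij : lev i < lev j) : Commute (opP0 s i) (opD s j) := by
  rw [Commute, SemiconjBy]
  simp only [opP0, opD, sh_mul_sh]
  refine sh_congr (by abel) fun ν => ?_
  have hli := lev_eq hi
  have hlj := lev_eq hj
  have h1 : i ≠ j := ne_of_lev_ne hij.ne
  have h2 : i ≠ j.rev := ne_of_lev_ne (by rw [lev_rev]; exact hij.ne)
  have h3 : j.rev ≠ i := h2.symm
  have h4 : ¬ ((j : ℕ) < i + 1) := by omega
  have h5 : ¬ ((j.rev : ℕ) < i + 1) := by rw [Fin.le_def] at hj; omega
  simp only [map_add, map_neg, pre_ez, out_ez, tot_ez, dCo, Pi.add_apply, Pi.neg_apply, ez_apply,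
    if_neg h1, if_neg h2, if_neg h1.symm, if_neg h3, if_neg h4, if_neg h5, if_pos hij,
    neg_zero, add_zero]
  split_ifs with hc
  · rw [show ∀ a b c d e g : ℂ, (a * b) * (c / d * (e * g)) = (b * c) * (a * e * g / d) by
        intros; ring,
      show ∀ a b c d e g : ℂ, (c / d * (e * g)) * (a * b) = (b * c) * (a * e * g / d) by
        intros; ring]
    simp only [← zpow_add₀ h.ne]
    congr 2; ring
  · rw [show ∀ a b c d e : ℂ, (a * b) * (c * (d * e)) = (b * c) * (a * d * e) by intros; ring,
      show ∀ a b c d e : ℂ, (c * (d * e)) * (a * b) = (b * c) * (a * d * e) by intros; ring]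
    simp only [← zpow_add₀ h.ne]
    congr 2; ring

lemma opP_mul_opP_rev (h : Generic s) {i : Fin N} (hi : i < i.rev) :
    opP s i * opP s i.rev = qRho s i • (opTh N s (lev i) - s ^ (-4 : ℤ) • opTh N s (lev i + 1)) := by
  rw [opP_rev hi, opP, if_pos hi, mul_add, ← mul_assoc, opP0_mul_opB h, opP0_mul_opP1 h hi, opTh,
    opTh, innerSum_eq_add _ _ hi.le, lev_eq hi.le, qRho, smul_mul_assoc, ← smul_add, sub_mul,
    mul_add, smul_mul_assoc]
  congr 1; abel

lemma opP_rev_mul_opP (h : Generic s) {i : Fin N} (hi : i < i.rev) :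
    opP s i.rev * opP s i = qRho s i • (opTh N s (lev i) - opTh N s (lev i + 1)) := by
  have hc : Commute (opP0 s i) (innerSum (opD s) (lev i + 1)) :=
    commute_innerSum _ _ _ fun j hj hij => commute_opP0_opD h hi.le hj hij
  rw [opP_rev hi, opP, if_pos hi, add_mul, mul_assoc, ← hc.eq, ← mul_assoc, opB_mul_opP0 h,
    opP1_mul_opP0 h hi, opTh,
    opTh, innerSum_eq_add _ _ hi.le, lev_eq hi.le, qRho, smul_mul_assoc, ← smul_add, sub_mul,
    mul_add]
  congr 1; abel

lemma opP_mid_sq (h : Generic s) {c : Fin N} (hc : c = c.rev) :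
    opP s c * opP s c = (1 + s ^ (-2 : ℤ)) • opTh N s (lev c) := by
  have hN := (two_lev_eq_iff c).2 hc
  have hl := lev_eq hc.le
  have hlt : ¬ c < c.rev := by rw [← hc]; exact lt_irrefl _
  rw [opTh, innerSum_eq_add _ _ hc.le, innerSum_eq_zero _ (by omega), add_zero, opP, if_neg hlt,
    if_pos hc]
  simp only [opG, opD, sh_mul_sh, smul_sh]
  refine sh_congr (by rw [← hc]; abel) fun ν => ?_
  have ho := out_eq (N := N) (k := c) (by omega) ν
  rw [show N - (c : ℕ) = c + 1 by omega] at ho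
  simp only [dCo, if_pos hc, hl, ho]
  rw [← hc]
  simp only [map_add, map_neg, pre_ez, tot_ez, pre_succ, Pi.add_apply, Pi.neg_apply, ez_apply,
    if_true, lt_irrefl, if_false, neg_zero, add_zero, zero_add]
  rw [← sub_eq_add_neg]
  have h1 : 1 + s ^ 2 ≠ 0 := by rw [add_comm]; exact h.sq_add_one_ne
  have h2 : (1 + s ^ (-2 : ℤ)) = (1 + s ^ 2) * s ^ (-2 : ℤ) := by
    rw [add_mul, one_mul, zpow_neg, zpow_ofNat, mul_inv_cancel₀ (pow_ne_zero 2 h.ne), add_comm]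
  rw [h2]
  rw [show ∀ a b c d : ℂ, (a * b) * (c * d) = (b * d) * (a * c) by intros; ring,
    show ∀ a b c d e : ℂ, a * b * (c * (d / a * e)) = (a / a * (b * c * d)) * e by intros; ring,
    div_self h1, one_mul]
  simp only [← zpow_add₀ h.ne]
  congr 2; ring

/-- The `q`-Laplace operator on functions on the lattice, in normally ordered form. -/
lemma sum_opP_mul_opP (h : Generic s) :
    ∑ i : Fin N, qRho s i • (opP s i * opP s i.rev)
      = (1 + s ^ (2 * ((N : ℤ) - 2))) • innerSum (opD s) 0 := by
  have h0 : (opTh N s 0) = innerSum (opD s) 0 := by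
    rw [opTh]
    convert one_mul _
    rw [opG, ← sh_one]
    exact sh_congr rfl fun ν => by rw [pre_zero]; simp
  rw [← h0, ← Equiv.sum_comp Fin.revPerm]
  have := sum_inner_telescope (s := s) (N := N)
    (fun i => qRho s i.rev • (opP s i.rev * opP s i)) (opTh N s)
    (fun i hi => by
      rw [opP_rev_mul_opP h hi, smul_smul, mul_comm, qRho_mul_qRho_rev h.ne, one_smul])
    (fun i hi => by
      rw [Fin.rev_rev, opP_mul_opP_rev h hi, smul_smul, smul_sub, smul_smul, qRho,
        ← zpow_add₀ h.ne, ← zpow_add₀ h.ne]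
      congr 3 <;> ring)
    (fun c hc => by rw [← hc, qRho_mid hc, one_smul, opP_mid_sq h hc])
    (fun k hk => by rw [opTh, innerSum_eq_zero _ hk.le, mul_zero]) (k := 0) (by omega)
  simpa [Fin.revPerm_apply] using this

/-! ### Operators on the algebra and on functions on the lattice -/

/-- In the formulas on monomials the truncated subtraction of exponents matters only in terms with
zero coefficient. -/
lemma symb_smul_mono (h : Generic s) (c : ℂ) (μ : Fin N → ℕ) (κ : Fin N → ℤ)
    (hc : c ≠ 0 → zc μ = κ) : symb N h (c • mono s μ) = c • pt κ := by
  rw [map_smul, symb_mono]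
  rcases eq_or_ne c 0 with rfl | h0
  · rw [zero_smul, zero_smul]
  · rw [hc h0]

lemma zc_sub {μ ν : Fin N → ℕ} (h : ν ≤ μ) : zc (μ - ν) = zc μ - zc ν := by
  ext i
  have := h i
  simp [zc, Nat.cast_sub this]

lemma sum_Ioi_eq (l : Fin N) (ν : Fin N → ℕ) :
    ((∑ i ∈ Finset.Ioi l, ν i : ℕ) : ℤ) = tot (zc ν) - pre (l + 1) (zc ν) := by
  rw [pre_zc, tot_zc, ← Finset.sum_filter_add_sum_filter_not Finset.univ
    (fun i : Fin N => i.val < l + 1) ν]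
  have : Finset.Ioi l = Finset.univ.filter fun i : Fin N => ¬ i.val < l + 1 := by
    ext i
    simp only [Finset.mem_Ioi, Finset.mem_filter, Finset.mem_univ, true_and, Fin.lt_def]; omega
  rw [this]; push_cast; ring

lemma sum_Ici_eq (l : Fin N) (ν : Fin N → ℕ) :
    ((∑ i ∈ Finset.Ici l, ν i : ℕ) : ℤ) = tot (zc ν) - pre l (zc ν) := by
  rw [pre_zc, tot_zc, ← Finset.sum_filter_add_sum_filter_not Finset.univ
    (fun i : Fin N => i.val < l) ν]
  have : Finset.Ici l = Finset.univ.filter fun i : Fin N => ¬ i.val < l := by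
    ext i
    simp only [Finset.mem_Ici, Finset.mem_filter, Finset.mem_univ, true_and, Fin.le_def]; omega
  rw [this]; push_cast; ring

lemma sum_Ico_eq {k l : Fin N} (hkl : k ≤ l) (ν : Fin N → ℕ) :
    ((∑ i ∈ Finset.Ico k l, ν i : ℕ) : ℤ) = pre l (zc ν) - pre k (zc ν) := by
  rw [Fin.le_def] at hkl
  have : (Finset.univ.filter fun i : Fin N => i.val < l)
      = (Finset.univ.filter fun i : Fin N => i.val < k) ∪ Finset.Ico k l := by
    ext i
    simp only [Finset.mem_Ico, Finset.mem_filter, Finset.mem_univ, true_and, Finset.mem_union,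
      Fin.lt_def, Fin.le_def]; omega
  rw [pre_zc, pre_zc, this, Finset.sum_union]
  · push_cast; ring
  · rw [Finset.disjoint_left]
    intro i
    simp only [Finset.mem_Ico, Finset.mem_filter, Finset.mem_univ, true_and, Fin.le_def]; omega

lemma ε_le {ν : Fin N → ℕ} {l : Fin N} (h : ν l ≠ 0) : ε l ≤ ν := by
  intro i
  rw [ε_apply]
  split_ifs with hi
  · subst hi; exact Nat.one_le_iff_ne_zero.2 h
  · exact Nat.zero_le _

lemma ε_le_add {ν : Fin N → ℕ} {l : Fin N} (h : ν l ≠ 0) (μ : Fin N → ℕ) : ε l ≤ ν + μ :=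
  (ε_le h).trans (le_add_of_nonneg_right fun _ => Nat.zero_le _)

lemma innerSum_opD_apply {i : Fin N} (hi : i < i.rev) (f : Lat N) :
    innerSum (opD s) (lev i + 1) f
      = ∑ j with i < j ∧ j < j.rev, opD s j f + ∑ c with c = c.rev, opD s c f := by
  have : (Finset.univ.filter fun j : Fin N => j ≤ j.rev ∧ lev i + 1 ≤ lev j)
      = (Finset.univ.filter fun j : Fin N => i < j ∧ j < j.rev)
        ∪ (Finset.univ.filter fun c : Fin N => c = c.rev) := by
    ext j
    simp only [Finset.mem_filter, Finset.mem_univ, true_and, Finset.mem_union]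
    rw [lev_eq hi.le]
    simp only [lev, Fin.lt_def, Fin.le_def, Fin.ext_iff, Fin.val_rev] at *
    omega
  rw [innerSum, this, Finset.sum_union, LinearMap.add_apply, LinearMap.sum_apply,
    LinearMap.sum_apply]
  rw [Finset.disjoint_left]
  intro j
  simp only [Finset.mem_filter, Finset.mem_univ, true_and]
  exact fun h1 h2 => h1.2.ne h2

lemma symb_partialOp (h : Generic s) (l : Fin N) (a : Alg N s) :
    symb N h (partialOp s l a) = opP s l (symb N h a) := by
  refine symb_opOfMono h (fun ν => ?_) a
  have hν : ∀ i : Fin N, zc ν i = (ν i : ℤ) := fun i => rfl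
  have hε : ∀ {c : ℂ}, (qSym s (ν l) * c ≠ 0 → zc (ν - ε l) = zc ν + -ez l) := by
    intro c hc
    have : ν l ≠ 0 := by rintro h0; simp [h0, qSym_zero] at hc
    rw [zc_sub (ε_le this), zc_ε, sub_eq_add_neg]
  rcases lt_trichotomy l l.rev with hl | hl | hl
  · rw [if_pos hl, symb_smul_mono h _ _ _ hε, opP, if_pos hl, opP0, sh_pt, sq_pow, sum_Ioi_eq, hν]
  · have hl' : ¬ l < l.rev := by rw [← hl]; exact lt_irrefl _
    rw [if_neg hl', if_pos hl, symb_smul_mono h _ _ (zc ν + -ez l), opP, if_neg hl', if_pos hl,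
      sh_pt, sq_pow, sum_Ioi_eq, hν]
    intro hc
    have : ν l ≠ 0 := by rintro h0; simp [h0, qNum_zero] at hc
    rw [zc_sub (ε_le this), zc_ε, sub_eq_add_neg]
  · rw [if_neg hl.not_gt, if_neg hl.ne']
    obtain ⟨i, rfl⟩ : ∃ i : Fin N, l = i.rev := ⟨l.rev, by simp⟩
    rw [Fin.rev_rev] at hl ⊢
    rw [opP_rev hl, map_add, map_add, LinearMap.add_apply, Module.End.mul_apply,
      innerSum_opD_apply hl, map_add, add_assoc, map_sum, map_sum, map_sum, map_sum]
    congr 1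
    · rw [symb_smul_mono h _ _ _ hε, opP1, sh_pt, sq_pow, Nat.cast_add, sum_Ioi_eq, hν, hν]
      congr 4; ring
    have hli := lev_eq hl.le
    congr 1
    · refine Finset.sum_congr rfl fun j hj => ?_
      simp only [Finset.mem_filter, Finset.mem_univ, true_and] at hj
      obtain ⟨hij, hjr⟩ := hj
      have hlj := lev_eq hjr.le
      rw [symb_smul_mono h _ _ (zc ν + -(ez j + ez j.rev) + ez i), opD, sh_pt, map_smul, opB, sh_pt,
        smul_smul]
      · congr 1
        rw [sq_pow, Nat.cast_add, sum_Ico_eq hij.le, sum_Ioi_eq]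
        have e1 : ((j.rev : ℕ) + 1) = N - j := by simp only [Fin.val_rev]; omega
        have hi1 : ¬ (j : ℕ) < i := by rw [Fin.lt_def] at hij; omega
        have hi2 : ¬ (j.rev : ℕ) < i := by rw [Fin.lt_def] at hij hjr; omega
        have ho := out_eq (N := N) (k := j) (by rw [Fin.lt_def] at hjr; omega) (zc ν)
        rw [dCo, if_neg hjr.ne, e1, qRho, qRho, rr_eq_twoRho hjr, hlj, ho, hν, hν]
        simp only [map_add, map_neg, tot_ez, pre_ez, if_neg hi1, if_neg hi2]
        rw [← zpow_sub₀ h.ne]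
        rw [show ∀ a b c d e : ℂ, a * b * c * d * e = a * b * c * (d * e) by intros; ring,
          show ∀ a b c d e : ℂ, d * (a * b) * (c * e) = a * b * c * (d * e) by intros; ring]
        simp only [← zpow_add₀ h.ne]
        congr 2; ring
      · intro hc
        have h1 : ν j ≠ 0 := by rintro h0; simp [h0, qSym_zero] at hc
        have h2 : ν j.rev ≠ 0 := by rintro h0; simp [h0, qSym_zero] at hc
        have h3 : ε j ≤ ν + ε i := ε_le_add h1 _
        have h4 : ε j.rev ≤ ν + ε i - ε j := by
          refine ε_le ?_
          simp only [Pi.sub_apply, Pi.add_apply, ε_apply, if_neg hjr.ne']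
          omega
        rw [zc_sub h4, zc_sub h3, zc_add, zc_ε, zc_ε, zc_ε]; abel
    · refine Finset.sum_congr rfl fun c hc => ?_
      simp only [Finset.mem_filter, Finset.mem_univ, true_and] at hc
      have hlc := lev_eq hc.le
      have hN := (two_lev_eq_iff c).2 hc
      have hic : ¬ (c : ℕ) < i := by
        simp only [Fin.lt_def, Fin.val_rev] at hl; omega
      rw [symb_smul_mono h _ _ (zc ν + -(ez c + ez c.rev) + ez i), opD, sh_pt, map_smul, opB, sh_pt,
        smul_smul]
      · congr 1
        rw [sq_zpow, sum_Ici_eq, ← pow_mul, ← zpow_natCast s (2 * 2), qRho]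
        have ho := out_succ_mid c hc (zc ν)
        rw [out_top (by omega)] at ho
        rw [dCo, if_pos hc, ← hc, ← hν c]
        simp only [map_add, map_neg, tot_ez, pre_ez, if_neg hic, ho]
        rw [show ∀ a b c d e x y : ℂ, a * b * (c / d) * (x * y) * e
            = a * b * c / d * (x * y * e) by intros; ring,
          show ∀ a b c d e y : ℂ, e / d * (a * b) * (c * y) = a * b * c / d * (e * y) by
            intros; ring]
        simp only [← zpow_add₀ h.ne]
        congr 2; push_cast; ring
      · intro hc0
        have h1 : ν c ≠ 0 := by rintro h0; simp [h0, qNum_zero] at hc0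
        have h2 : ν c ≠ 1 := by rintro h0; simp [h0, qNum_zero] at hc0
        have h4 : 2 • ε c ≤ ν + ε i := by
          intro k
          simp only [Pi.smul_apply, Pi.add_apply, ε_apply, smul_eq_mul]
          split_ifs with hk <;> first | omega | (subst hk; omega)
        rw [zc_sub h4, two_smul, zc_add, zc_add, zc_ε, zc_ε, ← hc]; abel

/-- On functions on the lattice, `Q` acts by its normally ordered form. -/
lemma symb_Qhat (h : Generic s) (a : Alg N s) :
    symb N h (Qhat N s a)
      = (1 + s ^ (2 * ((N : ℤ) - 2))) • innerSum (opU s) 0 (symb N h a) := by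
  have h0 : (opOm N s 0) = innerSum (opU s) 0 := by
    rw [opOm]
    convert one_mul _
    rw [opG, ← sh_one]
    exact sh_congr rfl fun ν => by rw [pre_zero]; simp
  have h1 := sum_opX_mul_opX (N := N) h.ne h.sq_add_one_ne (k := 0) (by omega)
  rw [h0] at h1
  have h2 : rep N h (radiusSq N s) = (1 + s ^ (2 * ((N : ℤ) - 2))) • innerSum (opU s) 0 := by
    simp only [radiusSq, map_sum, map_smul, map_mul, rep_x]
    simpa using h1
  rw [Qhat, LinearMap.mulLeft_apply, symb_mul, h2, LinearMap.smul_apply]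

lemma symb_laplace (h : Generic s) (a : Alg N s) :
    symb N h (laplace N s a)
      = (1 + s ^ (2 * ((N : ℤ) - 2))) • innerSum (opD s) 0 (symb N h a) := by
  rw [← LinearMap.smul_apply, ← sum_opP_mul_opP h, laplace, LinearMap.sum_apply, map_sum,
    LinearMap.sum_apply]
  refine Finset.sum_congr rfl fun i _ => ?_
  simp only [LinearMap.smul_apply, Module.End.mul_apply, map_smul, symb_partialOp]

/-- The operator of `E_α` for `α = (a, b)`, as the sum of its two shifts. -/
def latE (s : ℂ) (a b : Fin N) : Module.End ℂ (Lat N) :=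
  if b = b.rev then
    sh (ez a - ez b) (fun ν => qNum s (ν b) * (s ^ (2 * (ν a - ν b)) * s ^ 3))
    - sh (ez b - ez a.rev) (fun ν => qSym s (ν a.rev) * s ^ (2 * (ν a - ν a.rev + 1)))
  else
    sh (ez a - ez b) (fun ν => qSym s (ν b) * s ^ (2 * (ν a - ν b + 1)))
    - sh (ez b.rev - ez a.rev)
      (fun ν => qSym s (ν a.rev) * s ^ (2 * (ν a - ν b - ν a.rev + ν b.rev + 1)))

/-- The operator of `F_α` for `α = (a, b)`, as the sum of its two shifts. -/
def latF (s : ℂ) (a b : Fin N) : Module.End ℂ (Lat N) :=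
  if b = b.rev then
    sh (ez b - ez a) (fun ν => qSym s (ν a) * (s ^ (2 * (-ν a + ν a.rev)) * s))
    - sh (ez a.rev - ez b) (fun ν => qNum s (ν b) * s ^ (2 * (-ν b + ν a.rev + 1)))
  else
    sh (ez b - ez a) (fun ν => qSym s (ν a) * s ^ (2 * (-ν a + ν b - ν b.rev + ν a.rev + 1)))
    - sh (ez a.rev - ez b.rev) (fun ν => qSym s (ν b.rev) * s ^ (2 * (-ν b.rev + ν a.rev + 1)))

lemma zc_add_sub_ε {ν : Fin N → ℕ} {k : Fin N} (l : Fin N) (h : ν k ≠ 0) :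
    zc (ν + ε l - ε k) = zc ν + (ez l - ez k) := by
  rw [zc_sub (ε_le_add h _), zc_add, zc_ε, zc_ε]; abel

lemma zc_sub_add_ε {ν : Fin N → ℕ} {k : Fin N} (l : Fin N) (h : ν k ≠ 0) :
    zc (ν - ε k + ε l) = zc ν + (ez l - ez k) := by
  rw [zc_add, zc_sub (ε_le h), zc_ε, zc_ε]; abel

lemma ne_zero_of_qSym {n : ℕ} {c : ℂ} (h : qSym s n * c ≠ 0) : n ≠ 0 := by
  rintro rfl; simp [qSym_zero] at h

lemma ne_zero_of_qNum {n : ℕ} {c : ℂ} (h : qNum s n * c ≠ 0) : n ≠ 0 := by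
  rintro rfl; simp [qNum_zero] at h

lemma symb_opE (h : Generic s) (a b : Fin N) (p : Alg N s) :
    symb N h (opE s a b p) = latE s a b (symb N h p) := by
  refine symb_opOfMono h (fun ν => ?_) p
  unfold latE
  split_ifs
  · rw [map_sub, LinearMap.sub_apply, sh_pt, sh_pt,
      symb_smul_mono h _ _ _ fun hc => zc_add_sub_ε _ (ne_zero_of_qNum hc),
      symb_smul_mono h _ _ _ fun hc => zc_add_sub_ε _ (ne_zero_of_qSym hc), sq_zpow, sq_zpow]
    rfl
  · rw [map_sub, LinearMap.sub_apply, sh_pt, sh_pt,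
      symb_smul_mono h _ _ _ fun hc => zc_add_sub_ε _ (ne_zero_of_qSym hc),
      symb_smul_mono h _ _ _ fun hc => zc_add_sub_ε _ (ne_zero_of_qSym hc), sq_zpow, sq_zpow]
    rfl

lemma symb_opF (h : Generic s) (a b : Fin N) (p : Alg N s) :
    symb N h (opF s a b p) = latF s a b (symb N h p) := by
  refine symb_opOfMono h (fun ν => ?_) p
  unfold latF
  split_ifs
  · rw [map_sub, LinearMap.sub_apply, sh_pt, sh_pt,
      symb_smul_mono h _ _ _ fun hc => zc_sub_add_ε _ (ne_zero_of_qSym hc),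
      symb_smul_mono h _ _ _ fun hc => zc_sub_add_ε _ (ne_zero_of_qNum hc), sq_zpow, sq_zpow]
    rfl
  · rw [map_sub, LinearMap.sub_apply, sh_pt, sh_pt,
      symb_smul_mono h _ _ _ fun hc => zc_sub_add_ε _ (ne_zero_of_qSym hc),
      symb_smul_mono h _ _ _ fun hc => zc_sub_add_ε _ (ne_zero_of_qSym hc), sq_zpow, sq_zpow]
    rfl

/-- The diagonal operator `e_ν ↦ q^{z ((ν_a - ν_{a'}) - (ν_b - ν_{b'}))} e_ν`. -/
def latK (s : ℂ) (z : ℤ) (a b : Fin N) : Module.End ℂ (Lat N) :=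
  sh 0 fun ν => s ^ (2 * (z * ((ν a - ν a.rev) - (ν b - ν b.rev))))

/-- The diagonal operator `e_ν ↦ q^{z (ν_i - ν_{i'})} e_ν`. -/
def latKhat (s : ℂ) (z : ℤ) (i : Fin N) : Module.End ℂ (Lat N) :=
  sh 0 fun ν => s ^ (2 * (z * (ν i - ν i.rev)))

lemma symb_opK (h : Generic s) (z : ℤ) (a b : Fin N) (p : Alg N s) :
    symb N h (opK s z a b p) = latK s z a b (symb N h p) := by
  refine symb_opOfMono h (fun ν => ?_) p
  rw [map_smul, symb_mono, latK, sh_pt, add_zero, sq_zpow]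
  rfl

lemma symb_opKhat (h : Generic s) (z : ℤ) (i : Fin N) (p : Alg N s) :
    symb N h (opKhat s z i p) = latKhat s z i (symb N h p) := by
  refine symb_opOfMono h (fun ν => ?_) p
  rw [map_smul, symb_mono, latKhat, sh_pt, add_zero, sq_zpow]
  rfl

set_option linter.unusedSimpArgs false




/-! ### The commutation relation of the squared radius and the Laplace operator -/

lemma innerSum_telescope {M : Type*} [AddCommGroup M] (A : Fin N → M) (Z : ℕ → M)
    (h : ∀ i : Fin N, i ≤ i.rev → A i = Z (lev i + 1) - Z (lev i)) {k : ℕ} (hk : 2 * k ≤ N + 1) :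
    innerSum A k = Z ((N + 1) / 2) - Z k := by
  have hk' : k ≤ (N + 1) / 2 := by omega
  induction hk' using Nat.decreasingInduction with
  | self => rw [innerSum_eq_zero _ (by omega), sub_self]
  | of_succ k hk' ih =>
    have hi : (⟨k, by omega⟩ : Fin N) ≤ (⟨k, by omega⟩ : Fin N).rev := by
      rw [Fin.le_def, Fin.val_rev]; simp only; omega
    have h1 := innerSum_eq_add A _ hi
    have h2 := h _ hi
    have h3 : lev (⟨k, by omega⟩ : Fin N) = k := lev_eq hi
    rw [h3] at h1 h2
    rw [h1, h2, ih (by omega)]; abel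

/-- The contributions of distinct pairs satisfy the same `q`-commutation relation whatever the pairs
are; hence they drop out of the `q`-commutator of the sums. -/
lemma opD_mul_opU_of_ne (h : Generic s) {j k : Fin N} (hjk : lev j ≠ lev k) :
    opD s k * opU s j = s ^ (4 : ℤ) • (opU s j * opD s k) := by
  simp only [opD, opU, sh_mul_sh, smul_sh]
  refine sh_congr (by abel) fun ν => ?_
  have h1 : k ≠ j := ne_of_lev_ne hjk.symm
  have h2 : k ≠ j.rev := ne_of_lev_ne (by rw [lev_rev]; exact hjk.symm)
  have h3 : k.rev ≠ j := ne_of_lev_ne (by rw [lev_rev]; exact hjk.symm)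
  have h4 : k.rev ≠ j.rev := ne_of_lev_ne (by rw [lev_rev, lev_rev]; exact hjk.symm)
  have h5 : (lev k < lev j + 1) ↔ ¬ lev j < lev k := by omega
  simp only [uCo, dCo, map_add, map_neg, tot_ez, out_ez, lev_rev, Pi.add_apply, ez_apply, if_neg h1,
    if_neg h2, if_neg h3, if_neg h4, add_zero, h5]
  generalize (if j = j.rev then s / (s ^ 2 + 1) else 1) = w
  by_cases hk : k = k.rev
  · simp only [if_pos hk]
    rw [show ∀ a b c d x y : ℂ, a / b * (x * y) * (c * d) = (a * d) * (c * (x * y) / b) by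
        intros; ring,
      show ∀ a b c d x y z : ℂ, z * (c * d * (a / b * (x * y))) = (z * d * a) * (c * (x * y) / b) by
        intros; ring]
    simp only [← zpow_add₀ h.ne]
    have h6 : lev j < lev k := by
      have := (two_lev_eq_iff k).2 hk
      have := two_lev j
      omega
    congr 2
    simp [h6]; ring
  · simp only [if_neg hk]
    rw [show ∀ a c d x y : ℂ, a * (x * y) * (c * d) = (a * d) * (c * (x * y)) by
        intros; ring,
      show ∀ a c d x y z : ℂ, z * (c * d * (a * (x * y))) = (z * d * a) * (c * (x * y)) by
        intros; ring]
    simp only [← zpow_add₀ h.ne]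
    congr 2
    by_cases h6 : lev j < lev k <;> simp [h6] <;> ring

/-- The diagonal operators whose differences are the `q`-commutators of the contributions of the single
pairs to the Laplace operator and to the squared radius. -/
def opZ (N : ℕ) (s : ℂ) (k : ℕ) : Module.End ℂ (Lat N) :=
  sh 0 fun ν => s ^ (-2 * ((N : ℤ) - 2 - min (2 * k) N) + 4 * out k ν) / (s ^ 2 - (s ^ 2)⁻¹)

lemma Generic.sub_inv_eq (h : Generic s) :
    s ^ 2 - (s ^ 2)⁻¹ = (s ^ 2 - 1) * (s ^ 2 + 1) / s ^ 2 := by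
  have := h.ne
  field_simp
  ring

lemma Generic.qSym_eq (h : Generic s) (a : ℤ) :
    qSym s a = (s ^ (2 * a) - (s ^ (2 * a))⁻¹) * s ^ 2 / ((s ^ 2 - 1) * (s ^ 2 + 1)) := by
  rw [qSym, sq_zpow, sq_zpow, mul_neg, zpow_neg, h.sub_inv_eq, div_div_eq_mul_div]

lemma qNum_eq (a : ℤ) : qNum s a = (s ^ (2 * a) - 1) / (s ^ 2 - 1) := by
  rw [qNum, sq_zpow, ← neg_sub, ← neg_sub (s ^ 2), neg_div_neg_eq]

lemma Generic.sq_sub_one_ne (h : Generic s) : s ^ 2 - 1 ≠ 0 := by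
  rw [← neg_sub]; exact neg_ne_zero.2 h.one_sub_sq_ne

lemma opD_mul_opU_self (h : Generic s) {j : Fin N} (hj : j ≤ j.rev) :
    opD s j * opU s j - s ^ (4 : ℤ) • (opU s j * opD s j)
      = opZ N s (lev j + 1) - opZ N s (lev j) := by
  have hs := h.ne
  have hK1 := h.sq_sub_one_ne
  have hK2 := h.sq_add_one_ne
  have hl := two_lev j
  have e : -(ez j + ez j.rev) + (ez j + ez j.rev) = (0 : Fin N → ℤ) := by abel
  have e' : (ez j + ez j.rev) + -(ez j + ez j.rev) = (0 : Fin N → ℤ) := by abel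
  simp only [opD, opU, opZ, sh_mul_sh, smul_sh, e, e', sh_sub]
  refine sh_congr rfl fun ν => ?_
  rcases hj.lt_or_eq with hlt | heq
  · have hne := hlt.ne
    have h1 := out_succ j hne ν
    have hm1 : min (2 * (lev j + 1)) N = 2 * lev j + 2 := by
      rw [lev_eq hj]; simp only [Fin.lt_def, Fin.val_rev] at hlt; omega
    have hm2 : min (2 * lev j) N = 2 * lev j := by omega
    rw [hm1, hm2]
    simp only [uCo, dCo, if_neg hne, map_add, map_neg, tot_ez, out_ez, lev_rev, Pi.add_apply,
      ez_apply, if_neg hne.symm, if_true, lt_irrefl, if_false, Nat.lt_succ_self, add_zero,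
      zero_add, one_mul, h1, rr, h.qSym_eq, h.sub_inv_eq]
    push_cast
    rw [show -2 * ((N : ℤ) - 2 - (2 * lev j + 2)) = -2 * ((N : ℤ) - 2 - 2 * lev j) + 4 by ring]
    generalize (N : ℤ) - 2 - 2 * lev j = r
    simp only [mul_add, mul_one, neg_mul, mul_neg, neg_neg, sub_neg_eq_add, zpow_add₀ hs,
      zpow_sub₀ hs, zpow_neg, zpow_mul', zpow_ofNat, Int.reduceMul]
    have hA := zpow_ne_zero (ν j) hs
    have hB := zpow_ne_zero (ν j.rev) hs
    have hR := zpow_ne_zero r hs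
    have hO := zpow_ne_zero (out (lev j) ν) hs
    have hT := zpow_ne_zero (tot ν) hs
    generalize s ^ ν j = A at *
    generalize s ^ ν j.rev = B at *
    generalize s ^ r = R at *
    generalize s ^ out (lev j) ν = O at *
    generalize s ^ tot ν = T at *
    field_simp
    ring
  · have hN := (two_lev_eq_iff j).2 heq
    have h1 := out_succ_mid j heq ν
    have hm1 : min (2 * (lev j + 1)) N = N := by omega
    have hm2 : min (2 * lev j) N = 2 * lev j := by omega
    have ht : tot ν = out (lev j) ν + ν j := by rw [← h1, out_top (by omega)]
    have hr : (N : ℤ) - 2 - 2 * lev j = -1 := by omega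
    have hr' : -2 * ((N : ℤ) - 2 - N) = 4 := by ring
    rw [hm1, hm2]
    simp only [uCo, dCo, if_pos heq, map_add, map_neg, tot_ez, out_ez, lev_rev, Pi.add_apply,
      Pi.neg_apply, ez_apply, lt_irrefl, if_false, Nat.lt_succ_self, add_zero,
      zero_add, one_mul, h1, ht, rr, qNum_eq, h.sub_inv_eq, if_true]
    push_cast
    rw [hr, hr', add_comm (1 : ℂ) (s ^ 2)]
    simp only [mul_add, mul_sub, mul_one, neg_mul, mul_neg, neg_neg, sub_neg_eq_add, zpow_add₀ hs,
      zpow_sub₀ hs, zpow_neg, zpow_mul', zpow_ofNat, zpow_one, Int.reduceMul]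
    have hA := zpow_ne_zero (ν j) hs
    have hO := zpow_ne_zero (out (lev j) ν) hs
    generalize s ^ ν j = A at *
    generalize s ^ out (lev j) ν = O at *
    field_simp
    ring

/-- The `q`-commutator of the Laplace operator and of the squared radius telescopes to the two
extreme diagonal operators, which depend only on the degree. -/
lemma innerSum_opD_mul_innerSum_opU (h : Generic s) :
    innerSum (opD s) 0 * innerSum (opU s) 0 - s ^ (4 : ℤ) • (innerSum (opU s) 0 * innerSum (opD s) 0)
      = opZ N s ((N + 1) / 2) - opZ N s 0 := by
  rw [← innerSum_telescope (fun j : Fin N => opD s j * opU s j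
    - s ^ (4 : ℤ) • (opU s j * opD s j)) (opZ N s) (fun j hj => opD_mul_opU_self h hj) (k := 0)
    (by omega)]
  simp only [innerSum, Finset.sum_mul_sum]
  rw [Finset.sum_comm, Finset.smul_sum, ← Finset.sum_sub_distrib]
  refine Finset.sum_congr rfl fun j hj => ?_
  rw [Finset.smul_sum, ← Finset.sum_sub_distrib]
  refine Finset.sum_eq_single_of_mem j hj fun k hk hkj => ?_
  simp only [Finset.mem_filter, Finset.mem_univ, true_and] at hj hk
  rw [opD_mul_opU_of_ne h, sub_self]
  rw [lev_eq hj.1, lev_eq hk.1]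
  exact fun h0 => hkj (Fin.ext h0.symm)

lemma opZ_apply {k : ℕ} {d : ℤ} {c : ℂ} {f : Lat N} (hf : f ∈ latDeg N d)
    (hc : ∀ ν : Fin N → ℤ, tot ν = d →
      s ^ (-2 * ((N : ℤ) - 2 - (min (2 * k) N : ℕ)) + 4 * out k ν) / (s ^ 2 - (s ^ 2)⁻¹) = c) :
    opZ N s k f = c • f := by
  ext ν
  rw [opZ, sh_apply, sub_zero, Pi.smul_apply, smul_eq_mul]
  by_cases h0 : f ν = 0
  · rw [h0, mul_zero, mul_zero]
  · rw [hc ν (hf ν h0)]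

/-- The commutation relation between the Laplace operator and the squared radius on homogeneous
functions. -/
lemma innerSum_opD_innerSum_opU_apply (h : Generic s) {d : ℤ} {f : Lat N} (hf : f ∈ latDeg N d) :
    innerSum (opD s) 0 (innerSum (opU s) 0 f)
      = s ^ (4 : ℤ) • innerSum (opU s) 0 (innerSum (opD s) 0 f)
        + ((s ^ (4 + 4 * d) - s ^ (-2 * ((N : ℤ) - 2))) / (s ^ 2 - (s ^ 2)⁻¹)) • f := by
  have h1 := LinearMap.congr_fun (innerSum_opD_mul_innerSum_opU (N := N) h) f
  rw [LinearMap.sub_apply, LinearMap.sub_apply, LinearMap.smul_apply, Module.End.mul_apply,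
    Module.End.mul_apply] at h1
  rw [opZ_apply hf (c := s ^ (4 + 4 * d) / (s ^ 2 - (s ^ 2)⁻¹)), opZ_apply hf
    (c := s ^ (-2 * ((N : ℤ) - 2)) / (s ^ 2 - (s ^ 2)⁻¹)), ← sub_smul, ← sub_div] at h1
  · rw [← h1]; abel
  · intro ν _
    rw [out_zero]; simp
  · intro ν hν
    rw [out_top (by omega), hν, min_eq_right (by omega)]
    congr 2; ring

/-! ### Invariance of the squared radius and of the Laplace operator under the quantum algebra -/

lemma sh_commutator (δ δ' : Fin N → ℤ) (c c' : (Fin N → ℤ) → ℂ) :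
    sh δ c * sh δ' c' - sh δ' c' * sh δ c
      = sh (δ + δ') (fun ν => c (ν + δ') * c' ν - c' (ν + δ) * c ν) := by
  rw [sh_mul_sh, sh_mul_sh, add_comm δ' δ, sh_sub]

lemma commute_sh {δ δ' : Fin N → ℤ} {c c' : (Fin N → ℤ) → ℂ}
    (hc : ∀ ν, c (ν + δ') * c' ν = c' (ν + δ) * c ν) : Commute (sh δ c) (sh δ' c') := by
  rw [Commute, SemiconjBy, ← sub_eq_zero, sh_commutator]
  ext f ν
  simp [sh_apply, hc]

lemma opU_rev (j : Fin N) : opU s j.rev = opU s j := by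
  refine sh_congr (by rw [Fin.rev_rev, add_comm]) fun ν => ?_
  simp only [uCo, Fin.rev_rev, rr, lev_rev, eq_comm]

lemma opD_rev (j : Fin N) : opD s j.rev = opD s j := by
  refine sh_congr (by rw [Fin.rev_rev, add_comm]) fun ν => ?_
  simp only [dCo, Fin.rev_rev, rr, lev_rev]
  by_cases hj : j = j.rev
  · rw [if_pos hj.symm, if_pos hj, ← hj]
  · rw [if_neg (fun h => hj h.symm), if_neg hj, mul_comm (qSym s (ν j.rev))]

/-- Only two pairs of coordinates take part in a simple root, so that commutation with the sum over
all pairs reduces to commutation with the sum of their two contributions. -/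
lemma commute_innerSum_of_pair {R : Type*} [Ring R] {A : Fin N → R} (hA : ∀ j, A j.rev = A j)
    {T : R} {a b : Fin N} (hab : lev a ≠ lev b) (h1 : Commute T (A a + A b))
    (h2 : ∀ j, lev j ≠ lev a → lev j ≠ lev b → Commute T (A j)) :
    Commute T (innerSum A 0) := by
  have key : ∀ i : Fin N, ∃ i' : Fin N, i' ≤ i'.rev ∧ lev i' = lev i ∧ A i' = A i := by
    intro i
    rcases le_total i i.rev with h | h
    · exact ⟨i, h, rfl, rfl⟩
    · exact ⟨i.rev, by rwa [Fin.rev_rev], lev_rev i, hA i⟩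
  obtain ⟨a', ha, hla, hAa⟩ := key a
  obtain ⟨b', hb, hlb, hAb⟩ := key b
  rw [← hla, ← hlb] at hab h2
  rw [← hAa, ← hAb] at h1
  have hne : a' ≠ b' := ne_of_lev_ne hab
  have hset : (Finset.univ.filter fun j : Fin N => j ≤ j.rev ∧ 0 ≤ lev j)
      = insert a' (insert b' (Finset.univ.filter fun j : Fin N =>
        j ≤ j.rev ∧ lev j ≠ lev a' ∧ lev j ≠ lev b')) := by
    ext j
    simp only [Finset.mem_filter, Finset.mem_univ, true_and, Finset.mem_insert]
    constructor
    · rintro ⟨hj, -⟩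
      by_cases h3 : lev j = lev a'
      · left; rw [lev_eq hj, lev_eq ha] at h3; exact Fin.ext h3
      · by_cases h4 : lev j = lev b'
        · right; left; rw [lev_eq hj, lev_eq hb] at h4; exact Fin.ext h4
        · exact Or.inr (Or.inr ⟨hj, h3, h4⟩)
    · rintro (rfl | rfl | h)
      · exact ⟨ha, Nat.zero_le _⟩
      · exact ⟨hb, Nat.zero_le _⟩
      · exact ⟨h.1, Nat.zero_le _⟩
  rw [innerSum, hset, Finset.sum_insert (by simp [hne]), Finset.sum_insert (by simp), ← add_assoc]
  refine h1.add_right (Commute.sum_right _ _ _ fun j hj => ?_)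
  simp only [Finset.mem_filter, Finset.mem_univ, true_and] at hj
  exact h2 j hj.2.1 hj.2.2

/-- If the generator is `e - f`, its commutator with the contributions `A` and `B` of the two pairs
vanishes as soon as the commutator of `e` with one pair is that of `f` with the other. -/
lemma commute_sub_add {R : Type*} [Ring R] {A B e f : R} (h1 : A * e - e * A = B * f - f * B)
    (h2 : Commute B e) (h3 : Commute A f) : Commute (e - f) (A + B) := by
  have h2 := h2.eq
  have h3 := h3.eq
  rw [Commute, SemiconjBy, sub_mul, mul_add, mul_add, add_mul, mul_sub, mul_sub, ← h2, h3]
  have : A * e = B * f - f * B + e * A := by rw [← h1]; abel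
  rw [this]; abel

/-- Two pairs of indices as they occur in a simple root: `{b, b'}` is next to `{a, a'}`. -/
structure Adj (a b : Fin N) : Prop where
  ne_rev : a ≠ a.rev
  lev_succ : lev b = lev a + 1

lemma Adj.ne {a b : Fin N} (h : Adj a b) : a ≠ b :=
  ne_of_lev_ne (by rw [h.lev_succ]; omega)
lemma Adj.ne' {a b : Fin N} (h : Adj a b) : a ≠ b.rev :=
  ne_of_lev_ne (by rw [lev_rev, h.lev_succ]; omega)
lemma Adj.rev_ne {a b : Fin N} (h : Adj a b) : a.rev ≠ b :=
  ne_of_lev_ne (by rw [lev_rev, h.lev_succ]; omega)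
lemma Adj.rev_ne' {a b : Fin N} (h : Adj a b) : a.rev ≠ b.rev :=
  ne_of_lev_ne (by rw [lev_rev, lev_rev, h.lev_succ]; omega)

/-- The action of a simple root `(a, b)` with `b ≠ b'` commutes with the joint contribution of the
pairs `{a, a'}` and `{b, b'}`. -/
lemma commute_pair (h : Generic s) {a b : Fin N} (hab : Adj a b) (hb : b ≠ b.rev) :
    Commute (latE s a b) (opU s b + opU s a) ∧ Commute (latE s a b) (opD s a + opD s b) ∧
    Commute (latF s a b) (opU s a + opU s b) ∧ Commute (latF s a b) (opD s b + opD s a) := by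
  have hs := h.ne
  have hK1 := h.sq_sub_one_ne
  have hK2 := h.sq_add_one_ne
  have e1 := hab.ne_rev
  have e2 := hab.ne
  have e3 := hab.ne'
  have e4 := hab.rev_ne
  have e5 := hab.rev_ne'
  have hl := hab.lev_succ
  have n1 : ¬ lev a + 1 < lev a := by omega
  have n2 : lev a < lev a + 1 + 1 := by omega
  have oa := out_succ a e1
  have ob := out_succ b hb
  rw [hl] at ob
  have hr : rr a = rr b + 2 := by rw [rr, rr, hl]; push_cast; ring
  rw [latE, if_neg hb, latF, if_neg hb]
  simp only [opU, opD]
  refine ⟨commute_sub_add ?_ (commute_sh fun ν => ?_) (commute_sh fun ν => ?_),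
    commute_sub_add ?_ (commute_sh fun ν => ?_) (commute_sh fun ν => ?_),
    commute_sub_add ?_ (commute_sh fun ν => ?_) (commute_sh fun ν => ?_),
    commute_sub_add ?_ (commute_sh fun ν => ?_) (commute_sh fun ν => ?_)⟩
  -- on each point of the lattice the claims are identities of rational functions in the powers of
  -- `s` at the exponents involved
  any_goals (rw [sh_commutator, sh_commutator]; refine sh_congr (by abel) fun ν => ?_)
  all_goals
    have hA := zpow_ne_zero (ν a) hs
    have hA' := zpow_ne_zero (ν a.rev) hs
    have hB := zpow_ne_zero (ν b) hs
    have hB' := zpow_ne_zero (ν b.rev) hs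
    have hR := zpow_ne_zero (rr b) hs
    have hO := zpow_ne_zero (out (lev a) ν) hs
    have hT := zpow_ne_zero (tot ν) hs
    simp only [uCo, dCo, if_neg hb, if_neg e1, map_add, map_sub, map_neg, tot_ez, out_ez, lev_rev,
      hl, oa, ob, hr, Pi.add_apply, Pi.sub_apply, Pi.neg_apply, ez_apply, if_neg hb.symm,
      if_neg e1.symm,
      if_neg e2, if_neg e2.symm, if_neg e3, if_neg e3.symm, if_neg e4, if_neg e4.symm, if_neg e5,
      if_neg e5.symm, if_true, lt_irrefl, if_false, Nat.lt_succ_self, n1, n2, add_zero, zero_add,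
      one_mul, sub_self, neg_zero,
      h.qSym_eq, mul_add, mul_sub, mul_one, mul_zero, sub_zero, zero_sub, neg_mul, mul_neg, neg_neg,
      sub_neg_eq_add, zpow_add₀ hs, zpow_sub₀ hs, zpow_neg, zpow_mul', zpow_ofNat, Int.reduceMul]
    generalize s ^ ν a = A at *
    generalize s ^ ν a.rev = A' at *
    generalize s ^ ν b = B at *
    generalize s ^ ν b.rev = B' at *
    generalize s ^ rr b = R at *
    generalize s ^ out (lev a) ν = O at *
    generalize s ^ tot ν = T at *
    clear e1 e2 e3 e4 e5 n1 n2 oa ob hl hr hb hab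
    field_simp
    try ring

/-- The action of a simple root `(a, b)` with `b = b'` commutes with the joint contribution of the
pair `{a, a'}` and of the middle coordinate. -/
lemma commute_pair_mid (h : Generic s) {a b : Fin N} (hab : Adj a b) (hb : b = b.rev) :
    Commute (latE s a b) (opU s b + opU s a) ∧ Commute (latE s a b) (opD s a + opD s b) ∧
    Commute (latF s a b) (opU s a + opU s b) ∧ Commute (latF s a b) (opD s b + opD s a) := by
  have hs := h.ne
  have hK1 := h.sq_sub_one_ne
  have hK2 := h.sq_add_one_ne
  have hN := (two_lev_eq_iff b).2 hb
  have e1 := hab.ne_rev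
  have e2 := hab.ne
  have e4 := hab.rev_ne
  have hl := hab.lev_succ
  have n1 : ¬ lev a + 1 < lev a := by omega
  have n2 : lev a < lev a + 1 + 1 := by omega
  have oa := out_succ a e1
  have ob := out_succ_mid b hb
  rw [hl] at ob hN
  have ht : ∀ ν : Fin N → ℤ, tot ν = out (lev a) ν + ν a + ν a.rev + ν b := fun ν => by
    rw [← out_top (k := lev a + 1 + 1) (by omega), ob, oa]
  have hr : rr b = -1 := by rw [rr, hl]; omega
  have hr' : rr a = 1 := by rw [rr]; omega
  have hb' : b.rev = b := hb.symm
  have hc : (1 : ℂ) + s ^ 2 = s ^ 2 + 1 := add_comm _ _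
  rw [latE, if_pos hb, latF, if_pos hb]
  simp only [opU, opD]
  refine ⟨commute_sub_add ?_ (commute_sh fun ν => ?_) (commute_sh fun ν => ?_),
    commute_sub_add ?_ (commute_sh fun ν => ?_) (commute_sh fun ν => ?_),
    commute_sub_add ?_ (commute_sh fun ν => ?_) (commute_sh fun ν => ?_),
    commute_sub_add ?_ (commute_sh fun ν => ?_) (commute_sh fun ν => ?_)⟩
  -- on each point of the lattice the claims are identities of rational functions in the powers of
  -- `s` at the exponents involved
  any_goals (rw [sh_commutator, sh_commutator]; refine sh_congr (by rw [hb']; abel) fun ν => ?_)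
  all_goals
    have hA := zpow_ne_zero (ν a) hs
    have hA' := zpow_ne_zero (ν a.rev) hs
    have hB := zpow_ne_zero (ν b) hs
    have hO := zpow_ne_zero (out (lev a) ν) hs
    simp only [uCo, dCo, if_pos hb, if_neg e1, map_add, map_sub, map_neg, tot_ez, out_ez, lev_rev,
      hb', hl, oa, ob, hr, hr', ht, hc, Pi.add_apply, Pi.sub_apply, Pi.neg_apply, ez_apply,
      if_neg e1.symm, if_neg e2, if_neg e2.symm, if_neg e4, if_neg e4.symm,
      if_true, lt_irrefl, if_false, Nat.lt_succ_self, n1, n2, add_zero, zero_add, one_mul, sub_self,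
      neg_zero, h.qSym_eq, qNum_eq, mul_add, mul_sub, mul_one, mul_zero, sub_zero, zero_sub,
      neg_mul, mul_neg, neg_neg, sub_neg_eq_add, zpow_add₀ hs, zpow_sub₀ hs, zpow_neg, zpow_mul',
      zpow_ofNat, zpow_one, Int.reduceMul]
    generalize s ^ ν a = A at *
    generalize s ^ ν a.rev = A' at *
    generalize s ^ ν b = B at *
    generalize s ^ out (lev a) ν = O at *
    clear e1 e2 e4 n1 n2 oa ob hl hr hr' ht hb hb' hc hab hN
    field_simp
    try ring

/-- The other pairs commute with the action of a simple root. -/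
lemma commute_lat_of_lev_ne {δ : Fin N → ℤ} {c : (Fin N → ℤ) → ℂ} {j : Fin N}
    (ht : tot δ = 0) (ho : out (lev j) δ = 0) (ho' : out (lev j + 1) δ = 0) (h1 : δ j = 0)
    (h2 : δ j.rev = 0) (hc : ∀ ν, c (ν + (ez j + ez j.rev)) = c ν) :
    Commute (sh δ c) (opU s j) ∧ Commute (sh δ c) (opD s j) := by
  have hc' : ∀ ν, c (ν + -(ez j + ez j.rev)) = c ν := fun ν => by
    rw [← hc, neg_add_cancel_right]
  refine ⟨commute_sh fun ν => ?_, commute_sh fun ν => ?_⟩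
  · rw [hc, uCo, uCo, map_add, map_add, ht, ho', add_zero, add_zero, mul_comm]
  · rw [hc', dCo, dCo, map_add, map_add, ht, ho, add_zero, add_zero, Pi.add_apply, Pi.add_apply, h1,
      h2, add_zero, add_zero, mul_comm]

lemma commute_other (s : ℂ) {a b : Fin N} (hab : Adj a b) {j : Fin N} (hja : lev j ≠ lev a)
    (hjb : lev j ≠ lev b) :
    Commute (latE s a b) (opU s j) ∧ Commute (latE s a b) (opD s j) ∧
    Commute (latF s a b) (opU s j) ∧ Commute (latF s a b) (opD s j) := by
  have hl := hab.lev_succ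
  have f : ∀ i : Fin N, lev j ≠ lev i → i ≠ j ∧ i ≠ j.rev ∧ i.rev ≠ j ∧ i.rev ≠ j.rev := by
    intro i hi
    refine ⟨ne_of_lev_ne hi.symm, ne_of_lev_ne ?_, ne_of_lev_ne ?_, ne_of_lev_ne ?_⟩ <;>
      simp only [lev_rev] <;> exact hi.symm
  obtain ⟨a1, a2, a3, a4⟩ := f a hja
  obtain ⟨b1, b2, b3, b4⟩ := f b hjb
  have o1 : lev a < lev j ↔ lev b < lev j := by omega
  have o2 : lev a < lev j + 1 ↔ lev b < lev j + 1 := by omega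
  have key : ∀ (i k : Fin N) (c : (Fin N → ℤ) → ℂ),
      (i = a ∨ i = b ∨ i = a.rev ∨ i = b.rev) → (k = a ∨ k = b ∨ k = a.rev ∨ k = b.rev) →
      (∀ ν, c (ν + (ez j + ez j.rev)) = c ν) →
      Commute (sh (ez i - ez k) c) (opU s j) ∧ Commute (sh (ez i - ez k) c) (opD s j) := by
    intro i k c hi hk hc
    have g : ∀ i : Fin N, (i = a ∨ i = b ∨ i = a.rev ∨ i = b.rev) →
        i ≠ j ∧ i ≠ j.rev ∧ (lev i < lev j ↔ lev a < lev j) ∧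
          (lev i < lev j + 1 ↔ lev a < lev j + 1) := by
      rintro i (h | h | h | h) <;> rw [h]
      · exact ⟨a1, a2, Iff.rfl, Iff.rfl⟩
      · exact ⟨b1, b2, o1.symm, o2.symm⟩
      · rw [lev_rev]; exact ⟨a3, a4, Iff.rfl, Iff.rfl⟩
      · rw [lev_rev]; exact ⟨b3, b4, o1.symm, o2.symm⟩
    obtain ⟨i1, i2, i3, i4⟩ := g i hi
    obtain ⟨k1, k2, k3, k4⟩ := g k hk
    refine commute_lat_of_lev_ne ?_ ?_ ?_ ?_ ?_ hc <;>
      simp [tot_ez, out_ez, ez_apply, i1.symm, i2.symm, k1.symm, k2.symm, i3, i4, k3, k4]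
  have hv : ∀ (ν : Fin N → ℤ) (i : Fin N), (i = a ∨ i = b ∨ i = a.rev ∨ i = b.rev) →
      (ν + (ez j + ez j.rev)) i = ν i := by
    rintro ν i (h | h | h | h) <;> rw [h]
    · simp [ez_apply, a1, a2]
    · simp [ez_apply, b1, b2]
    · simp [ez_apply, a3, a4]
    · simp [ez_apply, b3, b4]
  have ma : a = a ∨ a = b ∨ a = a.rev ∨ a = b.rev := Or.inl rfl
  have mb : b = a ∨ b = b ∨ b = a.rev ∨ b = b.rev := Or.inr (Or.inl rfl)
  have ma' : a.rev = a ∨ a.rev = b ∨ a.rev = a.rev ∨ a.rev = b.rev := Or.inr (Or.inr (Or.inl rfl))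
  have mb' : b.rev = a ∨ b.rev = b ∨ b.rev = a.rev ∨ b.rev = b.rev := Or.inr (Or.inr (Or.inr rfl))
  have va := fun ν => hv ν a ma
  have vb := fun ν => hv ν b mb
  have va' := fun ν => hv ν a.rev ma'
  have vb' := fun ν => hv ν b.rev mb'
  unfold latE latF
  split_ifs with hb
  · have k1 := key a b (fun ν => qNum s (ν b) * (s ^ (2 * (ν a - ν b)) * s ^ 3)) ma mb
      (fun ν => by simp only [va, vb])
    have k2 := key b a.rev (fun ν => qSym s (ν a.rev) * s ^ (2 * (ν a - ν a.rev + 1))) mb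
      ma' (fun ν => by simp only [va, va'])
    have k3 := key b a (fun ν => qSym s (ν a) * (s ^ (2 * (-ν a + ν a.rev)) * s)) mb
      ma (fun ν => by simp only [va, va'])
    have k4 := key a.rev b (fun ν => qNum s (ν b) * s ^ (2 * (-ν b + ν a.rev + 1))) ma'
      mb (fun ν => by simp only [vb, va'])
    exact ⟨k1.1.sub_left k2.1, k1.2.sub_left k2.2, k3.1.sub_left k4.1, k3.2.sub_left k4.2⟩
  · have k1 := key a b (fun ν => qSym s (ν b) * s ^ (2 * (ν a - ν b + 1))) ma mb
      (fun ν => by simp only [va, vb])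
    have k2 := key b.rev a.rev
      (fun ν => qSym s (ν a.rev) * s ^ (2 * (ν a - ν b - ν a.rev + ν b.rev + 1))) mb'
      ma' (fun ν => by simp only [va, va', vb, vb'])
    have k3 := key b a
      (fun ν => qSym s (ν a) * s ^ (2 * (-ν a + ν b - ν b.rev + ν a.rev + 1))) mb
      ma (fun ν => by simp only [va, va', vb, vb'])
    have k4 := key a.rev b.rev (fun ν => qSym s (ν b.rev) * s ^ (2 * (-ν b.rev + ν a.rev + 1)))
      ma' mb' (fun ν => by simp only [vb', va'])
    exact ⟨k1.1.sub_left k2.1, k1.2.sub_left k2.2, k3.1.sub_left k4.1, k3.2.sub_left k4.2⟩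

lemma IsSimpleRoot.adj {a b : Fin N} (hab : IsSimpleRoot a b) : Adj a b := by
  constructor
  · simp only [IsSimpleRoot, ne_eq, Fin.ext_iff, Fin.val_rev] at *; omega
  · simp only [IsSimpleRoot, lev, Fin.val_rev] at *; omega

/-- The squared radius and the Laplace operator are invariant under the generators of the quantum
algebra. -/
lemma commute_latE_latF (h : Generic s) {a b : Fin N} (hab : Adj a b) :
    Commute (latE s a b) (innerSum (opU s) 0) ∧ Commute (latE s a b) (innerSum (opD s) 0) ∧
    Commute (latF s a b) (innerSum (opU s) 0) ∧ Commute (latF s a b) (innerSum (opD s) 0) := by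
  have hl : lev a ≠ lev b := by rw [hab.lev_succ]; omega
  have hp : Commute (latE s a b) (opU s b + opU s a) ∧ Commute (latE s a b) (opD s a + opD s b) ∧
      Commute (latF s a b) (opU s a + opU s b) ∧ Commute (latF s a b) (opD s b + opD s a) := by
    by_cases hb : b = b.rev
    · exact commute_pair_mid h hab hb
    · exact commute_pair h hab hb
  rw [add_comm (opU s b), add_comm (opD s b)] at hp
  have ho := fun j h1 h2 => commute_other s hab (j := j) h1 h2
  exact ⟨commute_innerSum_of_pair opU_rev hl hp.1 fun j h1 h2 => (ho j h1 h2).1,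
    commute_innerSum_of_pair opD_rev hl hp.2.1 fun j h1 h2 => (ho j h1 h2).2.1,
    commute_innerSum_of_pair opU_rev hl hp.2.2.1 fun j h1 h2 => (ho j h1 h2).2.2.1,
    commute_innerSum_of_pair opD_rev hl hp.2.2.2 fun j h1 h2 => (ho j h1 h2).2.2.2⟩

lemma commute_diag {c : (Fin N → ℤ) → ℂ}
    (hc : ∀ (j : Fin N) (ν : Fin N → ℤ), c (ν + (ez j + ez j.rev)) = c ν) :
    Commute (sh 0 c) (innerSum (opU s) 0) ∧ Commute (sh 0 c) (innerSum (opD s) 0) := by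
  have h1 := fun j => commute_lat_of_lev_ne (s := s) (map_zero _) (map_zero _) (map_zero _) rfl rfl
    (hc j)
  exact ⟨commute_innerSum _ _ _ fun j _ _ => (h1 j).1, commute_innerSum _ _ _ fun j _ _ => (h1 j).2⟩

/-- The weight `ν_i - ν_{i'}` does not change when both exponents of a pair are raised. -/
lemma weight_add_pair (ν : Fin N → ℤ) (i j : Fin N) :
    (ν + (ez j + ez j.rev)) i - (ν + (ez j + ez j.rev)) i.rev = ν i - ν i.rev := by
  have h1 : i.rev = j ↔ i = j.rev := Fin.rev_eq_iff
  simp only [Pi.add_apply, ez_apply, h1, Fin.rev_inj]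
  ring

lemma commute_latK (s : ℂ) (z : ℤ) (a b : Fin N) :
    Commute (latK s z a b) (innerSum (opU s) 0) ∧ Commute (latK s z a b) (innerSum (opD s) 0) :=
  commute_diag fun j ν => by rw [weight_add_pair, weight_add_pair]

lemma commute_latKhat (s : ℂ) (z : ℤ) (i : Fin N) :
    Commute (latKhat s z i) (innerSum (opU s) 0) ∧ Commute (latKhat s z i) (innerSum (opD s) 0) :=
  commute_diag fun j ν => by rw [weight_add_pair]

/-! ### Degrees and commutation relations of the operators on `𝒜` -/

lemma innerSum_mem_latDeg {A : Fin N → Module.End ℂ (Lat N)} {d e : ℤ}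
    (hA : ∀ j, ∀ f ∈ latDeg N d, A j f ∈ latDeg N e) {f : Lat N} (hf : f ∈ latDeg N d) :
    innerSum A 0 f ∈ latDeg N e := by
  rw [innerSum, LinearMap.sum_apply]
  exact Submodule.sum_mem _ fun j _ => hA j f hf

lemma Qhat_mem_gr (h : Generic s) {d e : ℤ} (he : d + 2 = e) {p : Alg N s} (hp : p ∈ gr N h d) :
    Qhat N s p ∈ gr N h e := by
  change symb N h _ ∈ latDeg N e
  rw [symb_Qhat]
  have hδ : ∀ j : Fin N, d + tot (ez j + ez j.rev) = e := fun j => by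
    rw [map_add, tot_ez, tot_ez, ← he]; rfl
  exact Submodule.smul_mem _ _ (innerSum_mem_latDeg (fun j f hf => sh_mem_latDeg _ (hδ j) hf) hp)

lemma laplace_mem_gr (h : Generic s) {d e : ℤ} (he : d - 2 = e) {p : Alg N s}
    (hp : p ∈ gr N h d) : laplace N s p ∈ gr N h e := by
  change symb N h _ ∈ latDeg N e
  rw [symb_laplace]
  have hδ : ∀ j : Fin N, d + tot (-(ez j + ez j.rev)) = e := fun j => by
    rw [map_neg, map_add, tot_ez, tot_ez, ← he]; rfl
  exact Submodule.smul_mem _ _ (innerSum_mem_latDeg (fun j f hf => sh_mem_latDeg _ (hδ j) hf) hp)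

lemma Qhat_pow_mem_gr (h : Generic s) (k : ℕ) {d e : ℤ} (he : d + 2 * k = e) {p : Alg N s}
    (hp : p ∈ gr N h d) : (Qhat N s ^ k) p ∈ gr N h e := by
  induction k generalizing e with
  | zero => simpa [← he] using hp
  | succ k ih =>
    rw [pow_succ', Module.End.mul_apply]
    exact Qhat_mem_gr h (by push_cast at he; linarith) (ih rfl)

lemma laplace_pow_mem_gr (h : Generic s) (k : ℕ) {d e : ℤ} (he : d - 2 * k = e) {p : Alg N s}
    (hp : p ∈ gr N h d) : (laplace N s ^ k) p ∈ gr N h e := by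
  induction k generalizing e with
  | zero => simpa [← he] using hp
  | succ k ih =>
    rw [pow_succ', Module.End.mul_apply]
    exact laplace_mem_gr h (by push_cast at he; linarith) (ih rfl)

/-- The coefficient of `Q^{k-1} p` in `Δ_q Q^k p` for `p` of degree `d - 2 k`, and of `Δ_q^{k-1} p`
in `Δ_q^k Q p` for `p` of degree `d - 2`. -/
def radCo (N : ℕ) (q : ℂ) (k : ℕ) (d : ℤ) : ℂ :=
  (1 + q ^ ((N : ℤ) - 2)) ^ 2 / (q - q⁻¹) * ((1 - q ^ (2 * k)) / (1 - q ^ 2))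
    * (q ^ (2 * d - 2 * k) - q ^ (2 - (N : ℤ)))

lemma radCo_zero (q : ℂ) (d : ℤ) : radCo N q 0 d = 0 := by simp [radCo]

lemma Generic.one_sub_pow_ne (h : Generic s) {k : ℕ} (hk : 0 < k) : 1 - (s ^ 2) ^ k ≠ 0 :=
  sub_ne_zero.2 (h.pow_ne k hk).symm

/-- The coefficient for `k + 1` arises by moving one more factor through the relation for
`k = 1`. -/
lemma radCo_succ (h : Generic s) (k : ℕ) (d : ℤ) :
    radCo N (s ^ 2) (k + 1) (d + 2)
      = (s ^ 2) ^ 2 * radCo N (s ^ 2) k d + radCo N (s ^ 2) 1 (d + 2) := by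
  have hq : s ^ 2 ≠ 0 := pow_ne_zero 2 h.ne
  have h1 : 1 - (s ^ 2) ^ 2 ≠ 0 := h.one_sub_pow_ne two_pos
  have key : (1 - (s ^ 2) ^ (2 * (k + 1))) *
        ((s ^ 2) ^ (2 * (d + 2) - 2 * ((k + 1 : ℕ) : ℤ)) - (s ^ 2) ^ (2 - (N : ℤ)))
      = (s ^ 2) ^ 2 * ((1 - (s ^ 2) ^ (2 * k)) *
          ((s ^ 2) ^ (2 * d - 2 * (k : ℤ)) - (s ^ 2) ^ (2 - (N : ℤ))))
        + (1 - (s ^ 2) ^ 2) * ((s ^ 2) ^ (2 * (d + 2) - 2 * ((1 : ℕ) : ℤ))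
          - (s ^ 2) ^ (2 - (N : ℤ))) := by
    have e1 : 2 * (d + 2) - 2 * ((k + 1 : ℕ) : ℤ) = (2 * d - 2 * (k : ℤ)) + (2 : ℕ) := by
      push_cast; ring
    have e2 : 2 * (d + 2) - 2 * ((1 : ℕ) : ℤ)
        = (2 * d - 2 * (k : ℤ)) + (2 * k + 2 : ℕ) := by
      push_cast; ring
    rw [e1, e2, zpow_add₀ hq, zpow_add₀ hq, zpow_natCast, zpow_natCast]
    ring
  simp only [radCo, mul_one]
  have hX : ∀ X a b : ℂ, X * (a / (1 - (s ^ 2) ^ 2)) * b = X / (1 - (s ^ 2) ^ 2) * (a * b) :=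
    fun X a b => by ring
  rw [hX, hX, hX, key]
  ring

/-- The commutation relation of `Δ_q` and multiplication by `Q` on elements of degree `d`. -/
lemma laplace_Qhat (h : Generic s) {d : ℤ} {p : Alg N s} (hp : p ∈ gr N h d) :
    laplace N s (Qhat N s p)
      = (s ^ 2) ^ 2 • Qhat N s (laplace N s p) + radCo N (s ^ 2) 1 (d + 2) • p := by
  apply symb_injective h
  have h1 : 1 - (s ^ 2) ^ 2 ≠ 0 := h.one_sub_pow_ne two_pos
  simp only [map_add, map_smul, symb_laplace, symb_Qhat]
  rw [innerSum_opD_innerSum_opU_apply h hp]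
  have e0 : ((s ^ 2) ^ 2 : ℂ) = s ^ (4 : ℤ) := by
    rw [← pow_mul]; norm_cast
  have e1 : radCo N (s ^ 2) 1 (d + 2) = (1 + s ^ (2 * ((N : ℤ) - 2))) ^ 2 *
      ((s ^ (4 + 4 * d) - s ^ (-2 * ((N : ℤ) - 2))) / (s ^ 2 - (s ^ 2)⁻¹)) := by
    rw [radCo, mul_one, div_self h1, sq_zpow, sq_zpow, sq_zpow,
      show 2 * (2 * (d + 2) - 2 * ((1 : ℕ) : ℤ)) = 4 + 4 * d by push_cast; ring,
      show 2 * (2 - (N : ℤ)) = -2 * ((N : ℤ) - 2) by ring]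
    ring
  rw [e1, e0]
  module

/-! ### The projector -/

/-- `Δ_q Q^k p` for `p` of degree `d - 2 k`. -/
lemma laplace_Qhat_pow (h : Generic s) (k : ℕ) {d e : ℤ} (he : e + 2 * k = d) {p : Alg N s}
    (hp : p ∈ gr N h e) :
    laplace N s ((Qhat N s ^ k) p) = ((s ^ 2) ^ 2) ^ k • (Qhat N s ^ k) (laplace N s p)
      + radCo N (s ^ 2) k d • (Qhat N s ^ (k - 1)) p := by
  induction k generalizing d with
  | zero => simp [radCo_zero]
  | succ k ih =>
    have hd : d = e + 2 * k + 2 := by push_cast at he; linarith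
    rw [pow_succ', Module.End.mul_apply, laplace_Qhat h (Qhat_pow_mem_gr h k rfl hp), ih rfl, hd,
      radCo_succ h k, Nat.add_sub_cancel, map_add, map_smul, map_smul,
      Module.End.mul_apply, pow_succ' ((s ^ 2) ^ 2 : ℂ)]
    rcases k with _ | k
    · simp [radCo_zero]
    · rw [Nat.add_sub_cancel, pow_succ' (Qhat N s) k, Module.End.mul_apply, Module.End.mul_apply]
      module

/-- `Δ_q^k Q p` for `p` of degree `d - 2`. -/
lemma laplace_pow_Qhat (h : Generic s) (k : ℕ) {d e : ℤ} (he : e + 2 = d) {p : Alg N s}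
    (hp : p ∈ gr N h e) :
    (laplace N s ^ k) (Qhat N s p) = ((s ^ 2) ^ 2) ^ k • Qhat N s ((laplace N s ^ k) p)
      + radCo N (s ^ 2) k d • (laplace N s ^ (k - 1)) p := by
  induction k generalizing d e p with
  | zero => simp [radCo_zero]
  | succ k ih =>
    rw [pow_succ, Module.End.mul_apply, laplace_Qhat h hp, map_add, map_smul, map_smul,
      ih (d := e) (by ring) (laplace_mem_gr h rfl hp), ← he,
      radCo_succ h k, Nat.add_sub_cancel, Module.End.mul_apply,
      pow_succ ((s ^ 2) ^ 2 : ℂ)]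
    rcases k with _ | k
    · simp [radCo_zero]
    · rw [Nat.add_sub_cancel, pow_succ (laplace N s) k, Module.End.mul_apply, Module.End.mul_apply]
      module

/-- The recurrence that makes the telescoping sums for `Δ_q ∘ H_m` and `H_m ∘ Q` vanish. -/
lemma alpha_succ (h : Generic s) (hN : 0 < N) {m k : ℕ} (hk : k < m / 2) :
    alpha N (s ^ 2) m (k + 1) * radCo N (s ^ 2) (k + 1) m
      = -(alpha N (s ^ 2) m k * ((s ^ 2) ^ 2) ^ k) := by
  have hq : s ^ 2 ≠ 0 := pow_ne_zero 2 h.ne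
  have hκ : 1 + (s ^ 2) ^ ((N : ℤ) - 2) ≠ 0 := by rw [sq_zpow]; exact h.one_add_ne _
  have h2 : 1 - (s ^ 2) ^ 2 ≠ 0 := h.one_sub_pow_ne two_pos
  have hne : ∀ a : ℤ, a ≠ 0 → 1 - (s ^ 2) ^ a ≠ 0 := fun a ha => by
    rw [sq_zpow]; exact sub_ne_zero.2 (h.zpow_ne ha).symm
  have hinv : s ^ 2 - (s ^ 2)⁻¹ ≠ 0 := h.sub_inv_ne
  have hi2 : ∀ i : ℕ, ((s ^ 2) ^ 2) ^ i = (s ^ 2) ^ (2 * (i : ℤ)) := fun i => by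
    rw [← pow_mul]; norm_cast
  have hB : ∀ i : ℕ, 1 - (s ^ 2) ^ 2 * ((s ^ 2) ^ 2) ^ i ≠ 0 := fun i => by
    rw [← pow_succ', ← pow_mul]; exact h.one_sub_pow_ne (by positivity)
  -- the exponent `-N - 2 m + 4 + 2 i` is negative, since `2 i + 2 ≤ m`
  have hA : ∀ i : ℕ, i ≤ k →
      1 - (s ^ 2) ^ (-(N : ℤ) - 2 * m + 4) * ((s ^ 2) ^ 2) ^ i ≠ 0 := fun i hi => by
    rw [hi2, ← zpow_add₀ hq]; exact hne _ (by omega)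
  have hPA : qPoch ((s ^ 2) ^ (-(N : ℤ) - 2 * m + 4)) ((s ^ 2) ^ 2) k ≠ 0 :=
    Finset.prod_ne_zero_iff.2 fun i hi => hA i (Finset.mem_range.1 hi).le
  have hPB : qPoch ((s ^ 2) ^ 2) ((s ^ 2) ^ 2) k ≠ 0 :=
    Finset.prod_ne_zero_iff.2 fun i _ => hB i
  have hA' := hA k le_rfl
  have hB' := hB k
  have s1 : ∀ a b : ℂ, qPoch a b (k + 1) = qPoch a b k * (1 - a * b ^ k) := fun a b =>
    Finset.prod_range_succ _ _
  -- the powers of `q` in the two factors, relative to the exponents for `k`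
  have e1 : (s ^ 2) ^ (2 * ((k + 1 : ℕ) : ℤ) ^ 2 - 2 * m * ((k + 1 : ℕ) : ℤ) - ((k + 1 : ℕ) : ℤ))
      = (s ^ 2) ^ (2 * (k : ℤ) ^ 2 - 2 * m * k - k) * (s ^ 2) ^ (4 * (k : ℤ) + 1 - 2 * m) := by
    rw [← zpow_add₀ hq]; congr 1; push_cast; ring
  have e2 : (s ^ 2) ^ (2 * (m : ℤ) - 2 * ((k + 1 : ℕ) : ℤ)) - (s ^ 2) ^ (2 - (N : ℤ))
      = (s ^ 2) ^ (2 * (m : ℤ) - 2 * ((k + 1 : ℕ) : ℤ)) *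
        (1 - (s ^ 2) ^ (-(N : ℤ) - 2 * m + 4) * ((s ^ 2) ^ 2) ^ k) := by
    rw [hi2, mul_sub, mul_one, ← zpow_add₀ hq, ← zpow_add₀ hq]
    congr 2; push_cast; ring
  have e3 : (s ^ 2) ^ (4 * (k : ℤ) + 1 - 2 * m) * (s ^ 2) ^ (2 * (m : ℤ) - 2 * ((k + 1 : ℕ) : ℤ))
      * (1 - (s ^ 2) ^ 2) = -((s ^ 2 - (s ^ 2)⁻¹) * ((s ^ 2) ^ 2) ^ k) := by
    rw [← zpow_add₀ hq, hi2, show 4 * (k : ℤ) + 1 - 2 * m + (2 * (m : ℤ) - 2 * ((k + 1 : ℕ) : ℤ))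
      = 2 * (k : ℤ) + -1 by push_cast; ring, zpow_add₀ hq, zpow_neg_one]
    field_simp
    ring
  have e4 : (1 : ℂ) - (s ^ 2) ^ (2 * (k + 1)) = 1 - (s ^ 2) ^ 2 * ((s ^ 2) ^ 2) ^ k := by
    rw [← pow_succ', ← pow_mul _ 2 (k + 1)]
  simp only [alpha, radCo, s1, e1, e2, e4]
  generalize (s ^ 2) ^ (4 * (k : ℤ) + 1 - 2 * m) = u at *
  generalize (s ^ 2) ^ (2 * (m : ℤ) - 2 * ((k + 1 : ℕ) : ℤ)) = v at *
  generalize (s ^ 2) ^ (2 * (k : ℤ) ^ 2 - 2 * m * k - k) = w at *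
  generalize 1 - (s ^ 2) ^ (-(N : ℤ) - 2 * m + 4) * ((s ^ 2) ^ 2) ^ k = A at *
  generalize 1 - (s ^ 2) ^ 2 * ((s ^ 2) ^ 2) ^ k = B at *
  generalize qPoch ((s ^ 2) ^ (-(N : ℤ) - 2 * m + 4)) ((s ^ 2) ^ 2) k = PA at *
  generalize qPoch ((s ^ 2) ^ 2) ((s ^ 2) ^ 2) k = PB at *
  generalize 1 + (s ^ 2) ^ ((N : ℤ) - 2) = κ at *
  generalize s ^ 2 - (s ^ 2)⁻¹ = c at *
  generalize ((s ^ 2) ^ 2) ^ k = t at *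
  generalize 1 - (s ^ 2) ^ 2 = b at *
  rw [show 2 * (k + 1) = 2 * k + 2 by ring, pow_add, pow_add]
  field_simp
  linear_combination w * e3

/-- The operator `∑_k α_k Q^k Δ_q^k`. -/
def projOp (N : ℕ) (s : ℂ) (m : ℕ) : Module.End ℂ (Alg N s) :=
  ∑ k ∈ Finset.range (m / 2 + 1), alpha N (s ^ 2) m k • (Qhat N s ^ k * laplace N s ^ k)

lemma projOp_apply (m : ℕ) (p : Alg N s) :
    projOp N s m p = ∑ k ∈ Finset.range (m / 2 + 1),
      alpha N (s ^ 2) m k • (Qhat N s ^ k) ((laplace N s ^ k) p) := by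
  simp [projOp, LinearMap.sum_apply]

lemma sum_telescope {M : Type*} [AddCommGroup M] (a b : ℕ → M) (n : ℕ) (h0 : b 0 = 0)
    (hb : ∀ k < n, b (k + 1) = -a k) (hn : a n = 0) :
    ∑ k ∈ Finset.range (n + 1), (a k + b k) = 0 := by
  rw [Finset.sum_add_distrib, Finset.sum_range_succ, Finset.sum_range_succ' b, h0, hn,
    Finset.sum_congr rfl fun k hk => hb k (Finset.mem_range.1 hk)]
  simp

lemma laplace_projOp (h : Generic s) (hN : 0 < N) {m : ℕ} {p : Alg N s} (hp : p ∈ gr N h m) :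
    laplace N s (projOp N s m p) = 0 := by
  -- the last term of the telescoping sum has negative degree after the Laplace operators
  have hneg : (laplace N s ^ (m / 2 + 1)) p = 0 := by
    have := laplace_pow_mem_gr h (m / 2 + 1) rfl hp
    rwa [gr_eq_bot h (by omega), Submodule.mem_bot] at this
  rw [projOp_apply, map_sum]
  simp only [map_smul]
  have e : ∀ k : ℕ, alpha N (s ^ 2) m k • laplace N s ((Qhat N s ^ k) ((laplace N s ^ k) p))
      = (alpha N (s ^ 2) m k * ((s ^ 2) ^ 2) ^ k) • (Qhat N s ^ k) ((laplace N s ^ (k + 1)) p)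
        + (alpha N (s ^ 2) m k * radCo N (s ^ 2) k m)
          • (Qhat N s ^ (k - 1)) ((laplace N s ^ k) p) := fun k => by
    rw [laplace_Qhat_pow h k (d := m) (by ring) (laplace_pow_mem_gr h k rfl hp), smul_add,
      smul_smul, smul_smul, pow_succ' (laplace N s), Module.End.mul_apply]
  simp only [e]
  refine sum_telescope _ _ _ (by simp [radCo_zero]) (fun k hk => ?_) (by rw [hneg]; simp)
  rw [alpha_succ h hN hk, neg_smul, Nat.add_sub_cancel]

lemma projOp_Qhat (h : Generic s) (hN : 0 < N) {m : ℕ} {p : Alg N s}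
    (hp : p ∈ gr N h ((m : ℤ) - 2)) :
    projOp N s m (Qhat N s p) = 0 := by
  -- the last term of the telescoping sum has negative degree after the Laplace operators
  have hneg : (laplace N s ^ (m / 2)) p = 0 := by
    have := laplace_pow_mem_gr h (m / 2) rfl hp
    rwa [gr_eq_bot h (by omega), Submodule.mem_bot] at this
  rw [projOp_apply]
  have e : ∀ k : ℕ, alpha N (s ^ 2) m k • (Qhat N s ^ k) ((laplace N s ^ k) (Qhat N s p))
      = (alpha N (s ^ 2) m k * ((s ^ 2) ^ 2) ^ k) • (Qhat N s ^ (k + 1)) ((laplace N s ^ k) p)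
        + (alpha N (s ^ 2) m k * radCo N (s ^ 2) k m)
          • (Qhat N s ^ k) ((laplace N s ^ (k - 1)) p) := fun k => by
    rw [laplace_pow_Qhat h k (d := m) (by ring) hp, map_add, map_smul, map_smul, smul_add,
      smul_smul, smul_smul, pow_succ (Qhat N s), Module.End.mul_apply]
  simp only [e]
  refine sum_telescope _ _ _ (by simp [radCo_zero]) (fun k hk => ?_) (by rw [hneg]; simp)
  rw [alpha_succ h hN hk, neg_smul, Nat.add_sub_cancel]

lemma radial_eq_map (h : Generic s) (m : ℕ) :
    radial N s m = (gr N h ((m : ℤ) - 2)).map (Qhat N s) := by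
  match m with
  | 0 => rw [gr_eq_bot h (by norm_num), Submodule.map_bot]; rfl
  | 1 => rw [gr_eq_bot h (by norm_num), Submodule.map_bot]; rfl
  | m + 2 => rw [radial, homog_eq_gr h]; congr 2; push_cast; ring

lemma sub_projOp_mem_radial (h : Generic s) {m : ℕ} {p : Alg N s} (hp : p ∈ gr N h m) :
    p - projOp N s m p ∈ radial N s m := by
  rw [projOp_apply, Finset.sum_range_succ', radial_eq_map h]
  have h0 : alpha N (s ^ 2) m 0 • (Qhat N s ^ 0) ((laplace N s ^ 0) p) = p := by
    simp [alpha, qPoch]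
  rw [h0, sub_add_cancel_right]
  refine neg_mem (Submodule.sum_mem _ fun k _ => Submodule.smul_mem _ _ ?_)
  rw [pow_succ' (Qhat N s), Module.End.mul_apply]
  exact Submodule.mem_map_of_mem
    (Qhat_pow_mem_gr h k (by push_cast; ring) (laplace_pow_mem_gr h (k + 1) rfl hp))

lemma projOp_mem_homog (h : Generic s) {m : ℕ} {p : Alg N s} (hp : p ∈ homog N s m) :
    projOp N s m p ∈ homog N s m := by
  rw [homog_eq_gr h] at *
  rw [projOp_apply]
  exact Submodule.sum_mem _ fun k _ => Submodule.smul_mem _ _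
    (Qhat_pow_mem_gr h k (by ring) (laplace_pow_mem_gr h k rfl hp))

lemma projOp_of_harm {m : ℕ} {p : Alg N s} (hp : laplace N s p = 0) : projOp N s m p = p := by
  rw [projOp_apply, Finset.sum_range_succ', Finset.sum_eq_zero fun k _ => ?_]
  · simp [alpha, qPoch]
  · rw [pow_succ (laplace N s), Module.End.mul_apply, hp, map_zero, map_zero, smul_zero]

lemma projOp_mem_harm (h : Generic s) (hN : 0 < N) {m : ℕ} {p : Alg N s} (hp : p ∈ homog N s m) :
    projOp N s m p ∈ harm N s m :=
  ⟨projOp_mem_homog h hp, laplace_projOp h hN (homog_eq_gr h m ▸ hp)⟩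

/-- The two spaces are complementary because the operator `projOp N s m` maps `𝒜_m` into `ℋ_m`, is the
identity on `ℋ_m`, vanishes on `Q 𝒜_{m-2}`, and differs from the identity by elements of `Q 𝒜_{m-2}`. -/
theorem decomposition (h : Generic s) (hN : 0 < N) (m : ℕ) : Decomposition N s m := by
  refine ⟨?_, ?_, ?_⟩
  · rw [radial_eq_map h, homog_eq_gr h]
    rintro _ ⟨p, hp, rfl⟩
    exact Qhat_mem_gr h (by ring) hp
  · rw [Submodule.disjoint_def]
    intro p hp1 hp2
    have h1 : (p : Alg N s) ∈ harm N s m := hp1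
    have h2 : (p : Alg N s) ∈ radial N s m := hp2
    rw [radial_eq_map h] at h2
    obtain ⟨r, hr, hrp⟩ := h2
    apply Subtype.ext
    rw [← projOp_of_harm (m := m) h1.2, ← hrp]
    exact projOp_Qhat h hN hr
  · rw [codisjoint_iff, eq_top_iff]
    intro p _
    have hp : projOp N s m p ∈ harm N s m := projOp_mem_harm h hN p.2
    refine Submodule.mem_sup.2 ⟨⟨_, hp.1⟩, hp, p - ⟨_, hp.1⟩, ?_, by simp⟩
    exact sub_projOp_mem_radial h (homog_eq_gr h m ▸ p.2)

lemma projector_apply (h : Generic s) (hN : 0 < N) {m : ℕ} (hd : Decomposition N s m)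
    (p : homog N s m) :
    (projector hd p : Alg N s) = projOp N s m p := by
  have hp : projOp N s m p ∈ harm N s m := projOp_mem_harm h hN p.2
  have hr : (p : Alg N s) - projOp N s m p ∈ radial N s m :=
    sub_projOp_mem_radial h (homog_eq_gr h m ▸ p.2)
  have e1 : p = ⟨projOp N s m p, hp.1⟩ + (p - ⟨projOp N s m p, hp.1⟩) := by simp
  have e2 : projector hd p = ⟨projOp N s m p, hp.1⟩ := by
    rw [projector]
    conv_lhs => rw [e1]
    rw [map_add, Submodule.projection_apply_of_mem_left hd.2 hp,
      Submodule.projection_apply_of_mem_right hd.2 hr, add_zero]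
  rw [e2]

/-! ### The projector commutes with the quantum algebra -/

/-- The algebra of operators on `𝒜` that preserve the degree and commute with `Q` and `Δ_q`. -/
def invOperators (N : ℕ) (s : ℂ) : Subalgebra ℂ (Module.End ℂ (Alg N s)) where
  carrier := {T | (∀ m, ∀ p ∈ homog N s m, T p ∈ homog N s m) ∧ Commute T (Qhat N s) ∧
    Commute T (laplace N s)}
  mul_mem' := fun hS hT => ⟨fun m p hp => hS.1 m _ (hT.1 m p hp), hS.2.1.mul_left hT.2.1,
    hS.2.2.mul_left hT.2.2⟩
  add_mem' := fun hS hT => ⟨fun m p hp => add_mem (hS.1 m p hp) (hT.1 m p hp),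
    hS.2.1.add_left hT.2.1, hS.2.2.add_left hT.2.2⟩
  algebraMap_mem' := fun c => ⟨fun m p hp => by
      rw [Module.algebraMap_end_apply]; exact Submodule.smul_mem _ _ hp,
    Algebra.commutes c _, Algebra.commutes c _⟩

lemma commute_projOp {T : Module.End ℂ (Alg N s)} (hT : T ∈ invOperators N s) (m : ℕ) :
    Commute T (projOp N s m) :=
  Commute.sum_right _ _ _ fun _ _ =>
    ((hT.2.1.pow_right _).mul_right (hT.2.2.pow_right _)).smul_right _

/-- Membership in `invOperators` can be checked on functions on the lattice. -/
lemma mem_invOperators (h : Generic s) {T : Module.End ℂ (Alg N s)} {A : Module.End ℂ (Lat N)}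
    (hTA : ∀ p, symb N h (T p) = A (symb N h p)) (hA : ∀ d, ∀ f ∈ latDeg N d, A f ∈ latDeg N d)
    (hU : Commute A (innerSum (opU s) 0)) (hD : Commute A (innerSum (opD s) 0)) :
    T ∈ invOperators N s := by
  refine ⟨fun m p hp => ?_, LinearMap.ext fun p => symb_injective h ?_,
    LinearMap.ext fun p => symb_injective h ?_⟩
  · rw [homog_eq_gr h] at *
    change symb N h _ ∈ latDeg N m
    rw [hTA]
    exact hA _ _ hp
  · rw [Module.End.mul_apply, Module.End.mul_apply, hTA, symb_Qhat, symb_Qhat, hTA, map_smul]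
    exact congrArg _ (LinearMap.congr_fun hU.eq _)
  · rw [Module.End.mul_apply, Module.End.mul_apply, hTA, symb_laplace, symb_laplace, hTA, map_smul]
    exact congrArg _ (LinearMap.congr_fun hD.eq _)

lemma sh_sub_mem_latDeg {i j k l : Fin N} {c c' : (Fin N → ℤ) → ℂ} {d : ℤ} {f : Lat N}
    (hf : f ∈ latDeg N d) :
    (sh (ez i - ez j) c - sh (ez k - ez l) c') f ∈ latDeg N d :=
  sub_mem (sh_mem_latDeg c (by simp [tot_ez]) hf) (sh_mem_latDeg c' (by simp [tot_ez]) hf)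

lemma genOp_mem (h : Generic s) (g : UGen N) : genOp s g ∈ invOperators N s := by
  have hK : ∀ z (α : SimpleRoot N), opK s z α.1.1 α.1.2 ∈ invOperators N s := fun z α =>
    mem_invOperators h (symb_opK h z _ _) (fun d f hf => sh_mem_latDeg _ (by simp) hf)
      (commute_latK s z _ _).1 (commute_latK s z _ _).2
  match g with
  | .K α => exact hK 1 α
  | .Kinv α => exact hK (-1) α
  | .E α =>
    have hc := commute_latE_latF h α.2.adj
    refine mem_invOperators h (symb_opE h _ _) (fun d f hf => ?_) hc.1 hc.2.1
    unfold latE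
    split_ifs <;> exact sh_sub_mem_latDeg hf
  | .F α =>
    have hc := commute_latE_latF h α.2.adj
    refine mem_invOperators h (symb_opF h _ _) (fun d f hf => ?_) hc.2.2.1 hc.2.2.2
    unfold latF
    split_ifs <;> exact sh_sub_mem_latDeg hf

lemma opKhat_mem (h : Generic s) (z : ℤ) (i : Fin N) : opKhat s z i ∈ invOperators N s :=
  mem_invOperators h (symb_opKhat h z i) (fun _ _ hf => sh_mem_latDeg _ (by simp) hf)
    (commute_latKhat s z i).1 (commute_latKhat s z i).2

lemma uqOperators_le (h : Generic s) : uqOperators N s ≤ invOperators N s := by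
  refine Algebra.adjoin_le ?_
  rintro T (⟨g, rfl⟩ | ⟨i, _, rfl | rfl⟩)
  · exact genOp_mem h g
  · exact opKhat_mem h 1 i
  · exact opKhat_mem h (-1) i

lemma projector_mul_restrict (h : Generic s) (hN : 0 < N) {m : ℕ} (hd : Decomposition N s m)
    {T : Module.End ℂ (Alg N s)} (hT : T ∈ invOperators N s) :
    projector hd * T.restrict (hT.1 m) = T.restrict (hT.1 m) * projector hd := by
  refine LinearMap.ext fun p => Subtype.ext ?_
  rw [Module.End.mul_apply, Module.End.mul_apply, projector_apply h hN, LinearMap.coe_restrict_apply,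
    LinearMap.coe_restrict_apply, projector_apply h hN]
  exact (LinearMap.congr_fun (commute_projOp hT m).eq _).symm

/-- A representation of `U_q(so_N)` in which the generators preserve the degree and commute with
`Q` and `Δ_q` has these properties on all elements. -/
lemma map_mem_invOperators (h : Generic s) {L : Uq N s →ₐ[ℂ] Module.End ℂ (Alg N s)}
    (hL : ∀ g : UGen N, L (Uq.gen s g) = genOp s g) (X : Uq N s) : L X ∈ invOperators N s := by
  obtain ⟨f, rfl⟩ := RingCon.mkₐ_surjective (α := ℂ) _ X
  induction f using FreeAlgebra.induction with
  | grade0 c => rw [AlgHom.commutes, AlgHom.commutes]; exact Subalgebra.algebraMap_mem _ c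
  | grade1 g => exact (hL g).symm ▸ genOp_mem h g
  | mul a b ha hb => rw [map_mul, map_mul]; exact mul_mem ha hb
  | add a b ha hb => rw [map_add, map_add]; exact add_mem ha hb

end QEuclid

theorem mainTheorem3 (N : ℕ) (hN : 2 ≤ N) (q s : ℂ) (hs : s ^ 2 = q) (hq0 : q ≠ 0)
    (hq : ∀ r : ℕ, 0 < r → q ^ r ≠ 1) (m : ℕ) :
    ∃ hd : QEuclid.Decomposition N s m,
      (∀ p : QEuclid.homog N s m,
        (QEuclid.projector hd p : QEuclid.Alg N s) =
          ∑ k ∈ Finset.range (m / 2 + 1),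
            QEuclid.alpha N q m k •
              ((QEuclid.Qhat N s ^ k) ((QEuclid.laplace N s ^ k) (p : QEuclid.Alg N s)))) ∧
      QEuclid.projector hd * QEuclid.projector hd = QEuclid.projector hd ∧
      (∀ T ∈ QEuclid.uqOperators N s,
        ∃ hT : ∀ p ∈ QEuclid.homog N s m, T p ∈ QEuclid.homog N s m,
          QEuclid.projector hd * T.restrict hT = T.restrict hT * QEuclid.projector hd) ∧
      (∀ L : QEuclid.Uq N s →ₐ[ℂ] Module.End ℂ (QEuclid.Alg N s),
        (∀ g : QEuclid.UGen N, L (QEuclid.Uq.gen s g) = QEuclid.genOp s g) →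
        ∀ X : QEuclid.Uq N s,
          ∃ hX : ∀ p ∈ QEuclid.homog N s m, L X p ∈ QEuclid.homog N s m,
            QEuclid.projector hd * (L X).restrict hX
              = (L X).restrict hX * QEuclid.projector hd) := by
  subst hs
  have hN' : 0 < N := by omega
  have h : QEuclid.Generic s := ⟨fun h0 => hq0 (by simp [h0]), hq⟩
  refine ⟨QEuclid.decomposition h hN' m, fun p => ?_, ?_, fun T hT => ?_, fun L hL X => ?_⟩
  · rw [QEuclid.projector_apply h hN', QEuclid.projOp_apply]
  · refine LinearMap.ext fun p => Subtype.ext ?_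
    rw [Module.End.mul_apply, QEuclid.projector_apply h hN' _ (QEuclid.projector _ p),
      QEuclid.projector_apply h hN']
    exact QEuclid.projOp_of_harm (QEuclid.projOp_mem_harm h hN' p.2).2
  · exact ⟨_, QEuclid.projector_mul_restrict h hN' _ (QEuclid.uqOperators_le h hT)⟩
  · exact ⟨_, QEuclid.projector_mul_restrict h hN' _ (QEuclid.map_mem_invOperators h hL X)⟩

end
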